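/- **Setting.** Let $\mathbb F=\mathbb F_{2^q}$, write the bits of a field element as its coordinates in a basis of $\mathbb F$ over $\mathbb F_2$, and let $\mathbf H\in\mathbb F^{m\times n}$ be a parity-check matrix whose $j$-th row has $d_j\ge 3$ nonzero entries. Each check $h_{1}c_{\sigma_1}+\dots+h_{d}c_{\sigma_d}=0$ ($d=d_j$) is decomposed, with $d-3$ auxiliary symbols $g_t$, into the $d-2$ three-variable checks $h_1c_{\sigma_1}+h_2c_{\sigma_2}+g_1=0$, $g_{t-1}+h_{t+1}c_{\sigma_{t+1}}+g_t=0$ ($2\le t\le d-3$), $g_{d-3}+h_{d-1}c_{\sigma_{d-1}}+h_dc_{\sigma_d}=0$ (if $d=3$ the check is kept as it is). Let $\Gamma_c=\sum_j(d_j-2)$ and $\Gamma_a=\sum_j(d_j-3)$. Symbols are embedded in real space with one coordinate for each $\sigma\in\mathbb F\setminus\{0\}$ (Flanagan embedding, $\kappa=2^q-1$ coordinates) or for each $\sigma\in\mathbb F$ (Constant-Weight embedding, $\kappa=2^q$). For $h\ne0$ let $\mathbf D(h)$ be the 0/1 matrix with $\mathbf D(h)_{\sigma\sigma'}=1$ iff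 $\sigma=\sigma'h$; for a nonempty set $K$ of bit positions let $\hat{\mathbf b}_K$ be the 0/1 row vector whose $\sigma$-entry is the sum modulo 2 of the bits of $\sigma$ in $K$. With $$\mathbf P=\begin{bmatrix}1&-1&-1\\-1&1&-1\\-1&-1&1\\1&1&1\end{bmatrix},\qquad \mathbf t=\begin{bmatrix}0\\0\\0\\2\end{bmatrix},$$ let $\hat{\mathbf W}_\tau$ stack, over all $K$, the blocks $\mathbf P\,\mathrm{diag}(\hat{\mathbf b}_K,\hat{\mathbf b}_K,\hat{\mathbf b}_K)\,\mathrm{diag}(\mathbf D(h_1),\mathbf D(h_2),\mathbf D(h_3))$, where $h_1,h_2,h_3$ are the coefficients of the $\tau$-th three-variable check, let $\mathbf Q_\tau\in\{0,1\}^{3\times(n+\Gamma_a)}$ select its three symbols, and let $\mathbf S=\mathrm{diag}(\mathbf 1_\kappa^T,\dots,\mathbf 1_\kappa^T)$. Put $$\mathbf A=[\hat{\mathbf W}_1(\mathbf Q_1\otimes\mathbf I_\kappa);\dots;\hat{\mathbf W}_{\Gamma_c}(\mathbf Q_{\Gamma_c}\otimes\mathbf I_\kappa);\mathbf S]\in\mathbb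 R^{M\times N},\qquad \boldsymbol\varrho=[\mathbf t;\dots;\mathbf t;\mathbf 1_{n+\Gamma_a}],\qquad \boldsymbol\lambda=[\boldsymbol\gamma;\mathbf 0],$$ where $\boldsymbol\gamma\in\mathbb R^{n\kappa}$ is the cost (log-likelihood) vector of the received word. The decoding model is $$\min_{\mathbf v}\ g(\mathbf v)=\boldsymbol\lambda^T\mathbf v-\tfrac{\alpha}{2}\|\mathbf v-0.5\|_2^2\quad\text{over } X=\{\mathbf v\in[0,1]^N:\ \mathbf A\mathbf v\preceq\boldsymbol\varrho\},$$ where for the Constant-Weight embedding the rows of $\mathbf S$ are equalities $\mathbf S\mathbf v=\mathbf 1$. Let $E$ be the set of $\mathbf e_1\succeq\mathbf 0$ in $\mathbb R^M$, with, for the Constant-Weight embedding, zero entries in the rows of $\mathbf S$. Put $$\mathcal L_\mu(\mathbf v,\mathbf e_1,\mathbf e_2,\mathbf y_1,\mathbf y_2)=g(\mathbf v)+\mathbf y_1^T(\mathbf A\mathbf v+\mathbf e_1-\boldsymbol\varrho)+\mathbf y_2^T(\mathbf v-\mathbf e_2)+\tfrac\mu2\|\mathbf A\mathbf v+\mathbf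 e_1-\boldsymbol\varrho\|_2^2+\tfrac\mu2\|\mathbf v-\mathbf e_2\|_2^2 .$$ The proximal-ADMM decoder with parameters $\alpha,\rho,\mu$ and $\beta\in(0,1]$ starts from all-zeros vectors and iterates $$\begin{aligned} \mathbf v^{k+1}&=\arg\min_{\mathbf v}\ \mathcal L_\mu(\mathbf v,\mathbf e_1^k,\mathbf e_2^k,\mathbf y_1^k,\mathbf y_2^k)+\tfrac\rho2\|\mathbf v-\mathbf p^k\|_2^2,\\ \mathbf e_1^{k+1}&=\arg\min_{\mathbf e_1\in E}\ \mathcal L_\mu(\mathbf v^{k+1},\mathbf e_1,\mathbf e_2^k,\mathbf y_1^k,\mathbf y_2^k)+\tfrac\rho2\|\mathbf e_1-\mathbf z_1^k\|_2^2,\\ \mathbf e_2^{k+1}&=\arg\min_{\mathbf e_2\in[0,1]^N}\ \mathcal L_\mu(\mathbf v^{k+1},\mathbf e_1^k,\mathbf e_2,\mathbf y_1^k,\mathbf y_2^k)+\tfrac\rho2\|\mathbf e_2-\mathbf z_2^k\|_2^2,\\ \mathbf p^{k+1}&=\mathbf p^k+\beta(\mathbf v^{k+1}-\mathbf p^k),\qquad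 \mathbf z_i^{k+1}=\mathbf z_i^k+\beta(\mathbf e_i^{k+1}-\mathbf z_i^k)\quad(i=1,2),\\ \mathbf y_1^{k+1}&=\mathbf y_1^k+\mu(\mathbf A\mathbf v^{k+1}+\mathbf e_1^{k+1}-\boldsymbol\varrho),\qquad \mathbf y_2^{k+1}=\mathbf y_2^k+\mu(\mathbf v^{k+1}-\mathbf e_2^{k+1}). \end{aligned}$$ **Theorem.** Take either embedding and any $\boldsymbol\gamma$. Let $\rho>\alpha>0$, let $\delta$ be the spectral norm of $\begin{bmatrix}\mathbf A&\mathbf I_M&\mathbf 0\\\mathbf I_N&\mathbf 0&-\mathbf I_N\end{bmatrix}$ and let $L$ be a Lipschitz constant on $X$ of $\nabla_{\mathbf v}\mathcal L_\mu$. Assume $\lambda_{\min}(\mathbf A^T\mathbf A)>0$ and $$\frac{\alpha}{\lambda_{\min}(\mathbf A^T\mathbf A)}\le\mu\le\frac{\rho(\rho-\alpha)^2}{4\delta^2(\rho+L+2)^2-(\rho-\alpha)^2}.$$ Then there is $\beta_0\in(0,1]$, depending only on the data and parameters above, such that for every $\beta\in(0,\beta_0)$ all eight sequences $\mathbf v^k,\mathbf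 e_1^k,\mathbf e_2^k,\mathbf p^k,\mathbf z_1^k,\mathbf z_2^k,\mathbf y_1^k,\mathbf y_2^k$ generated by the decoder converge, and their limits satisfy $\mathbf A\mathbf v^*+\mathbf e_1^*=\boldsymbol\varrho$, $\mathbf v^*=\mathbf e_2^*=\mathbf p^*$, $\mathbf e_1^*=\mathbf z_1^*$ and $\mathbf e_2^*=\mathbf z_2^*$. Moreover $\mathbf v^*$ is a stationary point of the decoding model: $\mathbf v^*\in X$ and $(\mathbf v-\mathbf v^*)^T\nabla g(\mathbf v^*)\ge0$ for all $\mathbf v\in X$. -/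

import Mathlib

open Filter Topology
open scoped NNReal Kronecker

noncomputable section

namespace ProxADMM

/-! ### The two embeddings of field symbols into real space -/

/-- The two ways of embedding the elements of the field into binary vectors: the Flanagan
embedding has one coordinate for every nonzero element (zero is sent to the zero vector), the
constant-weight embedding has one coordinate for every element. -/
inductive Embedding where
  | flanagan
  | constantWeight
  deriving DecidableEq

/-- The coordinates of an embedded symbol. -/
abbrev Idx (F : Type*) [Zero F] (emb : Embedding) : Type _ :=
  {σ : F // emb = Embedding.constantWeight ∨ σ ≠ 0}

section Code

variable {F : Type*} [Field F] [Fintype F] [DecidableEq F] {m n q : ℕ}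

/-! ### Decomposition of the parity checks into three-variable checks -/

/-- The variables involved in the `j`-th parity check. -/
def support (H : Matrix (Fin m) (Fin n) F) (j : Fin m) : Finset (Fin n) :=
  Finset.univ.filter fun i => H j i ≠ 0

/-- The number of variables involved in the `j`-th parity check. -/
def checkDegree (H : Matrix (Fin m) (Fin n) F) (j : Fin m) : ℕ := (support H j).card

/-- The `i`-th variable (counted from zero, in increasing order) of the `j`-th parity check. -/
def checkVar (H : Matrix (Fin m) (Fin n) F) (j : Fin m) (i : Fin (checkDegree H j)) : Fin n :=
  (support H j).orderEmbOfFin rfl i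

/-- The symbols: the `n` code symbols, and `d - 3` auxiliary symbols for every parity check
involving `d` variables. -/
abbrev Sym (H : Matrix (Fin m) (Fin n) F) : Type :=
  Fin n ⊕ (Σ j : Fin m, Fin (checkDegree H j - 3))

/-- The three-variable checks: `d - 2` for every parity check involving `d` variables. -/
abbrev Eqn (H : Matrix (Fin m) (Fin n) F) : Type :=
  Σ j : Fin m, Fin (checkDegree H j - 2)

/-- The three (symbol, coefficient) pairs of a three-variable check. If the parity check is
`h₀ c₀ + ⋯ + h_{d-1} c_{d-1} = 0` with auxiliary symbols `g₀, …, g_{d-4}`, then the three-variable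
checks are `h₀ c₀ + h₁ c₁ + g₀ = 0`, `g_{t-1} + h_{t+1} c_{t+1} + g_t = 0` for `1 ≤ t ≤ d - 4` and
`g_{d-4} + h_{d-2} c_{d-2} + h_{d-1} c_{d-1} = 0`; for `d = 3` there is just the parity check. -/
def triple (H : Matrix (Fin m) (Fin n) F) (τ : Eqn H) : Fin 3 → Sym H × F :=
  have hτ := τ.2.isLt
  ![if h : τ.2.val = 0 then
      (let i := checkVar H τ.1 ⟨0, by omega⟩; (Sum.inl i, H τ.1 i))
    else (Sum.inr ⟨τ.1, ⟨τ.2.val - 1, by omega⟩⟩, 1),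
    (let i := checkVar H τ.1 ⟨τ.2.val + 1, by omega⟩; (Sum.inl i, H τ.1 i)),
    if h : τ.2.val + 3 = checkDegree H τ.1 then
      (let i := checkVar H τ.1 ⟨τ.2.val + 2, by omega⟩; (Sum.inl i, H τ.1 i))
    else (Sum.inr ⟨τ.1, ⟨τ.2.val, by omega⟩⟩, 1)]

/-- The variable-selecting matrix `Q_τ`. -/
def selectMatrix (H : Matrix (Fin m) (Fin n) F) (τ : Eqn H) : Matrix (Fin 3) (Sym H) ℝ :=
  Matrix.of fun k s => if (triple H τ k).1 = s then 1 else 0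

/-! ### The real inequalities of a three-variable check -/

/-- The matrix `D(2^q, h)` of multiplication by `h` (for the constant-weight embedding, with the
additional row and column of the zero element). -/
def rotation (emb : Embedding) (h : F) : Matrix (Idx F emb) (Idx F emb) ℝ :=
  Matrix.of fun i j => if (i : F) = (j : F) * h then 1 else 0

/-- The matrix `D = diag(D(2^q, h₁), D(2^q, h₂), D(2^q, h₃))`. -/
def rotationBlock (emb : Embedding) (h : Fin 3 → F) :
    Matrix (Fin 3 × Idx F emb) (Fin 3 × Idx F emb) ℝ :=
  Matrix.of fun a b => if a.1 = b.1 then rotation emb (h a.1) a.2 b.2 else 0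

/-- The nonempty sets `K` of bit positions. -/
abbrev BitSet (q : ℕ) : Type := {K : Finset (Fin q) // K.Nonempty}

/-- The binary row vector obtained by adding, modulo 2, the rows of the bit matrix `B` with index
in `K`. The bits of a field element are its coordinates in the basis `bs` over the field with two
elements. -/
def bitRow [Algebra (ZMod 2) F] (bs : Module.Basis (Fin q) (ZMod 2) F) (emb : Embedding)
    (K : BitSet q) (σ : Idx F emb) : ℝ :=
  ((∑ i ∈ K.1, bs.repr (σ : F) i : ZMod 2).val : ℝ)

/-- The matrix `T̂_K`, block diagonal with three equal blocks `bitRow K`. -/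
def bitBlock [Algebra (ZMod 2) F] (bs : Module.Basis (Fin q) (ZMod 2) F) (emb : Embedding)
    (K : BitSet q) : Matrix (Fin 3) (Fin 3 × Idx F emb) ℝ :=
  Matrix.of fun k a => if k = a.1 then bitRow bs emb K a.2 else 0

/-- The matrix `P` of the parity inequalities `P f ≤ t` of three bits. -/
def parityMatrix : Matrix (Fin 4) (Fin 3) ℝ :=
  !![1, -1, -1; -1, 1, -1; -1, -1, 1; 1, 1, 1]

/-- The right-hand side `t` of the parity inequalities. -/
def parityRhs : Fin 4 → ℝ := ![0, 0, 0, 2]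

/-- The matrix `Ŵ`, with the blocks `P T̂_K D` stacked over all nonempty `K`. -/
def checkMatrix [Algebra (ZMod 2) F] (bs : Module.Basis (Fin q) (ZMod 2) F) (emb : Embedding)
    (h : Fin 3 → F) : Matrix (BitSet q × Fin 4) (Fin 3 × Idx F emb) ℝ :=
  Matrix.of fun r a => (parityMatrix * bitBlock bs emb r.1 * rotationBlock emb h) r.2 a

/-! ### The decoding model -/

/-- The coordinates of `v`: one block of embedding coordinates for every symbol. -/
abbrev Var (emb : Embedding) (H : Matrix (Fin m) (Fin n) F) : Type _ := Sym H × Idx F emb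

/-- The rows of `A`: the parity inequalities of all three-variable checks, followed by one row
for every symbol. -/
abbrev Row (q : ℕ) (H : Matrix (Fin m) (Fin n) F) : Type :=
  (Eqn H × (BitSet q × Fin 4)) ⊕ Sym H

/-- The matrix `A = [Ŵ₁ (Q₁ ⊗ I); …; Ŵ_Γ (Q_Γ ⊗ I); S]`. -/
def codeMatrix [Algebra (ZMod 2) F] (bs : Module.Basis (Fin q) (ZMod 2) F) (emb : Embedding)
    (H : Matrix (Fin m) (Fin n) F) : Matrix (Row q H) (Var emb H) ℝ :=
  Matrix.of fun r c =>
    match r with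
    | Sum.inl (τ, r') =>
        (checkMatrix bs emb (fun k => (triple H τ k).2) *
          (selectMatrix H τ ⊗ₖ (1 : Matrix (Idx F emb) (Idx F emb) ℝ))) r' c
    | Sum.inr s => if s = c.1 then 1 else 0

end Code

/-- The data of the problem of minimizing `λᵀ v - (α / 2) ‖v - 0.5‖²` over the box `[0, 1]^N`
subject to linear constraints `A v ≤ ϱ`, where the rows marked by `isEq` are required to hold with
equality. -/
structure Model (M N : Type*) where
  A : Matrix M N ℝ
  rhs : EuclideanSpace ℝ M
  isEq : M → Prop
  cost : EuclideanSpace ℝ N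

/-- The decoding model of the code with parity-check matrix `H`. The cost vector is `[γ; 0]`, with
`γ` on the code symbols and zero on the auxiliary symbols. The symbol rows are inequalities
`S v ≤ 1` for the Flanagan embedding and equalities `S v = 1` for the constant-weight one. -/
def decodingModel {F : Type*} [Field F] [Fintype F] [DecidableEq F] [Algebra (ZMod 2) F]
    {m n q : ℕ} (bs : Module.Basis (Fin q) (ZMod 2) F) (emb : Embedding)
    (H : Matrix (Fin m) (Fin n) F) (γ : Fin n → Idx F emb → ℝ) : Model (Row q H) (Var emb H) where
  A := codeMatrix bs emb H
  rhs := WithLp.toLp 2 fun r =>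
    match r with
    | Sum.inl (_, r') => parityRhs r'.2
    | Sum.inr _ => 1
  isEq := fun r =>
    match r with
    | Sum.inl _ => False
    | Sum.inr _ => emb = Embedding.constantWeight
  cost := WithLp.toLp 2 fun c =>
    match c.1 with
    | Sum.inl i => γ i c.2
    | Sum.inr _ => 0

section Algorithm

variable {M N : Type*} [Fintype M] [DecidableEq M] [Fintype N] [DecidableEq N]

/-- The spectral norm of a real matrix. -/
def specNorm (C : Matrix M N ℝ) : ℝ := ‖(Matrix.toEuclideanLin C).toContinuousLinearMap‖

/-- The minimum eigenvalue of `Aᵀ A`. -/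
def minEigenvalue (A : Matrix M N ℝ) : ℝ :=
  ⨅ i, (Matrix.isHermitian_conjTranspose_mul_self A).eigenvalues i

/-- The matrix `[A, I, 0; I, 0, -I]`. -/
def couplingMatrix (A : Matrix M N ℝ) : Matrix (M ⊕ N) (N ⊕ (M ⊕ N)) ℝ :=
  Matrix.fromBlocks A (Matrix.fromCols 1 0) 1 (Matrix.fromCols 0 (-1))

/-- The spectral norm of the matrix `[A, I, 0; I, 0, -I]`. -/
def couplingNorm (A : Matrix M N ℝ) : ℝ := specNorm (couplingMatrix A)

namespace Model

/-- The product `A v`. -/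
def mul (Q : Model M N) (v : EuclideanSpace ℝ N) : EuclideanSpace ℝ M :=
  Matrix.toEuclideanLin Q.A v

/-- The feasible set `X`. -/
def feasible (Q : Model M N) : Set (EuclideanSpace ℝ N) :=
  {v | (∀ i, Q.mul v i ≤ Q.rhs i ∧ (Q.isEq i → Q.mul v i = Q.rhs i)) ∧
    ∀ j, 0 ≤ v j ∧ v j ≤ 1}

/-- The penalized objective `g(v) = λᵀ v - (α / 2) ‖v - 0.5‖²`. -/
def objective (Q : Model M N) (α : ℝ) (v : EuclideanSpace ℝ N) : ℝ :=
  inner ℝ Q.cost v - α / 2 * ‖v - WithLp.toLp 2 (fun _ => (0.5 : ℝ))‖ ^ 2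

/-- The augmented Lagrangian. -/
def augLag (Q : Model M N) (α μ : ℝ) (v : EuclideanSpace ℝ N) (e₁ : EuclideanSpace ℝ M)
    (e₂ : EuclideanSpace ℝ N) (y₁ : EuclideanSpace ℝ M) (y₂ : EuclideanSpace ℝ N) : ℝ :=
  Q.objective α v + inner ℝ y₁ (Q.mul v + e₁ - Q.rhs) + inner ℝ y₂ (v - e₂) +
    μ / 2 * ‖Q.mul v + e₁ - Q.rhs‖ ^ 2 + μ / 2 * ‖v - e₂‖ ^ 2

/-- The slack vectors `e₁ ≥ 0`; equality rows have no slack. -/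
def slacks (Q : Model M N) : Set (EuclideanSpace ℝ M) :=
  {e | ∀ i, 0 ≤ e i ∧ (Q.isEq i → e i = 0)}

end Model

/-- The box `[0, 1]^N`. -/
def box (N : Type*) : Set (EuclideanSpace ℝ N) := {e | ∀ j, 0 ≤ e j ∧ e j ≤ 1}

/-- The eight iterates of the algorithm. -/
structure Iterate (M N : Type*) where
  v : EuclideanSpace ℝ N
  e₁ : EuclideanSpace ℝ M
  e₂ : EuclideanSpace ℝ N
  p : EuclideanSpace ℝ N
  z₁ : EuclideanSpace ℝ M
  z₂ : EuclideanSpace ℝ N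
  y₁ : EuclideanSpace ℝ M
  y₂ : EuclideanSpace ℝ N

/-- `x` is a minimizer of `f` on `S`. -/
def IsArgmin {E : Type*} (f : E → ℝ) (S : Set E) (x : E) : Prop := x ∈ S ∧ IsMinOn f S x

/-- One proximal-ADMM iteration, from `s` to `s'`. -/
structure Step (Q : Model M N) (α ρ μ β : ℝ) (s s' : Iterate M N) : Prop where
  v_update : IsArgmin
    (fun v => Q.augLag α μ v s.e₁ s.e₂ s.y₁ s.y₂ + ρ / 2 * ‖v - s.p‖ ^ 2) Set.univ s'.v
  e₁_update : IsArgmin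
    (fun e => Q.augLag α μ s'.v e s.e₂ s.y₁ s.y₂ + ρ / 2 * ‖e - s.z₁‖ ^ 2) Q.slacks s'.e₁
  e₂_update : IsArgmin
    (fun e => Q.augLag α μ s'.v s.e₁ e s.y₁ s.y₂ + ρ / 2 * ‖e - s.z₂‖ ^ 2) (box N) s'.e₂
  p_update : s'.p = s.p + β • (s'.v - s.p)
  z₁_update : s'.z₁ = s.z₁ + β • (s'.e₁ - s.z₁)
  z₂_update : s'.z₂ = s.z₂ + β • (s'.e₂ - s.z₂)
  y₁_update : s'.y₁ = s.y₁ + μ • (Q.mul s'.v + s'.e₁ - Q.rhs)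
  y₂_update : s'.y₂ = s.y₂ + μ • (s'.v - s'.e₂)

/-- The iterates generated by the proximal-ADMM algorithm, which starts from zero vectors. -/
def Generates (Q : Model M N) (α ρ μ β : ℝ) (s : ℕ → Iterate M N) : Prop :=
  s 0 = ⟨0, 0, 0, 0, 0, 0, 0, 0⟩ ∧ ∀ k, Step Q α ρ μ β (s k) (s (k + 1))

/-- All eight components of the iterates converge, to the components of `l`. -/
structure ConvergesTo (s : ℕ → Iterate M N) (l : Iterate M N) : Prop where
  v_lim : Tendsto (fun k => (s k).v) atTop (𝓝 l.v)
  e₁_lim : Tendsto (fun k => (s k).e₁) atTop (𝓝 l.e₁)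
  e₂_lim : Tendsto (fun k => (s k).e₂) atTop (𝓝 l.e₂)
  p_lim : Tendsto (fun k => (s k).p) atTop (𝓝 l.p)
  z₁_lim : Tendsto (fun k => (s k).z₁) atTop (𝓝 l.z₁)
  z₂_lim : Tendsto (fun k => (s k).z₂) atTop (𝓝 l.z₂)
  y₁_lim : Tendsto (fun k => (s k).y₁) atTop (𝓝 l.y₁)
  y₂_lim : Tendsto (fun k => (s k).y₂) atTop (𝓝 l.y₂)

/-- `x` is a stationary point of the problem of minimizing `g` on the set `X`. -/
def IsStationary (g : EuclideanSpace ℝ N → ℝ) (X : Set (EuclideanSpace ℝ N))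
    (x : EuclideanSpace ℝ N) : Prop :=
  x ∈ X ∧ ∀ v ∈ X, 0 ≤ inner ℝ (v - x) (gradient g x)

/-- `L` is a Lipschitz constant on `X` for the gradient in `v` of the augmented Lagrangian. -/
def IsGradLipschitz (Q : Model M N) (α μ : ℝ) (L : ℝ≥0) : Prop :=
  ∀ e₁ e₂ y₁ y₂, LipschitzOnWith L
    (fun v => gradient (fun w => Q.augLag α μ w e₁ e₂ y₁ y₂) v) Q.feasible

end Algorithm

end ProxADMM

end

/-! Treating the box constraint as a second slack turns the model into minimizing a concave
quadratic subject to `A v + e = rhs`, with `e` in a product of intervals. One decoder iteration is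
then a sweep over the two blocks `v` and `e`, followed by a multiplier step and a relaxation of the
proximal centre `w` (`Model.sweep_of_step`). Because `ρ > α`, the proximal Lagrangian `L` is
strongly convex.

Descent is measured by the potential `L(y, w, x) - 2 d(y, w) + 2 P(w)`, where the dual function `d`
minimizes `L` over the slack domain and the envelope `P` minimizes the proximal objective over the
feasible points. The multiplier step raises `L`, but this is paid for by the sweep and by the growth
of `d`. Moving `w` costs a term governed by the distance between the minimizers defining `d` and
`P`. The dual error bound controls this distance by the constraint residual. It follows from
`exists_lipschitz_minimizer`: the minimizer of a strongly convex quadratic over the slices `B x = b`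
of a polyhedron is Lipschitz in `b`, because along a segment of right-hand sides only finitely many
sets of active constraints occur. For small `β` the potential then drops by a multiple of the
squared step length (`exists_potential_le`).

This alone makes the steps only square-summable. Convergence of the whole sequence uses the
polyhedral structure again: the KKT points form finitely many polyhedra, one for each sign pattern
of the multiplier, and the objective is constant on each (`IsKKT.obj_eq`). By Hoffman's bound a
short step ends near a KKT point, at a distance of the order of the step, and there the potential
differs from the constant by a quadratic error (`exists_critical_values`). So the excess of the
potential over its limit is at most a multiple of the squared step. With the descent this gives
geometric decay and summable steps, and the optimality conditions of the blocks pass to the limit.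
-/

noncomputable section

namespace ProxADMM

/-! ### Piecewise Lipschitz paths -/

section Chain

variable {X ι : Type*} [NormedAddCommGroup X]

/-- A function on the unit interval that is Lipschitz, with a common constant, on each of finitely
many closed sets covering the interval is Lipschitz between the endpoints. -/
theorem norm_sub_le_of_finite_closed_cover {x : ℝ → X} {C : ℝ} {s : Set ι}
    (hs : s.Finite) (T : ι → Set ℝ) (hclosed : ∀ i ∈ s, IsClosed (T i))
    (hcover : ∀ t ∈ Set.Icc (0 : ℝ) 1, ∃ i ∈ s, t ∈ T i)
    (hlip : ∀ i ∈ s, ∀ t ∈ T i, ∀ t' ∈ T i, ‖x t' - x t‖ ≤ C * |t' - t|) :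
    ‖x 1 - x 0‖ ≤ C := by
  -- A closed `T i` that misses `t` misses a neighbourhood of `t`, and there are finitely many, so
  -- every set containing a nearby `t'` also contains `t`.
  have hloc : ∀ t : ℝ, ∀ᶠ t' in 𝓝 t, t' ∈ Set.Icc (0 : ℝ) 1 →
      ‖x t' - x t‖ ≤ C * |t' - t| := by
    intro t
    have h : ∀ᶠ t' in 𝓝 t, ∀ i ∈ s, t' ∈ T i → t ∈ T i := by
      rw [eventually_all_finite hs]
      intro i hi
      by_cases hti : t ∈ T i
      · exact Eventually.of_forall fun _ _ => hti
      · filter_upwards [(hclosed i hi).isOpen_compl.mem_nhds hti] with t' h1 h2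
        exact absurd h2 h1
    filter_upwards [h] with t' h ht'
    obtain ⟨i, hi, hti⟩ := hcover t' ht'
    exact hlip i hi t (h i hi hti) t' hti
  have hcont : ContinuousOn x (Set.Icc 0 1) := by
    intro t _
    rw [ContinuousWithinAt, tendsto_iff_norm_sub_tendsto_zero]
    have h0 : Tendsto (fun t' => C * |t' - t|) (𝓝[Set.Icc 0 1] t) (𝓝 0) := by
      have : Continuous fun t' => C * |t' - t| := by fun_prop
      have h := (this.tendsto t).mono_left (nhdsWithin_le_nhds (s := Set.Icc 0 1))
      simpa using h
    refine squeeze_zero' (Eventually.of_forall fun _ => norm_nonneg _) ?_ h0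
    filter_upwards [nhdsWithin_le_nhds (hloc t), self_mem_nhdsWithin] with t' h1 h2
    exact h1 h2
  set G : Set ℝ := {t | ‖x t - x 0‖ ≤ C * t} with hG
  have hGc : IsClosed (G ∩ Set.Icc 0 1) := by
    have := isClosed_Icc.isClosed_le (f := fun t => ‖x t - x 0‖) (g := fun t => C * t)
      (s := Set.Icc (0 : ℝ) 1) ((hcont.sub continuousOn_const).norm) (by fun_prop)
    convert this using 1
    ext t
    simp [hG, and_comm]
  -- Continuous induction: `G` is closed in the interval, and the local bound extends it slightly to
  -- the right of each of its points.
  have hsub : Set.Icc (0 : ℝ) 1 ⊆ G := by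
    refine hGc.Icc_subset_of_forall_exists_gt (by simp [hG]) ?_
    rintro t ⟨htG, ht0, ht1⟩ y hy
    have h1 : ∀ᶠ t' in 𝓝[>] t, t' ∈ Set.Icc (0 : ℝ) 1 →
      ‖x t' - x t‖ ≤ C * |t' - t| := nhdsWithin_le_nhds (hloc t)
    have h2 : ∀ᶠ t' in 𝓝[>] t, t' ∈ Set.Ioc t (min y 1) :=
      Ioc_mem_nhdsGT (lt_min hy ht1)
    obtain ⟨t', h1, h2, h3⟩ := (h1.and h2).exists
    refine ⟨t', ?_, h2, h3.trans (min_le_left _ _)⟩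
    have h4 := h1 ⟨ht0.trans h2.le, h3.trans (min_le_right _ _)⟩
    rw [abs_of_pos (sub_pos.2 h2)] at h4
    have h5 : ‖x t - x 0‖ ≤ C * t := htG
    calc ‖x t' - x 0‖ = ‖(x t' - x t) + (x t - x 0)‖ := by abel_nf
      _ ≤ _ := (norm_add_le _ _).trans (by linarith)
  have := hsub (Set.right_mem_Icc.2 zero_le_one)
  simpa [hG] using this

end Chain

/-! ### Strongly convex quadratics on slices of a polyhedron -/

section Polyhedra

variable {X Y : Type*} [NormedAddCommGroup X] [NormedSpace ℝ X]
  [NormedAddCommGroup Y] [NormedSpace ℝ Y]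

/-- `f` is a quadratic function with gradient `G` and Hessian `Q`. -/
structure IsQuadratic (f : X → ℝ) (G : X → X →L[ℝ] ℝ) (Q : X →L[ℝ] X →L[ℝ] ℝ) : Prop where
  add : ∀ x d, f (x + d) = f x + G x d + Q d d / 2
  grad_add : ∀ x d, G (x + d) = G x + Q d

/-- The polyhedron cut out by a set of (functional, bound) pairs. -/
def polyhedron (s : Set ((X →L[ℝ] ℝ) × ℝ)) : Set X := {x | ∀ p ∈ s, p.1 x ≤ p.2}

/-- The points of a polyhedron that satisfy the linear equations `B x = b`. -/
def slice (s : Set ((X →L[ℝ] ℝ) × ℝ)) (B : X →L[ℝ] Y) (b : Y) : Set X :=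
  {x | x ∈ polyhedron s ∧ B x = b}

theorem isClosed_polyhedron (s : Set ((X →L[ℝ] ℝ) × ℝ)) : IsClosed (polyhedron s) := by
  have : polyhedron s = ⋂ p ∈ s, {x | p.1 x ≤ p.2} := by ext; simp [polyhedron]
  rw [this]
  exact isClosed_biInter fun p _ => isClosed_le p.1.continuous continuous_const

theorem isClosed_slice (s : Set ((X →L[ℝ] ℝ) × ℝ)) (B : X →L[ℝ] Y) (b : Y) :
    IsClosed (slice s B b) :=
  (isClosed_polyhedron s).inter (isClosed_eq B.continuous continuous_const)

theorem slice_add_smul {s : Set ((X →L[ℝ] ℝ) × ℝ)} {B : X →L[ℝ] Y} {b₀ b₁ : Y} {x₀ x₁ : X}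
    (h₀ : x₀ ∈ slice s B b₀) (h₁ : x₁ ∈ slice s B b₁) {t : ℝ} (ht : t ∈ Set.Icc (0 : ℝ) 1) :
    x₀ + t • (x₁ - x₀) ∈ slice s B (b₀ + t • (b₁ - b₀)) := by
  refine ⟨fun p hp => ?_, ?_⟩
  · have h2 := h₀.1 p hp
    have h3 := h₁.1 p hp
    simp only [map_add, map_smul, map_sub, smul_eq_mul]
    nlinarith [ht.1, ht.2, mul_le_mul_of_nonneg_left h2 (sub_nonneg.2 ht.2),
      mul_le_mul_of_nonneg_left h3 ht.1]
  · simp [h₀.2, h₁.2]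

/-- First-order optimality relative to the face on which the constraints in `I` are active. -/
def ActiveOptimal (s I : Set ((X →L[ℝ] ℝ) × ℝ)) (B : X →L[ℝ] Y) (G : X → X →L[ℝ] ℝ) (b : Y)
    (x : X) : Prop :=
  x ∈ slice s B b ∧ (∀ p ∈ I, p.1 x = p.2) ∧
    ∀ d, B d = 0 → (∀ p ∈ I, p.1 d ≤ 0) → 0 ≤ G x d

/-- Divide by `t` and let `t → 0⁺`. This is how minimality along a ray becomes a first-order
condition. -/
theorem nonneg_of_eventually_quadratic {a c : ℝ} (h : ∀ᶠ t in 𝓝[>] (0 : ℝ), 0 ≤ t * a + t ^ 2 * c) :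
    0 ≤ a := by
  have h1 : Tendsto (fun t : ℝ => a + t * c) (𝓝[>] 0) (𝓝 a) := by
    have : Continuous fun t : ℝ => a + t * c := by fun_prop
    have h := (this.tendsto 0).mono_left (nhdsWithin_le_nhds (s := Set.Ioi 0))
    simpa using h
  refine ge_of_tendsto h1 ?_
  filter_upwards [h, self_mem_nhdsWithin] with t ht ht0
  have ht0 : 0 < t := ht0
  have : 0 ≤ t * (a + t * c) := by linarith [ht, show t * (a + t * c) = t * a + t ^ 2 * c by ring]
  exact nonneg_of_mul_nonneg_right this ht0

theorem IsQuadratic.add_smul {f : X → ℝ} {G : X → X →L[ℝ] ℝ} {Q : X →L[ℝ] X →L[ℝ] ℝ}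
    (hf : IsQuadratic f G Q) (x d : X) (t : ℝ) :
    f (x + t • d) = f x + (t * G x d + t ^ 2 * (Q d d / 2)) := by
  rw [hf.add]
  simp only [map_smul, smul_eq_mul, smul_apply]
  ring

theorem IsQuadratic.continuous {f : X → ℝ} {G : X → X →L[ℝ] ℝ} {Q : X →L[ℝ] X →L[ℝ] ℝ}
    (hf : IsQuadratic f G Q) : Continuous f := by
  have : f = fun x => f 0 + G 0 x + Q x x / 2 := by
    ext x
    have := hf.add 0 x
    simpa using this
  rw [this]
  fun_prop

theorem IsQuadratic.continuous_grad {f : X → ℝ} {G : X → X →L[ℝ] ℝ} {Q : X →L[ℝ] X →L[ℝ] ℝ}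
    (hf : IsQuadratic f G Q) : Continuous G := by
  have : G = fun x => G 0 + Q x := by
    ext1 x
    have := hf.grad_add 0 x
    simpa using this
  rw [this]
  fun_prop

/-- A minimizer of a quadratic function on a slice of a polyhedron is optimal relative to its
face. -/
theorem activeOptimal_of_isMinOn {s : Set ((X →L[ℝ] ℝ) × ℝ)} (hs : s.Finite) {B : X →L[ℝ] Y}
    {f : X → ℝ} {G : X → X →L[ℝ] ℝ} {Q : X →L[ℝ] X →L[ℝ] ℝ} (hf : IsQuadratic f G Q) {b : Y}
    {x : X} (hx : x ∈ slice s B b) (hmin : IsMinOn f (slice s B b) x) :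
    ActiveOptimal s {p ∈ s | p.1 x = p.2} B G b x := by
  refine ⟨hx, fun p hp => hp.2, fun d hBd hd => ?_⟩
  -- Active constraints do not increase along `d`, inactive ones have room, and there are finitely
  -- many.
  have hfeas : ∀ᶠ t in 𝓝[>] (0 : ℝ), x + t • d ∈ slice s B b := by
    have : ∀ᶠ t in 𝓝[>] (0 : ℝ), ∀ p ∈ s, p.1 (x + t • d) ≤ p.2 := by
      rw [eventually_all_finite hs]
      intro p hp
      by_cases h : p.1 x = p.2
      · filter_upwards [self_mem_nhdsWithin] with t ht
        have h1 := hd p ⟨hp, h⟩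
        have ht : 0 < t := ht
        simp only [map_add, map_smul, smul_eq_mul]
        nlinarith
      · have h1 : p.1 x < p.2 := lt_of_le_of_ne (hx.1 p hp) h
        have hc : Continuous fun t : ℝ => p.1 (x + t • d) := by fun_prop
        have h2 : ∀ᶠ t in 𝓝 (0 : ℝ), p.1 (x + t • d) < p.2 :=
          hc.continuousAt.eventually_lt continuousAt_const (by simpa using h1)
        filter_upwards [nhdsWithin_le_nhds h2] with t ht using ht.le
    filter_upwards [this] with t ht
    exact ⟨ht, by simp [hx.2, hBd]⟩
  refine nonneg_of_eventually_quadratic (c := Q d d / 2) ?_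
  filter_upwards [hfeas] with t ht
  have := hmin ht
  simp only [Set.mem_ofPred_eq] at this
  rw [hf.add_smul] at this
  linarith

/-- Any point of the slice lies in an admissible direction from `x`, since the constraints in `I`
are tight at `x`. So the linear term is nonnegative, and the Hessian supplies quadratic growth. `I`
may be any part of `s` that is tight at `x`. -/
theorem ActiveOptimal.isMinOn {s I : Set ((X →L[ℝ] ℝ) × ℝ)} (hI : I ⊆ s) {B : X →L[ℝ] Y}
    {f : X → ℝ} {G : X → X →L[ℝ] ℝ} {Q : X →L[ℝ] X →L[ℝ] ℝ} (hf : IsQuadratic f G Q) {m : ℝ}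
    (hQ : ∀ d, m * ‖d‖ ^ 2 ≤ Q d d) {b : Y} {x : X} (h : ActiveOptimal s I B G b x) :
    ∀ x' ∈ slice s B b, f x + m / 2 * ‖x' - x‖ ^ 2 ≤ f x' := by
  intro x' hx'
  have h1 := hf.add x (x' - x)
  rw [add_sub_cancel] at h1
  have h2 := h.2.2 (x' - x) (by simp [hx'.2, h.1.2]) (fun p hp => by
    rw [map_sub, h.2.1 p hp]
    linarith [hx'.1 p (hI hp)])
  linarith [hQ (x' - x)]

/-- A linear map on the subspace on which the functionals in `I` vanish has a bounded section. -/
theorem exists_bounded_preimage [FiniteDimensional ℝ X] (I : Set ((X →L[ℝ] ℝ) × ℝ))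
    (B : X →L[ℝ] Y) :
    ∃ κ : ℝ, 0 ≤ κ ∧ ∀ u, (∀ p ∈ I, p.1 u = 0) →
      ∃ u', B u' = B u ∧ (∀ p ∈ I, p.1 u' = 0) ∧ ‖u'‖ ≤ κ * ‖B u‖ := by
  let W : Submodule ℝ X :=
    { carrier := {u | ∀ p ∈ I, p.1 u = 0}
      add_mem' := fun ha hb p hp => by simp [ha p hp, hb p hp]
      zero_mem' := fun p _ => by simp
      smul_mem' := fun c a ha p hp => by simp [ha p hp] }
  let B' : W →ₗ[ℝ] Y := B.toLinearMap.comp W.subtype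
  obtain ⟨g, hg⟩ := B'.rangeRestrict.exists_rightInverse_of_surjective
    (LinearMap.range_rangeRestrict _)
  let g' : (LinearMap.range B') →L[ℝ] W := LinearMap.toContinuousLinearMap g
  refine ⟨‖g'‖, norm_nonneg g', fun u hu => ?_⟩
  let y : LinearMap.range B' := B'.rangeRestrict ⟨u, hu⟩
  refine ⟨(g y : W), ?_, (g y).2, ?_⟩
  · have := LinearMap.congr_fun hg y
    exact congrArg Subtype.val this
  · exact g'.le_opNorm y

/-- With a common `I` the difference `x₁ - x₀` is annihilated by the functionals in `I`. Remove from
it a short `u` with the same image under `B`. The remainder and its negative are both admissible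
directions, so both gradients vanish on it. Hence `Q (x₁ - x₀)` takes equal values on `x₁ - x₀` and
on `u`, and coercivity bounds the former by the latter. -/
theorem ActiveOptimal.norm_sub_le {s I : Set ((X →L[ℝ] ℝ) × ℝ)} {B : X →L[ℝ] Y}
    {f : X → ℝ} {G : X → X →L[ℝ] ℝ} {Q : X →L[ℝ] X →L[ℝ] ℝ} (hf : IsQuadratic f G Q) {m κ : ℝ}
    (hm : 0 < m) (hQ : ∀ d, m * ‖d‖ ^ 2 ≤ Q d d)
    (hκ : ∀ u, (∀ p ∈ I, p.1 u = 0) →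
      ∃ u', B u' = B u ∧ (∀ p ∈ I, p.1 u' = 0) ∧ ‖u'‖ ≤ κ * ‖B u‖)
    {b₀ b₁ : Y} {x₀ x₁ : X} (h₀ : ActiveOptimal s I B G b₀ x₀)
    (h₁ : ActiveOptimal s I B G b₁ x₁) :
    ‖x₁ - x₀‖ ≤ ‖Q‖ * κ / m * ‖b₁ - b₀‖ := by
  obtain ⟨u, hBu, hIu, hu⟩ := hκ (x₁ - x₀) fun p hp => by
    rw [map_sub, h₀.2.1 p hp, h₁.2.1 p hp, sub_self]
  have hzero : ∀ {b x}, ActiveOptimal s I B G b x → G x (x₁ - x₀ - u) = 0 := by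
    intro b x h
    have hI : ∀ p ∈ I, p.1 (x₁ - x₀ - u) = 0 := fun p hp => by
      rw [map_sub, map_sub, h₀.2.1 p hp, h₁.2.1 p hp, hIu p hp]; simp
    have hB : B (x₁ - x₀ - u) = 0 := by rw [map_sub, hBu, sub_self]
    have h1 := h.2.2 _ hB fun p hp => (hI p hp).le
    have h2 := h.2.2 (-(x₁ - x₀ - u)) (by rw [map_neg, hB, neg_zero]) fun p hp => by
      rw [map_neg, hI p hp, neg_zero]
    rw [map_neg] at h2
    linarith
  have hG := hf.grad_add x₀ (x₁ - x₀)
  rw [add_sub_cancel] at hG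
  have h1 : Q (x₁ - x₀) (x₁ - x₀ - u) = 0 := by
    have := congrArg (fun φ : X →L[ℝ] ℝ => φ (x₁ - x₀ - u)) hG
    simp only [add_apply, hzero h₀, hzero h₁] at this
    linarith
  rw [map_sub, sub_eq_zero] at h1
  have h2 : m * ‖x₁ - x₀‖ ^ 2 ≤ ‖Q‖ * ‖x₁ - x₀‖ * ‖u‖ := by
    refine (hQ _).trans ?_
    rw [h1]
    exact (le_abs_self _).trans (Q.le_opNorm₂ _ _)
  rw [map_sub, h₀.1.2, h₁.1.2] at hu
  rcases (norm_nonneg (x₁ - x₀)).eq_or_lt with h | h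
  · rw [← h]
    have hκ' : 0 ≤ κ * ‖b₁ - b₀‖ := (norm_nonneg _).trans hu
    calc (0 : ℝ) ≤ ‖Q‖ * (κ * ‖b₁ - b₀‖) / m := by positivity
      _ = _ := by ring
  · have h3 : m * ‖x₁ - x₀‖ ≤ ‖Q‖ * ‖u‖ := by
      refine le_of_mul_le_mul_right ?_ h
      linarith
    have h4 : m * ‖x₁ - x₀‖ ≤ ‖Q‖ * (κ * ‖b₁ - b₀‖) :=
      h3.trans (mul_le_mul_of_nonneg_left hu (norm_nonneg Q))
    rw [div_mul_eq_mul_div, le_div_iff₀ hm]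
    linarith

/-- A strongly convex quadratic function attains its minimum on a nonempty closed set. -/
theorem IsQuadratic.exists_isMinOn [FiniteDimensional ℝ X] {f : X → ℝ} {G : X → X →L[ℝ] ℝ}
    {Q : X →L[ℝ] X →L[ℝ] ℝ} (hf : IsQuadratic f G Q) {m : ℝ} (hm : 0 < m)
    (hQ : ∀ d, m * ‖d‖ ^ 2 ≤ Q d d) {S : Set X} (hS : IsClosed S) (hne : S.Nonempty) :
    ∃ x ∈ S, IsMinOn f S x := by
  obtain ⟨x₀, h₀⟩ := hne
  refine hf.continuous.continuousOn.exists_isMinOn' hS h₀ (mem_inf_of_left ?_)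
  have h1 : Tendsto (fun x => ‖x - x₀‖) (cocompact X) atTop := by
    have : (fun x => ‖x - x₀‖) = fun x => dist x x₀ := by ext; rw [dist_eq_norm]
    rw [this]
    exact tendsto_dist_right_cocompact_atTop x₀
  filter_upwards [h1.eventually_ge_atTop (2 * ‖G x₀‖ / m)] with x hx
  have h2 := hf.add x₀ (x - x₀)
  rw [add_sub_cancel] at h2
  have h3 : -(‖G x₀‖ * ‖x - x₀‖) ≤ G x₀ (x - x₀) :=
    neg_le_of_abs_le ((G x₀).le_opNorm _)
  have h4 := hQ (x - x₀)
  rw [div_le_iff₀ hm] at hx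
  nlinarith [norm_nonneg (x - x₀)]

/-- The minimizer of a strongly convex quadratic function over the slices `B x = b` of a polyhedron
is a Lipschitz function of `b`, with a constant that only depends on the Hessian. -/
theorem exists_lipschitz_minimizer [FiniteDimensional ℝ X] {s : Set ((X →L[ℝ] ℝ) × ℝ)}
    (hs : s.Finite) (B : X →L[ℝ] Y) (Q : X →L[ℝ] X →L[ℝ] ℝ) {m : ℝ} (hm : 0 < m)
    (hQ : ∀ d, m * ‖d‖ ^ 2 ≤ Q d d) :
    ∃ σ : ℝ, 0 ≤ σ ∧ ∀ (f : X → ℝ) (G : X → X →L[ℝ] ℝ), IsQuadratic f G Q →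
      ∀ b₀ b₁ x₀ x₁, x₀ ∈ slice s B b₀ → IsMinOn f (slice s B b₀) x₀ →
        x₁ ∈ slice s B b₁ → IsMinOn f (slice s B b₁) x₁ → ‖x₁ - x₀‖ ≤ σ * ‖b₁ - b₀‖ := by
  choose κ hκ0 hκ using fun I : Set ((X →L[ℝ] ℝ) × ℝ) => exists_bounded_preimage I B
  -- There are finitely many candidate sets `I ⊆ s`, so one constant serves all of them. It involves
  -- neither `f` nor its linear part.
  obtain ⟨κ₀, hκ₀⟩ := (hs.powerset.image κ).bddAbove
  have hle : ∀ I ⊆ s, κ I ≤ κ₀ := fun I hI => hκ₀ (Set.mem_image_of_mem κ hI)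
  have hκ₀0 : 0 ≤ κ₀ := (hκ0 ∅).trans (hle ∅ (Set.empty_subset s))
  set σ := ‖Q‖ * κ₀ / m with hσ
  have hσ0 : 0 ≤ σ := by positivity
  refine ⟨σ, hσ0, fun f G hf b₀ b₁ x₀ x₁ hx₀ hm₀ hx₁ hm₁ => ?_⟩
  have hlip : ∀ I ⊆ s, ∀ {b b' x x'}, ActiveOptimal s I B G b x → ActiveOptimal s I B G b' x' →
      ‖x' - x‖ ≤ σ * ‖b' - b‖ := fun I hI b b' x x' h h' =>
    (h.norm_sub_le hf hm hQ (hκ I) h').trans (by rw [hσ]; gcongr; exact hle I hI)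
  have huniq : ∀ {b x x'}, x ∈ slice s B b → IsMinOn f (slice s B b) x → x' ∈ slice s B b →
      IsMinOn f (slice s B b) x' → x' = x := by
    intro b x x' hx hxm hx' hxm'
    have h1 := (activeOptimal_of_isMinOn hs hf hx hxm).isMinOn (Set.sep_subset _ _) hf hQ x' hx'
    have h2 : f x' ≤ f x := hxm' hx
    have h3 : ‖x' - x‖ ^ 2 ≤ 0 := by
      by_contra h
      push Not at h
      have := mul_pos hm h
      linarith
    exact sub_eq_zero.1 (norm_eq_zero.1 (pow_eq_zero_iff two_ne_zero |>.1
      (le_antisymm h3 (sq_nonneg _))))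
  set b : ℝ → Y := fun t => b₀ + t • (b₁ - b₀) with hb
  have hex : ∀ t, ∃ x, t ∈ Set.Icc (0 : ℝ) 1 →
      x ∈ slice s B (b t) ∧ IsMinOn f (slice s B (b t)) x := by
    intro t
    by_cases ht : t ∈ Set.Icc (0 : ℝ) 1
    · obtain ⟨x, hx, hxm⟩ := hf.exists_isMinOn hm hQ (isClosed_slice s B (b t))
        ⟨_, slice_add_smul hx₀ hx₁ ht⟩
      exact ⟨x, fun _ => ⟨hx, hxm⟩⟩
    · exact ⟨0, fun h => absurd h ht⟩
  choose x hx using hex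
  have hbt : ∀ t t', ‖b t' - b t‖ = ‖b₁ - b₀‖ * |t' - t| := by
    intro t t'
    have : b t' - b t = (t' - t) • (b₁ - b₀) := by simp only [hb]; module
    rw [this, norm_smul, Real.norm_eq_abs, mul_comm]
  -- `T I` collects the parameters at which `I` certifies optimality. As `I` need not be the full
  -- active set, the certificate is a closed condition on the pair formed by the right-hand side and
  -- the point.
  set T : Set ((X →L[ℝ] ℝ) × ℝ) → Set ℝ := fun I =>
    {t ∈ Set.Icc (0 : ℝ) 1 | ActiveOptimal s I B G (b t) (x t)} with hT
  have hlipT : ∀ I ∈ 𝒫 s, ∀ t ∈ T I, ∀ t' ∈ T I,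
      ‖x t' - x t‖ ≤ σ * ‖b₁ - b₀‖ * |t' - t| := by
    intro I hI t ht t' ht'
    have := hlip I hI ht.2 ht'.2
    rwa [hbt, ← mul_assoc] at this
  have hfinal : ‖x 1 - x 0‖ ≤ σ * ‖b₁ - b₀‖ := by
    refine norm_sub_le_of_finite_closed_cover hs.powerset T ?_ ?_ hlipT
    · intro I hI
      -- The path `x` is not yet known to be continuous. Its restriction to `T I` is Lipschitz and
      -- extends to a continuous `g`. The certificate for `g` is closed in `t`, and where it holds
      -- uniqueness of minimizers gives `g t = x t`.
      have hL : LipschitzOnWith (Real.toNNReal (σ * ‖b₁ - b₀‖)) x (T I) := by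
        refine LipschitzOnWith.of_dist_le_mul fun t ht t' ht' => ?_
        rw [dist_eq_norm, dist_eq_norm, Real.coe_toNNReal _ (by positivity), Real.norm_eq_abs]
        exact hlipT I hI t' ht' t ht
      obtain ⟨g, hg, hgx⟩ := hL.extend_finite_dimension
      have hgc := hg.continuous
      have hbc : Continuous b := by simp only [hb]; fun_prop
      have hGc := hf.continuous_grad
      have hZ : IsClosed {t | ActiveOptimal s I B G (b t) (g t)} := by
        simp only [ActiveOptimal, slice, Set.ofPred_and, Set.ofPred_forall]
        refine (((isClosed_polyhedron s).preimage hgc).inter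
          (isClosed_eq (B.continuous.comp hgc) hbc)).inter ((isClosed_biInter fun p _ =>
            isClosed_eq (p.1.continuous.comp hgc) continuous_const).inter ?_)
        refine isClosed_iInter fun d => isClosed_iInter fun _ => isClosed_iInter fun _ =>
          isClosed_le continuous_const ?_
        exact (hGc.comp hgc).clm_apply continuous_const
      have hTZ : T I = Set.Icc 0 1 ∩ {t | ActiveOptimal s I B G (b t) (g t)} := by
        ext t
        constructor
        · intro ht
          refine ⟨ht.1, ?_⟩
          simp only [Set.mem_ofPred_eq]
          rw [← hgx ht]
          exact ht.2
        · rintro ⟨ht, ht'⟩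
          refine ⟨ht, ?_⟩
          have hmin : IsMinOn f (slice s B (b t)) (g t) := by
            intro y hy
            have := ht'.isMinOn hI hf hQ y hy
            have h0 : 0 ≤ m / 2 * ‖y - g t‖ ^ 2 := by positivity
            simp only [Set.mem_ofPred_eq]
            linarith
          rw [huniq ht'.1 hmin (hx t ht).1 (hx t ht).2]
          exact ht'
      rw [hTZ]
      exact isClosed_Icc.inter hZ
    · intro t ht
      exact ⟨_, Set.sep_subset _ _, ht, activeOptimal_of_isMinOn hs hf (hx t ht).1 (hx t ht).2⟩
  have h0 : x 0 = x₀ := by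
    have h := hx 0 (by simp)
    have hb0 : b 0 = b₀ := by simp [hb]
    rw [hb0] at h
    exact huniq hx₀ hm₀ h.1 h.2
  have h1 : x 1 = x₁ := by
    have h := hx 1 (by simp)
    have hb1 : b 1 = b₁ := by simp [hb]
    rw [hb1] at h
    exact huniq hx₁ hm₁ h.1 h.2
  rwa [h0, h1] at hfinal

end Polyhedra

/-! ### Polyhedral sets and Hoffman's error bound -/

section ErrorBound

variable {X Y : Type*} [NormedAddCommGroup X] [NormedSpace ℝ X]
  [NormedAddCommGroup Y] [NormedSpace ℝ Y]

/-- Products carry the supremum norm, which is not Euclidean. A Euclidean structure is pulled back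
through a linear isomorphism to obtain a strongly convex quadratic. -/
theorem exists_posDef_form (X : Type*) [NormedAddCommGroup X] [NormedSpace ℝ X]
    [FiniteDimensional ℝ X] :
    ∃ Q : X →L[ℝ] X →L[ℝ] ℝ, (∀ x y, Q x y = Q y x) ∧
      ∃ m : ℝ, 0 < m ∧ ∀ d, m * ‖d‖ ^ 2 ≤ Q d d := by
  let T : X ≃L[ℝ] EuclideanSpace ℝ (Fin (Module.finrank ℝ X)) := toEuclidean
  let T' : X →L[ℝ] EuclideanSpace ℝ (Fin (Module.finrank ℝ X)) := T
  let S : EuclideanSpace ℝ (Fin (Module.finrank ℝ X)) →L[ℝ] X := T.symm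
  refine ⟨(innerSL ℝ).bilinearComp T' T', fun x y => real_inner_comm (T' y) (T' x),
    1 / (‖S‖ ^ 2 + 1), by positivity, fun d => ?_⟩
  have h1 : ‖d‖ ≤ ‖S‖ * ‖T' d‖ := by
    have := S.le_opNorm (T' d)
    simpa [S, T'] using this
  have h2 : ((innerSL ℝ).bilinearComp T' T') d d = ‖T' d‖ ^ 2 := real_inner_self_eq_norm_sq (T' d)
  rw [h2, div_mul_eq_mul_div, div_le_iff₀ (by positivity), one_mul]
  have h3 : ‖d‖ ^ 2 ≤ (‖S‖ * ‖T' d‖) ^ 2 := pow_le_pow_left₀ (norm_nonneg d) h1 2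
  nlinarith [sq_nonneg ‖T' d‖]

theorem isQuadratic_form (Q : X →L[ℝ] X →L[ℝ] ℝ) (hQ : ∀ x y, Q x y = Q y x) (x₀ : X) :
    IsQuadratic (fun x => Q (x - x₀) (x - x₀) / 2) (fun x => Q (x - x₀)) Q := by
  constructor
  · intro x d
    have : x + d - x₀ = (x - x₀) + d := by abel
    rw [this]
    simp only [map_add, add_apply]
    rw [hQ d (x - x₀)]
    ring
  · intro x d
    have : x + d - x₀ = (x - x₀) + d := by abel
    rw [this, map_add]

/-- A finite intersection of closed half-spaces. -/
def IsPolyhedral (S : Set X) : Prop :=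
  ∃ s : Set ((X →L[ℝ] ℝ) × ℝ), s.Finite ∧ S = polyhedron s

theorem IsPolyhedral.inter {S T : Set X} (hS : IsPolyhedral S) (hT : IsPolyhedral T) :
    IsPolyhedral (S ∩ T) := by
  obtain ⟨s, hs, rfl⟩ := hS
  obtain ⟨t, ht, rfl⟩ := hT
  refine ⟨s ∪ t, hs.union ht, ?_⟩
  ext x
  simp only [polyhedron, Set.mem_inter_iff, Set.mem_ofPred_eq, Set.mem_union]
  exact ⟨fun h p hp => hp.elim (h.1 p) (h.2 p), fun h =>
    ⟨fun p hp => h p (Or.inl hp), fun p hp => h p (Or.inr hp)⟩⟩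

theorem IsPolyhedral.iInter {ι : Type*} [Finite ι] {S : ι → Set X}
    (hS : ∀ i, IsPolyhedral (S i)) : IsPolyhedral (⋂ i, S i) := by
  choose s hs h using hS
  refine ⟨⋃ i, s i, Set.finite_iUnion hs, ?_⟩
  ext x
  simp only [h, polyhedron, Set.mem_iInter, Set.mem_ofPred_eq, Set.mem_iUnion]
  exact ⟨fun H p ⟨i, hi⟩ => H i p hi, fun H i p hi => H p ⟨i, hi⟩⟩

theorem isPolyhedral_univ : IsPolyhedral (Set.univ : Set X) :=
  ⟨∅, Set.finite_empty, by ext; simp [polyhedron]⟩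

theorem isPolyhedral_le (a : X →L[ℝ] ℝ) (c : ℝ) : IsPolyhedral {x | a x ≤ c} :=
  ⟨{(a, c)}, Set.finite_singleton _, by ext; simp [polyhedron]⟩

theorem isPolyhedral_ge (a : X →L[ℝ] ℝ) (c : ℝ) : IsPolyhedral {x | c ≤ a x} :=
  ⟨{(-a, -c)}, Set.finite_singleton _, by ext; simp [polyhedron]⟩

theorem isPolyhedral_eq (a : X →L[ℝ] ℝ) (c : ℝ) : IsPolyhedral {x | a x = c} := by
  have : {x | a x = c} = {x | a x ≤ c} ∩ {x | c ≤ a x} := by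
    ext x
    exact le_antisymm_iff
  rw [this]
  exact (isPolyhedral_le a c).inter (isPolyhedral_ge a c)

theorem isPolyhedral_imp {p : Prop} {S : Set X} (hS : IsPolyhedral S) :
    IsPolyhedral {x | p → x ∈ S} := by
  by_cases hp : p
  · simpa [hp] using hS
  · simpa [hp] using isPolyhedral_univ

theorem IsPolyhedral.isClosed {S : Set X} (hS : IsPolyhedral S) : IsClosed S := by
  obtain ⟨s, -, rfl⟩ := hS
  exact isClosed_polyhedron s

/-- Hoffman's error bound: near a polyhedron `{x ∈ S | B x = b}` (also if it is empty, when the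
residual is bounded below), the distance to it is bounded by the residual `B x - b`. -/
theorem IsPolyhedral.exists_error_bound [FiniteDimensional ℝ X] {S : Set X} (hS : IsPolyhedral S)
    (B : X →L[ℝ] Y) (b : Y) :
    ∃ ε : ℝ, 0 < ε ∧ ∃ σ : ℝ, 0 ≤ σ ∧ ∀ x ∈ S, ‖B x - b‖ < ε →
      ∃ x' ∈ S, B x' = b ∧ ‖x' - x‖ ≤ σ * ‖B x - b‖ := by
  obtain ⟨s, hs, rfl⟩ := hS
  obtain ⟨Q, hsymm, m, hm, hQ⟩ := exists_posDef_form X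
  obtain ⟨σ, hσ, hlip⟩ := exists_lipschitz_minimizer hs B Q hm hQ
  -- The image of the polyhedron under `B` is closed: the point of least `Q`-norm in a slice is
  -- Lipschitz in `b` where slices are nonempty. Extended to all `b`, it describes this set by
  -- closed conditions.
  have hclosed : IsClosed {b | (slice s B b).Nonempty} := by
    have hf := isQuadratic_form Q hsymm 0
    have hex : ∀ b, ∃ x, (slice s B b).Nonempty →
        x ∈ slice s B b ∧ IsMinOn (fun x => Q (x - 0) (x - 0) / 2) (slice s B b) x := by
      intro b
      by_cases hb : (slice s B b).Nonempty
      · obtain ⟨x, hx, hx'⟩ := hf.exists_isMinOn hm hQ (isClosed_slice s B b) hb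
        exact ⟨x, fun _ => ⟨hx, hx'⟩⟩
      · exact ⟨0, fun h => absurd h hb⟩
    choose x hx using hex
    have hL : LipschitzOnWith (Real.toNNReal σ) x {b | (slice s B b).Nonempty} := by
      refine LipschitzOnWith.of_dist_le_mul fun b hb b' hb' => ?_
      rw [dist_eq_norm, dist_eq_norm, Real.coe_toNNReal _ hσ]
      exact hlip _ _ hf _ _ _ _ (hx b' hb').1 (hx b' hb').2 (hx b hb).1 (hx b hb).2
    obtain ⟨g, hg, hgx⟩ := hL.extend_finite_dimension
    have : {b | (slice s B b).Nonempty} = {b | g b ∈ polyhedron s} ∩ {b | B (g b) = b} := by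
      ext b
      constructor
      · intro hb
        have := (hx b hb).1
        rw [hgx hb] at this
        exact this
      · intro hb
        exact ⟨g b, hb⟩
    rw [this]
    exact ((isClosed_polyhedron s).preimage hg.continuous).inter
      (isClosed_eq (B.continuous.comp hg.continuous) continuous_id)
  by_cases hb : (slice s B b).Nonempty
  · refine ⟨1, one_pos, σ, hσ, fun x hx _ => ?_⟩
    have hf := isQuadratic_form Q hsymm x
    obtain ⟨x', hx', hmin⟩ := hf.exists_isMinOn hm hQ (isClosed_slice s B b) hb
    refine ⟨x', hx'.1, hx'.2, ?_⟩
    rw [← norm_neg (B x - b), neg_sub]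
    -- The function is half the squared `Q`-distance to `x`. So `x` is its minimizer on its own
    -- slice and `x'` its minimizer on the target slice; the Lipschitz bound compares the two.
    refine hlip _ _ hf (B x) b x x' ⟨hx, rfl⟩ (fun y _ => ?_) hx' hmin
    simp only [Set.mem_ofPred_eq, sub_self, map_zero, zero_div]
    have := hQ (y - x)
    have h0 : 0 ≤ m * ‖y - x‖ ^ 2 := by positivity
    linarith
  · obtain ⟨ε, hε, hball⟩ := Metric.isOpen_iff.1 hclosed.isOpen_compl b hb
    refine ⟨ε, hε, 0, le_rfl, fun x hx hxε => ?_⟩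
    -- If the slice over `b` is empty, so are all slices over the `ε`-ball: no point of the
    -- polyhedron has residual below `ε`.
    exact absurd ⟨x, hx, rfl⟩ (hball (by rwa [Metric.mem_ball, dist_eq_norm]))

end ErrorBound

/-! ### The split problem and the Euclidean geometry of pairs -/

/-- The problem of minimizing `⟪cost, v⟫ - (α / 2) ‖v - center‖²` subject to `A v + e = rhs`, with
the slack `e` in a product of intervals, with proximal parameter `ρ` and penalty parameter `μ`. -/
structure SplitProblem (V J : Type*) [NormedAddCommGroup V] [InnerProductSpace ℝ V]
    [Fintype J] where
  A : V →L[ℝ] EuclideanSpace ℝ J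
  rhs : EuclideanSpace ℝ J
  lower : J → ℝ
  upper : J → ℝ
  bounded : J → Prop
  cost : V
  center : V
  α : ℝ
  ρ : ℝ
  μ : ℝ

/-- The squared Euclidean norm of a pair. -/
def normSq {V W : Type*} [NormedAddCommGroup V] [NormedAddCommGroup W] (d : V × W) : ℝ :=
  ‖d.1‖ ^ 2 + ‖d.2‖ ^ 2

section normSq

variable {V W : Type*} [NormedAddCommGroup V] [NormedAddCommGroup W]

theorem normSq_nonneg (d : V × W) : 0 ≤ normSq d := by unfold normSq; positivity

theorem normSq_neg (d : V × W) : normSq (-d) = normSq d := by simp [normSq]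

theorem normSq_sub_comm (a b : V × W) : normSq (a - b) = normSq (b - a) := by
  rw [← normSq_neg, neg_sub]

theorem norm_sq_le_normSq (d : V × W) : ‖d‖ ^ 2 ≤ normSq d := by
  unfold normSq
  rcases max_cases ‖d.1‖ ‖d.2‖ with h | h <;>
  · rw [Prod.norm_def, h.1]
    nlinarith [sq_nonneg ‖d.1‖, sq_nonneg ‖d.2‖]

theorem normSq_le (d : V × W) : normSq d ≤ 2 * ‖d‖ ^ 2 := by
  have h1 := pow_le_pow_left₀ (norm_nonneg d.1) (norm_fst_le d) 2
  have h2 := pow_le_pow_left₀ (norm_nonneg d.2) (norm_snd_le d) 2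
  unfold normSq
  linarith

theorem norm_add_sq_le (a b : V) {t : ℝ} (ht : 0 < t) :
    ‖a + b‖ ^ 2 ≤ (1 + t) * ‖a‖ ^ 2 + (1 + 1 / t) * ‖b‖ ^ 2 := by
  have h1 : ‖a + b‖ ^ 2 ≤ (‖a‖ + ‖b‖) ^ 2 :=
    pow_le_pow_left₀ (norm_nonneg _) (norm_add_le a b) 2
  have h2 : (1 + t) * ‖a‖ ^ 2 + (1 + 1 / t) * ‖b‖ ^ 2 - (‖a‖ + ‖b‖) ^ 2
      = (t * ‖a‖ - ‖b‖) ^ 2 / t := by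
    field_simp
    ring
  have h3 : 0 ≤ (t * ‖a‖ - ‖b‖) ^ 2 / t := by positivity
  linarith

theorem normSq_add_le (a b : V × W) {t : ℝ} (ht : 0 < t) :
    normSq (a + b) ≤ (1 + t) * normSq a + (1 + 1 / t) * normSq b := by
  have h1 := norm_add_sq_le a.1 b.1 ht
  have h2 := norm_add_sq_le a.2 b.2 ht
  unfold normSq
  rw [Prod.fst_add, Prod.snd_add]
  linarith

end normSq

section pairInner

variable {V W : Type*} [NormedAddCommGroup V] [InnerProductSpace ℝ V]
  [NormedAddCommGroup W] [InnerProductSpace ℝ W]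

/-- The Euclidean inner product of pairs. -/
def pairInner (a b : V × W) : ℝ := inner ℝ a.1 b.1 + inner ℝ a.2 b.2

theorem two_inner_le {U : Type*} [NormedAddCommGroup U] [InnerProductSpace ℝ U] (u v : U) {t : ℝ}
    (ht : 0 < t) : 2 * inner ℝ u v ≤ t * ‖u‖ ^ 2 + ‖v‖ ^ 2 / t := by
  have h1 := real_inner_le_norm u v
  have h2 : t * ‖u‖ ^ 2 + ‖v‖ ^ 2 / t - 2 * (‖u‖ * ‖v‖) = (t * ‖u‖ - ‖v‖) ^ 2 / t := by
    field_simp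
    ring
  have h3 : 0 ≤ (t * ‖u‖ - ‖v‖) ^ 2 / t := by positivity
  linarith

theorem two_pairInner_le (a b : V × W) {t : ℝ} (ht : 0 < t) :
    2 * pairInner a b ≤ t * normSq a + normSq b / t := by
  have h1 := two_inner_le a.1 b.1 ht
  have h2 := two_inner_le a.2 b.2 ht
  unfold pairInner normSq
  rw [add_div]
  linarith

theorem norm_sub_add_smul_sq (u w d : V) (β : ℝ) :
    ‖u - (w + β • d)‖ ^ 2 = ‖u - w‖ ^ 2 + β ^ 2 * ‖d‖ ^ 2 - 2 * β * inner ℝ (u - w) d := by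
  rw [← sub_sub, norm_sub_sq_real, inner_smul_right, norm_smul, mul_pow, Real.norm_eq_abs, sq_abs]
  ring

theorem normSq_sub_add_smul (u w d : V × W) (β : ℝ) :
    normSq (u - (w + β • d)) =
      normSq (u - w) + β ^ 2 * normSq d - 2 * β * pairInner (u - w) d := by
  simp only [normSq, pairInner, Prod.fst_sub, Prod.snd_sub, Prod.fst_add, Prod.snd_add,
    Prod.smul_fst, Prod.smul_snd, norm_sub_add_smul_sq]
  ring

theorem pairInner_sub_left (a b c : V × W) :
    pairInner (a - b) c = pairInner a c - pairInner b c := by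
  simp only [pairInner, Prod.fst_sub, Prod.snd_sub, inner_sub_left]
  ring

end pairInner

/-! ### The proximal augmented Lagrangian -/

namespace SplitProblem

variable {V J : Type*} [NormedAddCommGroup V] [InnerProductSpace ℝ V] [Fintype J]
  (S : SplitProblem V J)

/-- The box of slacks. -/
def slackSet : Set (EuclideanSpace ℝ J) :=
  {e | ∀ j, S.lower j ≤ e j ∧ (S.bounded j → e j ≤ S.upper j)}

/-- The linear part of the constraint residual. -/
def coupling : V × EuclideanSpace ℝ J →L[ℝ] EuclideanSpace ℝ J :=
  S.A.comp (ContinuousLinearMap.fst ℝ V (EuclideanSpace ℝ J)) +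
    ContinuousLinearMap.snd ℝ V (EuclideanSpace ℝ J)

theorem coupling_apply (x : V × EuclideanSpace ℝ J) : S.coupling x = S.A x.1 + x.2 := rfl

/-- The constraint residual. -/
def res (x : V × EuclideanSpace ℝ J) : EuclideanSpace ℝ J := S.coupling x - S.rhs

/-- The objective. -/
def obj (v : V) : ℝ := inner ℝ S.cost v - S.α / 2 * ‖v - S.center‖ ^ 2

/-- The gradient of the objective. -/
def objGrad (v : V) : V := S.cost - S.α • (v - S.center)

/-- The proximal augmented Lagrangian with penalty `ν`, multiplier `y` and proximal center `w`. -/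
def lag (ν : ℝ) (y : EuclideanSpace ℝ J) (w x : V × EuclideanSpace ℝ J) : ℝ :=
  S.obj x.1 + inner ℝ y (S.res x) + ν / 2 * ‖S.res x‖ ^ 2 + S.ρ / 2 * normSq (x - w)

/-- The derivative of the proximal augmented Lagrangian. -/
def lagGrad (ν : ℝ) (y : EuclideanSpace ℝ J) (w x : V × EuclideanSpace ℝ J) :
    V × EuclideanSpace ℝ J →L[ℝ] ℝ :=
  (innerSL ℝ (S.objGrad x.1 + S.ρ • (x.1 - w.1))).comp
      (ContinuousLinearMap.fst ℝ V (EuclideanSpace ℝ J)) +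
    (innerSL ℝ (S.ρ • (x.2 - w.2))).comp (ContinuousLinearMap.snd ℝ V (EuclideanSpace ℝ J)) +
    (innerSL ℝ (y + ν • S.res x)).comp S.coupling

/-- The Hessian of the proximal augmented Lagrangian. -/
def lagHess (ν : ℝ) : V × EuclideanSpace ℝ J →L[ℝ] V × EuclideanSpace ℝ J →L[ℝ] ℝ :=
  (S.ρ - S.α) • (innerSL ℝ).bilinearComp (ContinuousLinearMap.fst ℝ V (EuclideanSpace ℝ J))
      (ContinuousLinearMap.fst ℝ V (EuclideanSpace ℝ J)) +
    S.ρ • (innerSL ℝ).bilinearComp (ContinuousLinearMap.snd ℝ V (EuclideanSpace ℝ J))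
      (ContinuousLinearMap.snd ℝ V (EuclideanSpace ℝ J)) +
    ν • (innerSL ℝ).bilinearComp S.coupling S.coupling

theorem lagGrad_apply (ν : ℝ) (y : EuclideanSpace ℝ J) (w x d : V × EuclideanSpace ℝ J) :
    S.lagGrad ν y w x d = inner ℝ (S.objGrad x.1 + S.ρ • (x.1 - w.1)) d.1 +
      inner ℝ (S.ρ • (x.2 - w.2)) d.2 + inner ℝ (y + ν • S.res x) (S.coupling d) := rfl

theorem lagHess_apply (ν : ℝ) (d d' : V × EuclideanSpace ℝ J) :
    S.lagHess ν d d' = (S.ρ - S.α) * inner ℝ d.1 d'.1 + S.ρ * inner ℝ d.2 d'.2 +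
      ν * inner ℝ (S.coupling d) (S.coupling d') := rfl

theorem res_add (x d : V × EuclideanSpace ℝ J) : S.res (x + d) = S.res x + S.coupling d := by
  simp only [res, map_add]
  abel

theorem res_sub_res (x x' : V × EuclideanSpace ℝ J) :
    S.res x - S.res x' = S.coupling (x - x') := by
  simp only [res, map_sub]
  abel

theorem obj_add (v d : V) :
    S.obj (v + d) = S.obj v + inner ℝ (S.objGrad v) d - S.α / 2 * ‖d‖ ^ 2 := by
  have : v + d - S.center = (v - S.center) + d := by abel
  simp only [obj, objGrad, this, norm_add_sq_real, inner_add_right, inner_sub_left,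
    inner_smul_left]
  simp only [conj_trivial]
  ring

theorem isQuadratic_lag (ν : ℝ) (y : EuclideanSpace ℝ J) (w : V × EuclideanSpace ℝ J) :
    IsQuadratic (S.lag ν y w) (S.lagGrad ν y w) (S.lagHess ν) := by
  constructor
  · intro x d
    have h1 : (x.1 + d.1) - w.1 = (x.1 - w.1) + d.1 := by abel
    have h2 : (x.2 + d.2) - w.2 = (x.2 - w.2) + d.2 := by abel
    simp only [lag, lagGrad_apply, lagHess_apply, res_add, normSq, Prod.fst_add, Prod.fst_sub,
      Prod.snd_add, Prod.snd_sub, obj_add, h1, h2, norm_add_sq_real, inner_add_right,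
      inner_add_left, inner_smul_left, conj_trivial, real_inner_self_eq_norm_sq]
    ring
  · intro x d
    ext d'
    · simp only [ContinuousLinearMap.coe_comp, Function.comp_apply, add_apply, lagGrad_apply,
        lagHess_apply, res_add, objGrad, Prod.fst_add, Prod.snd_add, inner_add_left,
        inner_sub_left, inner_smul_left, conj_trivial]
      ring
    · simp only [ContinuousLinearMap.coe_comp, Function.comp_apply, add_apply, lagGrad_apply,
        lagHess_apply, res_add, objGrad, Prod.fst_add, Prod.snd_add, inner_add_left,
        inner_sub_left, inner_smul_left, conj_trivial]
      ring

/-- The proximal term gives curvature `ρ` to both blocks, the concave penalty takes `α` from the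
first, and the quadratic residual term only helps. -/
theorem le_lagHess {ν : ℝ} (hν : 0 ≤ ν) (hα : 0 ≤ S.α) (d : V × EuclideanSpace ℝ J) :
    (S.ρ - S.α) * normSq d ≤ S.lagHess ν d d := by
  simp only [lagHess_apply, real_inner_self_eq_norm_sq, normSq]
  nlinarith [sq_nonneg ‖d.2‖, sq_nonneg ‖S.coupling d‖]

theorem le_lagHess' {ν : ℝ} (hν : 0 ≤ ν) (hα : 0 ≤ S.α) (hρ : S.α ≤ S.ρ)
    (d : V × EuclideanSpace ℝ J) : (S.ρ - S.α) * ‖d‖ ^ 2 ≤ S.lagHess ν d d :=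
  (mul_le_mul_of_nonneg_left (norm_sq_le_normSq d) (sub_nonneg.2 hρ)).trans
    (S.le_lagHess hν hα d)

theorem isPolyhedral_slackSet : IsPolyhedral {x : V × EuclideanSpace ℝ J | x.2 ∈ S.slackSet} := by
  have : {x : V × EuclideanSpace ℝ J | x.2 ∈ S.slackSet} =
      ⋂ j, ({x | S.lower j ≤ x.2 j} ∩ {x | S.bounded j → x ∈ {x | x.2 j ≤ S.upper j}}) := by
    ext x
    simp [slackSet]
  rw [this]
  have hp : ∀ j, ∀ x : V × EuclideanSpace ℝ J, x.2 j =
      ((EuclideanSpace.proj j).comp (ContinuousLinearMap.snd ℝ V (EuclideanSpace ℝ J))) x :=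
    fun j x => rfl
  refine IsPolyhedral.iInter fun j => IsPolyhedral.inter ?_ (isPolyhedral_imp ?_)
  · simp only [hp]
    exact isPolyhedral_ge _ _
  · simp only [hp]
    exact isPolyhedral_le _ _

theorem convex_slackSet : Convex ℝ S.slackSet := by
  intro a ha b hb s t hs ht hst j
  simp only [PiLp.add_apply, PiLp.smul_apply, smul_eq_mul]
  have h : s = 1 - t := by linarith
  have hs' : 0 ≤ 1 - t := by linarith
  subst h
  refine ⟨?_, fun hj => ?_⟩
  · nlinarith [mul_le_mul_of_nonneg_left (ha j).1 hs', mul_le_mul_of_nonneg_left (hb j).1 ht]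
  · nlinarith [mul_le_mul_of_nonneg_left ((ha j).2 hj) hs',
      mul_le_mul_of_nonneg_left ((hb j).2 hj) ht]

/-- The pairs with a slack in the box. -/
def slackDomain : Set (V × EuclideanSpace ℝ J) := {x | x.2 ∈ S.slackSet}

/-- The pairs that satisfy all constraints. -/
def feasibleDomain : Set (V × EuclideanSpace ℝ J) := {x | x.2 ∈ S.slackSet ∧ S.res x = 0}

theorem convex_slackDomain : Convex ℝ S.slackDomain := fun _ ha _ hb _ _ hs ht hst =>
  S.convex_slackSet ha hb hs ht hst

theorem isClosed_slackDomain : IsClosed S.slackDomain := S.isPolyhedral_slackSet.isClosed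

theorem isClosed_feasibleDomain : IsClosed S.feasibleDomain :=
  S.isClosed_slackDomain.inter
    (isClosed_eq (S.coupling.continuous.sub continuous_const) continuous_const)

end SplitProblem

/-- The variational inequality satisfied by a minimizer over a convex set. -/
theorem IsQuadratic.grad_nonneg {X : Type*} [NormedAddCommGroup X] [NormedSpace ℝ X] {f : X → ℝ}
    {G : X → X →L[ℝ] ℝ} {Q : X →L[ℝ] X →L[ℝ] ℝ} (hf : IsQuadratic f G Q) {D : Set X}
    (hD : Convex ℝ D) {x : X} (hx : x ∈ D) (hmin : IsMinOn f D x) {x' : X} (hx' : x' ∈ D) :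
    0 ≤ G x (x' - x) := by
  refine nonneg_of_eventually_quadratic (c := Q (x' - x) (x' - x) / 2) ?_
  filter_upwards [Ioc_mem_nhdsGT (zero_lt_one' ℝ)] with t ht
  have h := hmin (hD.add_smul_sub_mem hx hx' ⟨ht.1.le, ht.2⟩)
  simp only [Set.mem_ofPred_eq] at h
  rw [hf.add_smul] at h
  linarith

/-! ### Dual function, proximal envelope and potential -/

namespace SplitProblem

variable {V J : Type*} [NormedAddCommGroup V] [InnerProductSpace ℝ V] [Fintype J]
  (S : SplitProblem V J)

/-- The conditions on the parameters and the data under which the algorithm converges. -/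
structure Admissible (δ : ℝ) : Prop where
  α_pos : 0 < S.α
  α_lt_ρ : S.α < S.ρ
  μ_pos : 0 < S.μ
  δ_pos : 0 < δ
  coupling_le : ∀ d, ‖S.coupling d‖ ^ 2 ≤ δ ^ 2 * normSq d
  coercive : ∀ v, (S.μ + S.α) * ‖v‖ ^ 2 ≤ S.μ * ‖S.A v‖ ^ 2
  small : S.μ * δ ^ 2 * (1 + S.μ * δ / (S.ρ - S.α)) ^ 2 ≤ 4 / 9 * (S.ρ + S.μ)
  feasible : S.feasibleDomain.Nonempty
  bddBelow : ∃ c, ∀ x ∈ S.feasibleDomain, c ≤ S.obj x.1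

/-- The minimizer of the proximal augmented Lagrangian. -/
def dualMin (y : EuclideanSpace ℝ J) (w : V × EuclideanSpace ℝ J) : V × EuclideanSpace ℝ J :=
  Classical.epsilon fun x => x ∈ S.slackDomain ∧ IsMinOn (S.lag S.μ y w) S.slackDomain x

/-- The minimizer of the proximal objective under all constraints. -/
def primalMin (w : V × EuclideanSpace ℝ J) : V × EuclideanSpace ℝ J :=
  Classical.epsilon fun x => x ∈ S.feasibleDomain ∧ IsMinOn (S.lag 0 0 w) S.feasibleDomain x

/-- The value of the dual function. -/
def dualVal (y : EuclideanSpace ℝ J) (w : V × EuclideanSpace ℝ J) : ℝ :=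
  S.lag S.μ y w (S.dualMin y w)

/-- The value of the proximal envelope. -/
def primalVal (w : V × EuclideanSpace ℝ J) : ℝ := S.lag 0 0 w (S.primalMin w)

/-- The potential function of the algorithm. -/
def potential (y : EuclideanSpace ℝ J) (w x : V × EuclideanSpace ℝ J) : ℝ :=
  S.lag S.μ y w x - 2 * S.dualVal y w + 2 * S.primalVal w

/-- The square of the length of one iteration. -/
def progress (y : EuclideanSpace ℝ J)
    (w x x' : V × EuclideanSpace ℝ J) : ℝ :=
  normSq (x' - x) + ‖S.res (S.dualMin y w)‖ ^ 2 + normSq (x' - w)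

theorem lag_change_center (ν : ℝ) (y : EuclideanSpace ℝ J) (w w' x : V × EuclideanSpace ℝ J) :
    S.lag ν y w' x = S.lag ν y w x + S.ρ / 2 * (normSq (x - w') - normSq (x - w)) := by
  unfold lag; ring

theorem lag_change_multiplier (ν : ℝ) (y y' : EuclideanSpace ℝ J)
    (w x : V × EuclideanSpace ℝ J) :
    S.lag ν y' w x = S.lag ν y w x + inner ℝ (y' - y) (S.res x) := by
  unfold lag; rw [inner_sub_left]; ring

variable {S} {δ : ℝ}

namespace Admissible

theorem gap_pos (h : S.Admissible δ) : 0 < S.ρ - S.α := sub_pos.2 h.α_lt_ρ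

theorem ρ_pos (h : S.Admissible δ) : 0 < S.ρ := h.α_pos.trans h.α_lt_ρ

theorem dualMin_spec [FiniteDimensional ℝ V] (h : S.Admissible δ)
    (y : EuclideanSpace ℝ J) (w : V × EuclideanSpace ℝ J) :
    S.dualMin y w ∈ S.slackDomain ∧ IsMinOn (S.lag S.μ y w) S.slackDomain (S.dualMin y w) := by
  refine Classical.epsilon_spec
    (p := fun x => x ∈ S.slackDomain ∧ IsMinOn (S.lag S.μ y w) S.slackDomain x) ?_
  obtain ⟨x₀, hx₀⟩ := h.feasible
  exact (S.isQuadratic_lag S.μ y w).exists_isMinOn h.gap_pos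
    (S.le_lagHess' h.μ_pos.le h.α_pos.le h.α_lt_ρ.le) S.isClosed_slackDomain ⟨x₀, hx₀.1⟩

theorem primalMin_spec [FiniteDimensional ℝ V] (h : S.Admissible δ) (w : V × EuclideanSpace ℝ J) :
    S.primalMin w ∈ S.feasibleDomain ∧
      IsMinOn (S.lag 0 0 w) S.feasibleDomain (S.primalMin w) := by
  refine Classical.epsilon_spec
    (p := fun x => x ∈ S.feasibleDomain ∧ IsMinOn (S.lag 0 0 w) S.feasibleDomain x) ?_
  exact (S.isQuadratic_lag 0 0 w).exists_isMinOn h.gap_pos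
    (S.le_lagHess' le_rfl h.α_pos.le h.α_lt_ρ.le) S.isClosed_feasibleDomain h.feasible

theorem dualVal_le [FiniteDimensional ℝ V] (h : S.Admissible δ)
    (y : EuclideanSpace ℝ J) (w : V × EuclideanSpace ℝ J)
    {x : V × EuclideanSpace ℝ J} (hx : x ∈ S.slackDomain) : S.dualVal y w ≤ S.lag S.μ y w x :=
  (h.dualMin_spec y w).2 hx

theorem primalVal_le [FiniteDimensional ℝ V] (h : S.Admissible δ)
    (w : V × EuclideanSpace ℝ J) {x : V × EuclideanSpace ℝ J}
    (hx : x ∈ S.feasibleDomain) : S.primalVal w ≤ S.lag 0 0 w x :=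
  (h.primalMin_spec w).2 hx

/-- Weak duality: at the feasible point `primalMin` the multiplier and penalty terms vanish. -/
theorem dualVal_le_primalVal [FiniteDimensional ℝ V] (h : S.Admissible δ)
    (y : EuclideanSpace ℝ J) (w : V × EuclideanSpace ℝ J) :
    S.dualVal y w ≤ S.primalVal w := by
  have h1 := (h.primalMin_spec w).1
  have h2 := h.dualVal_le y w (x := S.primalMin w) h1.1
  have h3 : S.lag S.μ y w (S.primalMin w) = S.primalVal w := by
    simp [primalVal, lag, h1.2]
  rwa [h3] at h2

/-- The potential is `(L - d) + (P - d) + P`, with both brackets nonnegative. -/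
theorem primalVal_le_potential [FiniteDimensional ℝ V] (h : S.Admissible δ)
    (y : EuclideanSpace ℝ J) (w : V × EuclideanSpace ℝ J)
    {x : V × EuclideanSpace ℝ J} (hx : x ∈ S.slackDomain) :
    S.primalVal w ≤ S.potential y w x := by
  have h1 := h.dualVal_le y w hx
  have h2 := h.dualVal_le_primalVal y w
  unfold potential
  linarith

theorem exists_le_primalVal [FiniteDimensional ℝ V] (h : S.Admissible δ) :
    ∃ c, ∀ w, c ≤ S.primalVal w := by
  obtain ⟨c, hc⟩ := h.bddBelow
  refine ⟨c, fun w => ?_⟩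
  have h1 := (h.primalMin_spec w).1
  have h2 := hc _ h1
  have h3 : S.primalVal w = S.obj (S.primalMin w).1 + S.ρ / 2 * normSq (S.primalMin w - w) := by
    simp [primalVal, lag, h1.2]
  have h4 : 0 ≤ S.ρ / 2 * normSq (S.primalMin w - w) :=
    mul_nonneg (by linarith [h.ρ_pos]) (normSq_nonneg _)
  linarith

theorem dualMin_grad_nonneg [FiniteDimensional ℝ V] (h : S.Admissible δ)
    (y : EuclideanSpace ℝ J) (w : V × EuclideanSpace ℝ J)
    {x : V × EuclideanSpace ℝ J} (hx : x ∈ S.slackDomain) :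
    0 ≤ S.lagGrad S.μ y w (S.dualMin y w) (x - S.dualMin y w) :=
  (S.isQuadratic_lag S.μ y w).grad_nonneg S.convex_slackDomain (h.dualMin_spec y w).1
    (h.dualMin_spec y w).2 hx

theorem monotone (h : S.Admissible δ) (y : EuclideanSpace ℝ J) (w x x' : V × EuclideanSpace ℝ J) :
    (S.ρ - S.α) * normSq (x' - x) ≤
      S.lagGrad S.μ y w x' (x' - x) - S.lagGrad S.μ y w x (x' - x) := by
  have h1 := (S.isQuadratic_lag S.μ y w).grad_add x (x' - x)
  rw [add_sub_cancel] at h1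
  rw [h1, add_apply, add_sub_cancel_left]
  exact S.le_lagHess h.μ_pos.le h.α_pos.le _

/-- The dual error bound. -/
theorem exists_dual_error_bound [FiniteDimensional ℝ V] (h : S.Admissible δ) :
    ∃ σ : ℝ, 0 < σ ∧ ∀ y w, normSq (S.dualMin y w - S.primalMin w) ≤
      σ ^ 2 * ‖S.res (S.dualMin y w)‖ ^ 2 := by
  obtain ⟨s, hs, hS⟩ := S.isPolyhedral_slackSet
  obtain ⟨σ, hσ, hlip⟩ := exists_lipschitz_minimizer hs S.coupling (S.lagHess 0) h.gap_pos
    (S.le_lagHess' le_rfl h.α_pos.le h.α_lt_ρ.le)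
  have hmem : ∀ x, x ∈ polyhedron s ↔ x ∈ S.slackDomain := fun x => by
    rw [← hS]; rfl
  refine ⟨2 * (σ + 1), by positivity, fun y w => ?_⟩
  obtain ⟨hd, hdm⟩ := h.dualMin_spec y w
  obtain ⟨hp, hpm⟩ := h.primalMin_spec w
  have hres : ∀ x, S.coupling x = S.rhs ↔ S.res x = 0 := fun x => sub_eq_zero.symm
  -- The multiplier and penalty terms are constant on a slice. So `dualMin` also minimizes the plain
  -- proximal objective, over the slice through itself, and `primalMin` does so over the slice at
  -- `rhs`. The two right-hand sides differ by the residual.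
  have h1 := hlip _ _ (S.isQuadratic_lag 0 0 w) S.rhs (S.coupling (S.dualMin y w))
    (S.primalMin w) (S.dualMin y w) ⟨(hmem _).2 hp.1, (hres _).2 hp.2⟩
    (fun x hx => hpm ⟨(hmem x).1 hx.1, (hres x).1 hx.2⟩) ⟨(hmem _).2 hd, rfl⟩ (fun x hx => by
      have h2 := hdm ((hmem x).1 hx.1)
      have h3 : S.res x = S.res (S.dualMin y w) := by simp only [res, hx.2]
      simp only [Set.mem_ofPred_eq, lag, h3] at h2 ⊢
      simp only [inner_zero_left, zero_div, zero_mul, add_zero]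
      linarith)
  have h2 : ‖S.dualMin y w - S.primalMin w‖ ^ 2 ≤ (σ * ‖S.res (S.dualMin y w)‖) ^ 2 :=
    pow_le_pow_left₀ (norm_nonneg _) h1 2
  have h3 := normSq_le (S.dualMin y w - S.primalMin w)
  have h4 : 0 ≤ ‖S.res (S.dualMin y w)‖ ^ 2 := sq_nonneg _
  nlinarith

/-- Moving the centre shifts the gradient by `ρ (w' - w)`, and the gradient is strongly monotone
with modulus `ρ - α`. -/
theorem normSq_dualMin_sub_le [FiniteDimensional ℝ V] (h : S.Admissible δ)
    (y : EuclideanSpace ℝ J) (w w' : V × EuclideanSpace ℝ J) :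
    normSq (S.dualMin y w' - S.dualMin y w) ≤ (S.ρ / (S.ρ - S.α)) ^ 2 * normSq (w' - w) := by
  have hm := h.gap_pos
  set x := S.dualMin y w
  set x' := S.dualMin y w'
  have h1 := h.dualMin_grad_nonneg y w (h.dualMin_spec y w').1
  have h2 := h.dualMin_grad_nonneg y w' (h.dualMin_spec y w).1
  have h3 := h.monotone y w x x'
  have h4 : S.lagGrad S.μ y w x' (x' - x) =
      S.lagGrad S.μ y w' x' (x' - x) + S.ρ * pairInner (w' - w) (x' - x) := by
    simp only [lagGrad_apply, pairInner, inner_add_left, inner_sub_left, inner_smul_left,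
      conj_trivial, Prod.fst_sub, Prod.snd_sub]
    ring
  have h5 : S.lagGrad S.μ y w' x' (x' - x) ≤ 0 := by
    rw [← neg_sub x x', map_neg]
    linarith
  have h6 := two_pairInner_le (w' - w) (x' - x) (t := S.ρ / (S.ρ - S.α)) (div_pos h.ρ_pos hm)
  have hρ := h.ρ_pos
  have h7 : S.ρ * (2 * pairInner (w' - w) (x' - x)) ≤
      S.ρ ^ 2 / (S.ρ - S.α) * normSq (w' - w) + (S.ρ - S.α) * normSq (x' - x) := by
    calc S.ρ * (2 * pairInner (w' - w) (x' - x)) ≤ S.ρ * _ := mul_le_mul_of_nonneg_left h6 hρ.le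
      _ = _ := by field_simp
  have h8 : (S.ρ - S.α) * normSq (x' - x) ≤ S.ρ ^ 2 / (S.ρ - S.α) * normSq (w' - w) := by
    linarith
  calc normSq (x' - x) ≤ (S.ρ ^ 2 / (S.ρ - S.α) * normSq (w' - w)) / (S.ρ - S.α) := by
        rw [le_div_iff₀ hm]; linarith
    _ = _ := by field_simp

end Admissible

/-! ### One sweep and the decrease of the potential -/

/-- `x'` is obtained from `x` by minimizing over the first and then over the second block. -/
structure Sweep (S : SplitProblem V J) (y : EuclideanSpace ℝ J)
    (w x x' : V × EuclideanSpace ℝ J) : Prop where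
  fst_opt : ∀ d : V, S.lagGrad S.μ y w (x'.1, x.2) (d, 0) = 0
  snd_mem : x' ∈ S.slackDomain
  snd_opt : ∀ e ∈ S.slackSet, 0 ≤ S.lagGrad S.μ y w x' (0, e - x'.2)

namespace Admissible

variable {y : EuclideanSpace ℝ J} {w x x' : V × EuclideanSpace ℝ J}

theorem norm_A_le (h : S.Admissible δ) (v : V) : ‖S.A v‖ ≤ δ * ‖v‖ := by
  have := h.coupling_le (v, 0)
  simp only [coupling_apply, add_zero, normSq, norm_zero] at this
  refine abs_le_of_sq_le_sq' ?_ (mul_nonneg h.δ_pos.le (norm_nonneg _)) |>.2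
  nlinarith

/-- Each block minimization gains half its curvature times the squared move. The slack block has
curvature `ρ + μ`. The first block has `ρ - α` plus the contribution of `μ ‖A v‖²`, which coercivity
raises to at least `ρ + μ`. -/
theorem lag_sweep_le (h : S.Admissible δ) (hsw : Sweep S y w x x') (hx : x ∈ S.slackDomain) :
    S.lag S.μ y w x' + (S.ρ + S.μ) / 2 * normSq (x' - x) ≤ S.lag S.μ y w x := by
  have hq := S.isQuadratic_lag S.μ y w
  have h1 := hq.add (x'.1, x.2) (x.1 - x'.1, 0)
  have e1 : ((x'.1, x.2) : V × EuclideanSpace ℝ J) + (x.1 - x'.1, 0) = x := by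
    ext1 <;> simp
  rw [e1, hsw.fst_opt] at h1
  have h2 := hq.add x' (0, x.2 - x'.2)
  have e2 : x' + ((0, x.2 - x'.2) : V × EuclideanSpace ℝ J) = (x'.1, x.2) := by
    ext1 <;> simp
  rw [e2] at h2
  have h3 := hsw.snd_opt x.2 hx
  have h4 := h.coercive (x.1 - x'.1)
  have h5 : S.lagHess S.μ (x.1 - x'.1, 0) (x.1 - x'.1, 0) =
      (S.ρ - S.α) * ‖x.1 - x'.1‖ ^ 2 + S.μ * ‖S.A (x.1 - x'.1)‖ ^ 2 := by
    simp [lagHess_apply, coupling_apply]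
  have h6 : S.lagHess S.μ (0, x.2 - x'.2) (0, x.2 - x'.2) =
      S.ρ * ‖x.2 - x'.2‖ ^ 2 + S.μ * ‖x.2 - x'.2‖ ^ 2 := by
    simp [lagHess_apply, coupling_apply]
  rw [normSq_sub_comm]
  simp only [normSq, Prod.fst_sub, Prod.snd_sub]
  rw [h5] at h1
  rw [h6] at h2
  nlinarith

/-- The point `x'` fails joint optimality only because the first block was optimized against the old
slack. This leaves a gradient error of `μ` times the adjoint of `A` applied to `x'.2 - x.2`, and
strong monotonicity turns it into a distance. -/
theorem normSq_sweep_sub_dualMin_le [FiniteDimensional ℝ V] (h : S.Admissible δ)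
    (hsw : Sweep S y w x x') :
    normSq (x' - S.dualMin y w) ≤
      (S.μ * δ / (S.ρ - S.α)) ^ 2 * ‖x'.2 - x.2‖ ^ 2 := by
  have hm := h.gap_pos
  set u := S.dualMin y w with hu
  have h1 := h.dualMin_grad_nonneg y w hsw.snd_mem
  have h2 := h.monotone y w u x'
  have hq := S.isQuadratic_lag S.μ y w
  have h3 := hq.grad_add (x'.1, x.2) (0, x'.2 - x.2)
  have e1 : ((x'.1, x.2) : V × EuclideanSpace ℝ J) + (0, x'.2 - x.2) = x' := by
    ext1 <;> simp
  rw [e1] at h3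
  have h4 : S.lagGrad S.μ y w x' (u - x') =
      S.lagGrad S.μ y w x' (u.1 - x'.1, 0) + S.lagGrad S.μ y w x' (0, u.2 - x'.2) := by
    rw [← map_add]
    congr 1
    ext1 <;> simp
  have h5 := hsw.snd_opt u.2 (h.dualMin_spec y w).1
  have h6 : S.lagGrad S.μ y w x' (u.1 - x'.1, 0) =
      S.μ * inner ℝ (x'.2 - x.2) (S.A (u.1 - x'.1)) := by
    rw [h3, add_apply, hsw.fst_opt]
    simp [lagHess_apply, coupling_apply]
  have h7 : S.lagGrad S.μ y w x' (x' - u) = -S.lagGrad S.μ y w x' (u - x') := by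
    rw [← map_neg, neg_sub]
  have h8 : -inner ℝ (x'.2 - x.2) (S.A (u.1 - x'.1)) ≤ ‖x'.2 - x.2‖ * (δ * ‖x'.1 - u.1‖) := by
    rw [norm_sub_rev x'.1]
    exact (neg_le_abs _).trans ((abs_real_inner_le_norm _ _).trans
      (mul_le_mul_of_nonneg_left (h.norm_A_le _) (norm_nonneg (x'.2 - x.2))))
  have h9 : (S.ρ - S.α) * normSq (x' - u) ≤ S.μ * δ * (‖x'.2 - x.2‖ * ‖x'.1 - u.1‖) := by
    nlinarith [mul_le_mul_of_nonneg_left h8 h.μ_pos.le]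
  have h10 : ‖x'.1 - u.1‖ ^ 2 ≤ normSq (x' - u) := by
    simp only [normSq, Prod.fst_sub]
    linarith [sq_nonneg ‖(x' - u).2‖]
  have hc : 0 < S.μ * δ := mul_pos h.μ_pos h.δ_pos
  rw [div_pow, div_mul_eq_mul_div, le_div_iff₀ (by positivity)]
  nlinarith [sq_nonneg (S.μ * δ * ‖x'.2 - x.2‖ - (S.ρ - S.α) * ‖x'.1 - u.1‖),
    mul_le_mul_of_nonneg_left h9 hm.le, mul_le_mul_of_nonneg_left h10 (sq_nonneg (S.ρ - S.α))]

theorem normSq_sub_dualMin_le [FiniteDimensional ℝ V] (h : S.Admissible δ)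
    (hsw : Sweep S y w x x') :
    normSq (x - S.dualMin y w) ≤
      (1 + S.μ * δ / (S.ρ - S.α)) ^ 2 * normSq (x' - x) := by
  have ht : 0 < S.μ * δ / (S.ρ - S.α) := div_pos (mul_pos h.μ_pos h.δ_pos) h.gap_pos
  have h2 := h.normSq_sweep_sub_dualMin_le hsw
  set t := S.μ * δ / (S.ρ - S.α) with ht_def
  -- With this weight the two terms add up to exactly `(1 + t) ^ 2`, the square of the triangle
  -- inequality.
  have h1 := normSq_add_le (x - x') (x' - S.dualMin y w) ht
  rw [sub_add_sub_cancel] at h1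
  have h3 : ‖x'.2 - x.2‖ ^ 2 ≤ normSq (x' - x) := by
    simp only [normSq, Prod.snd_sub]
    linarith [sq_nonneg ‖(x' - x).1‖]
  rw [normSq_sub_comm x x'] at h1
  have h4 : (1 + 1 / t) * normSq (x' - S.dualMin y w) ≤ (1 + 1 / t) * (t ^ 2 * normSq (x' - x)) :=
    mul_le_mul_of_nonneg_left
      (h2.trans (mul_le_mul_of_nonneg_left h3 (sq_nonneg t))) (by positivity)
  have h5 : (1 + 1 / t) * (t ^ 2 * normSq (x' - x)) = (t ^ 2 + t) * normSq (x' - x) := by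
    field_simp
  rw [h5] at h4
  linarith

/-- Sufficient decrease of the potential function. -/
theorem exists_potential_le [FiniteDimensional ℝ V] (h : S.Admissible δ) :
    ∃ β₀ : ℝ, 0 < β₀ ∧ β₀ ≤ 1 ∧ ∀ β : ℝ, 0 < β → β < β₀ →
    ∃ c : ℝ, 0 < c ∧ ∀ y₀ y w w' x x', x ∈ S.slackDomain → Sweep S y w x x' →
      y = y₀ + S.μ • S.res x → w' = w + β • (x' - w) →
      S.potential y w' x' + c * S.progress y w x x' ≤ S.potential y₀ w x := by
  obtain ⟨σ, hσ, herr⟩ := h.exists_dual_error_bound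
  have hm := h.gap_pos
  have hρ := h.ρ_pos
  have hμ := h.μ_pos
  -- The three summands collect the costs of order `β²`: the proximal term at the new centre, the
  -- drift of `dualMin` with the centre, and the gap between `dualMin` and `primalMin`. The bound on
  -- `β` keeps them below half of the first-order gain `ρ β`.
  set κ := S.ρ / 2 + 2 * S.ρ ^ 2 / (S.ρ - S.α) + 2 * S.ρ ^ 2 * σ ^ 2 / S.μ with hκ
  have hκ0 : 0 < κ := by positivity
  refine ⟨min 1 (S.ρ / 2 / κ), by positivity, min_le_left _ _, fun β hβ0 hβ => ?_⟩
  have hβκ : β * κ ≤ S.ρ / 2 := by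
    have := hβ.le.trans (min_le_right _ _)
    rwa [le_div_iff₀ hκ0] at this
  -- Here `1 / 18 = 1 / 2 - 4 / 9`: the sweep gains `(ρ + μ) / 2` and the residual comparison `hr`
  -- spends `4 / 9 * (ρ + μ)`. The other two entries are the halves left after `hg2` and `hfin`.
  refine ⟨min ((S.ρ + S.μ) / 18) (min (S.μ / 2) (S.ρ * β / 2)), by positivity,
    fun y₀ y w w' x x' hx hsw hy hw => ?_⟩
  set c := min ((S.ρ + S.μ) / 18) (min (S.μ / 2) (S.ρ * β / 2))
  have hc1 : c ≤ (S.ρ + S.μ) / 18 := min_le_left _ _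
  have hc2 : c ≤ S.μ / 2 := (min_le_right _ _).trans (min_le_left _ _)
  have hc3 : c ≤ S.ρ * β / 2 := (min_le_right _ _).trans (min_le_right _ _)
  set D := x' - w with hD
  set u := S.dualMin y w with hu
  set u' := S.dualMin y w' with hu'
  set q := S.primalMin w with hq
  have hyy : y - y₀ = S.μ • S.res x := by rw [hy]; abel
  have ha : S.lag S.μ y w x = S.lag S.μ y₀ w x + S.μ * ‖S.res x‖ ^ 2 := by
    rw [S.lag_change_multiplier S.μ y₀ y, hyy, inner_smul_left, real_inner_self_eq_norm_sq]
    rfl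
  have hb : S.dualVal y₀ w ≤ S.dualVal y w - S.μ * inner ℝ (S.res x) (S.res u) := by
    refine (h.dualVal_le y₀ w (h.dualMin_spec y w).1).trans ?_
    rw [S.lag_change_multiplier S.μ y y₀, ← neg_sub y y₀, hyy, inner_neg_left, inner_smul_left]
    exact le_of_eq rfl
  have hc := h.lag_sweep_le hsw hx
  have hd := S.lag_change_center S.μ y w w' x'
  have he : S.dualVal y w ≤ S.dualVal y w' - S.ρ / 2 * (normSq (u' - w') - normSq (u' - w)) := by
    refine (h.dualVal_le y w (h.dualMin_spec y w').1).trans (le_of_eq ?_)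
    rw [S.lag_change_center S.μ y w' w]
    unfold dualVal
    ring
  have hf : S.primalVal w' ≤ S.primalVal w + S.ρ / 2 * (normSq (q - w') - normSq (q - w)) := by
    refine (h.primalVal_le w' (h.primalMin_spec w).1).trans (le_of_eq ?_)
    rw [S.lag_change_center 0 0 w w']
    rfl
  have hexp : ∀ a, normSq (a - w') = normSq (a - w) + β ^ 2 * normSq D
      - 2 * β * pairInner (a - w) D := fun a => by rw [hw, normSq_sub_add_smul]
  have hDD : pairInner (x' - w) D = normSq D := by
    simp only [← hD, pairInner, normSq, real_inner_self_eq_norm_sq]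
  rw [hexp, hDD] at hd
  rw [hexp] at he hf
  have hN := normSq_nonneg D
  -- The multiplier step contributes `μ (‖res x‖² - 2 ⟪res x, res u⟫) = μ ‖res x - res u‖² - μ ‖res
  -- u‖²`. The first part is absorbed by the sweep, and the second is a gain.
  have hr : S.μ * ‖S.res x - S.res u‖ ^ 2 ≤ 4 / 9 * (S.ρ + S.μ) * normSq (x' - x) := by
    rw [S.res_sub_res]
    have h1 := h.coupling_le (x - u)
    have h2 := h.normSq_sub_dualMin_le hsw
    calc S.μ * ‖S.coupling (x - u)‖ ^ 2
        ≤ S.μ * (δ ^ 2 * ((1 + S.μ * δ / (S.ρ - S.α)) ^ 2 * normSq (x' - x))) := 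
          mul_le_mul_of_nonneg_left (h1.trans (by gcongr)) hμ.le
      _ = S.μ * δ ^ 2 * (1 + S.μ * δ / (S.ρ - S.α)) ^ 2 * normSq (x' - x) := by ring
      _ ≤ _ := mul_le_mul_of_nonneg_right h.small (normSq_nonneg _)
  rw [norm_sub_sq_real] at hr
  have hg1 : 2 * β * S.ρ * pairInner (u' - u) D ≤ β ^ 2 * (2 * S.ρ ^ 2 / (S.ρ - S.α)) * normSq D := by
    have h1 := two_pairInner_le (u' - u) D (t := (S.ρ - S.α) / (S.ρ * β)) (by positivity)
    have h2 := h.normSq_dualMin_sub_le y w w'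
    have h3 : normSq (w' - w) = β ^ 2 * normSq D := by
      rw [hw, add_sub_cancel_left]
      simp only [normSq, Prod.smul_fst, Prod.smul_snd, norm_smul, Real.norm_eq_abs, mul_pow, sq_abs]
      ring
    rw [h3] at h2
    calc 2 * β * S.ρ * pairInner (u' - u) D = (S.ρ * β) * (2 * pairInner (u' - u) D) := by ring
      _ ≤ (S.ρ * β) * ((S.ρ - S.α) / (S.ρ * β) *
          ((S.ρ / (S.ρ - S.α)) ^ 2 * (β ^ 2 * normSq D)) +
            normSq D / ((S.ρ - S.α) / (S.ρ * β))) := by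
          refine mul_le_mul_of_nonneg_left (h1.trans ?_) (by positivity)
          gcongr
      _ = _ := by field_simp; ring
  have hg2 : 2 * β * S.ρ * pairInner (u - q) D ≤
      S.μ / 2 * ‖S.res u‖ ^ 2 + β ^ 2 * (2 * S.ρ ^ 2 * σ ^ 2 / S.μ) * normSq D := by
    have h1 := two_pairInner_le (u - q) D (t := S.μ / (2 * β * S.ρ * σ ^ 2)) (by positivity)
    have h2 := herr y w
    calc 2 * β * S.ρ * pairInner (u - q) D = (S.ρ * β) * (2 * pairInner (u - q) D) := by ring
      _ ≤ (S.ρ * β) * (S.μ / (2 * β * S.ρ * σ ^ 2) * (σ ^ 2 * ‖S.res u‖ ^ 2) +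
            normSq D / (S.μ / (2 * β * S.ρ * σ ^ 2))) := by
          refine mul_le_mul_of_nonneg_left (h1.trans ?_) (by positivity)
          gcongr
      _ = _ := by field_simp
  -- The cross term pairs `u' - q` with `D`. Inserting `u` separates the movement of the centre,
  -- bounded in `hg1`, from the dual error bound, used in `hg2`.
  have hsplit : pairInner (u' - w) D - pairInner (q - w) D =
      pairInner (u' - u) D + pairInner (u - q) D := by
    simp only [pairInner_sub_left]; ring
  have hsplit' : 2 * β * S.ρ * (pairInner (u' - w) D - pairInner (q - w) D) =
      2 * β * S.ρ * pairInner (u' - u) D + 2 * β * S.ρ * pairInner (u - q) D := by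
    rw [hsplit]; ring
  have hfin : β ^ 2 * κ * normSq D ≤ S.ρ * β / 2 * normSq D := by
    refine mul_le_mul_of_nonneg_right ?_ hN
    nlinarith
  have hκ' : β ^ 2 * κ * normSq D = β ^ 2 * (S.ρ / 2) * normSq D +
      β ^ 2 * (2 * S.ρ ^ 2 / (S.ρ - S.α)) * normSq D +
      β ^ 2 * (2 * S.ρ ^ 2 * σ ^ 2 / S.μ) * normSq D := by rw [hκ]; ring
  have hp1 := mul_le_mul_of_nonneg_right hc1 (normSq_nonneg (x' - x))
  have hp2 := mul_le_mul_of_nonneg_right hc2 (sq_nonneg ‖S.res u‖)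
  have hp3 := mul_le_mul_of_nonneg_right hc3 hN
  simp only [potential, progress, ← hu, ← hD]
  linarith

end Admissible

end SplitProblem

/-! ### From quadratic decrease to summable steps -/

/-- Increments controlled by the sufficient decrease of a bounded quantity, whose excess over its
limit is in turn controlled by the increments, are summable. -/
theorem summable_of_sufficient_decrease {Ψ η : ℕ → ℝ} {c C : ℝ} (hc : 0 < c) (hC : 0 < C)
    (hη : ∀ k, 0 ≤ η k) (hdec : ∀ k, Ψ (k + 1) + c * η k ^ 2 ≤ Ψ k) {l : ℝ}
    (hl : Tendsto Ψ atTop (𝓝 l)) (hbound : ∀ᶠ k in atTop, Ψ (k + 1) - l ≤ C * η k ^ 2) :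
    Summable η := by
  have hanti : Antitone Ψ := antitone_nat_of_succ_le fun k => by
    nlinarith [hdec k, sq_nonneg (η k)]
  have hge : ∀ k, l ≤ Ψ k := fun k => hanti.le_of_tendsto hl k
  obtain ⟨k₀, hk₀⟩ := eventually_atTop.1 hbound
  -- Eliminating `η k ^ 2` between `Ψ (k + 1) - l ≤ C * η k ^ 2` and the decrease gives this
  -- contraction factor.
  set q := C / (C + c) with hq
  have hq0 : 0 < q := by positivity
  have hq1 : q < 1 := by rw [hq, div_lt_one (by positivity)]; linarith
  have hstep : ∀ k, k₀ ≤ k → Ψ (k + 1) - l ≤ q * (Ψ k - l) := by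
    intro k hk
    rw [hq, div_mul_eq_mul_div, le_div_iff₀ (by positivity)]
    nlinarith [hk₀ k hk, hdec k]
  have hgeom : ∀ k, Ψ (k + k₀) - l ≤ q ^ k * (Ψ k₀ - l) := by
    intro k
    induction k with
    | zero => simp
    | succ k ih =>
      have h1 := hstep (k + k₀) (by omega)
      rw [show k + 1 + k₀ = k + k₀ + 1 by ring]
      calc _ ≤ q * (Ψ (k + k₀) - l) := h1
        _ ≤ q * (q ^ k * (Ψ k₀ - l)) := mul_le_mul_of_nonneg_left ih hq0.le
        _ = _ := by ring
  -- The decrease bounds `c * η ^ 2` by the current excess of `Ψ`, so `η` decays geometrically with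
  -- ratio `√q`.
  set K := (Ψ k₀ - l) / c with hK
  have hK0 : 0 ≤ K := div_nonneg (sub_nonneg.2 (hge k₀)) hc.le
  have hηle : ∀ k, η (k + k₀) ≤ √K * √q ^ k := by
    intro k
    rw [← Real.sqrt_sq (hη (k + k₀))]
    have hqk : q ^ k = (√q ^ k) ^ 2 := by
      rw [← pow_mul, mul_comm k 2, pow_mul, Real.sq_sqrt hq0.le]
    have hsqrt : √K * √q ^ k = √(K * q ^ k) := by
      rw [Real.sqrt_mul hK0, hqk, Real.sqrt_sq (by positivity)]
    rw [hsqrt]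
    refine Real.sqrt_le_sqrt ?_
    rw [hK, div_mul_eq_mul_div, le_div_iff₀ hc]
    have h1 := hgeom k
    have h2 := hdec (k + k₀)
    have h3 := hge (k + k₀ + 1)
    linarith
  refine (summable_nat_add_iff k₀).1 ?_
  refine Summable.of_nonneg_of_le (fun k => hη _) hηle ?_
  refine (summable_geometric_of_lt_one (Real.sqrt_nonneg q) ?_).mul_left _
  rw [Real.sqrt_lt' one_pos]
  simpa using hq1

/-! ### Complementarity patterns and KKT points -/

namespace SplitProblem

variable {V J : Type*} [NormedAddCommGroup V] [InnerProductSpace ℝ V] [Fintype J]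
  (S : SplitProblem V J)

/-- The slack-multiplier pairs in the box that satisfy the complementarity conditions given by the
signs `π` of the multipliers. -/
def face (π : J → SignType) : Set (V × EuclideanSpace ℝ J × EuclideanSpace ℝ J) :=
  {t | ∀ j, (S.lower j ≤ t.2.1 j ∧ (S.bounded j → t.2.1 j ≤ S.upper j)) ∧
    (¬ S.bounded j → 0 ≤ t.2.2 j) ∧ (π j = 0 → t.2.2 j = 0) ∧
    (π j = 1 → 0 ≤ t.2.2 j ∧ t.2.1 j = S.lower j) ∧
    (π j = -1 → t.2.2 j ≤ 0 ∧ t.2.1 j = S.upper j)}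

theorem isPolyhedral_face (π : J → SignType) : IsPolyhedral (S.face π) := by
  let E := EuclideanSpace ℝ J
  let a : J → (V × E × E →L[ℝ] ℝ) := fun j =>
    (EuclideanSpace.proj j).comp ((ContinuousLinearMap.fst ℝ E E).comp
      (ContinuousLinearMap.snd ℝ V (E × E)))
  let c : J → (V × E × E →L[ℝ] ℝ) := fun j =>
    (EuclideanSpace.proj j).comp ((ContinuousLinearMap.snd ℝ E E).comp
      (ContinuousLinearMap.snd ℝ V (E × E)))
  have : S.face π = ⋂ j, (({t | S.lower j ≤ a j t} ∩
      {t | S.bounded j → t ∈ {t | a j t ≤ S.upper j}}) ∩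
      ({t | ¬ S.bounded j → t ∈ {t | 0 ≤ c j t}} ∩ ({t | π j = 0 → t ∈ {t | c j t = 0}} ∩
      ({t | π j = 1 → t ∈ {t | 0 ≤ c j t} ∩ {t | a j t = S.lower j}} ∩
      {t | π j = -1 → t ∈ {t | c j t ≤ 0} ∩ {t | a j t = S.upper j}})))) := by
    ext t
    simp only [Set.mem_iInter]
    rfl
  rw [this]
  exact IsPolyhedral.iInter fun j =>
    ((isPolyhedral_ge _ _).inter (isPolyhedral_imp (isPolyhedral_le _ _))).inter
      ((isPolyhedral_imp (isPolyhedral_ge _ _)).inter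
        ((isPolyhedral_imp (isPolyhedral_eq _ _)).inter
          ((isPolyhedral_imp ((isPolyhedral_ge _ _).inter (isPolyhedral_eq _ _))).inter
            (isPolyhedral_imp ((isPolyhedral_le _ _).inter (isPolyhedral_eq _ _))))))

variable {S}

/-- The slack set is a product of intervals, so the variational inequality can be tested by moving
one coordinate: a positive multiplier pins the slack at its lower bound, a negative one at its upper
bound. -/
theorem mem_face_sign [DecidableEq J] {e y : EuclideanSpace ℝ J} (he : e ∈ S.slackSet)
    (hvi : ∀ e' ∈ S.slackSet, 0 ≤ inner ℝ y (e' - e)) (v : V) :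
    (v, e, y) ∈ S.face fun j => SignType.sign (y j) := by
  intro j
  have key : ∀ t : ℝ, S.lower j ≤ e j + t → (S.bounded j → e j + t ≤ S.upper j) → 0 ≤ t * y j := by
    intro t h1 h2
    have h3 := hvi (e + t • EuclideanSpace.single j 1) (by
      intro i
      by_cases hij : i = j
      · subst hij
        simpa using ⟨h1, h2⟩
      · simpa [hij] using he i)
    simpa [inner_smul_right, EuclideanSpace.inner_single_right] using h3
  have hneg : y j < 0 → S.bounded j := by
    intro hy
    by_contra hb
    have := key 1 (by linarith [(he j).1]) (fun h => absurd h hb)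
    linarith
  refine ⟨he j, fun hb => ?_, fun h0 => sign_eq_zero_iff.1 h0, fun h1 => ?_, fun h1 => ?_⟩
  · by_contra hy
    exact hb (hneg (not_le.1 hy))
  · have hy : 0 < y j := sign_eq_one_iff.1 h1
    refine ⟨hy.le, le_antisymm ?_ (he j).1⟩
    have := key (S.lower j - e j) (by simp) (fun hb => by
      have := (he j).2 hb
      linarith [(he j).1])
    have := nonneg_of_mul_nonneg_left this hy
    linarith
  · have hy : y j < 0 := sign_eq_neg_one_iff.1 h1
    have hb := hneg hy
    refine ⟨hy.le, le_antisymm ((he j).2 hb) ?_⟩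
    have h2 := key (S.upper j - e j) (by linarith [(he j).1, (he j).2 hb]) (fun _ => by simp)
    show S.upper j ≤ e j
    by_contra hlt
    push Not at hlt
    have := (he j).2 hb
    have : 0 < S.upper j - e j := by
      rcases this.eq_or_lt with h | h
      · linarith
      · linarith
    nlinarith

theorem inner_eq_sum (a b : EuclideanSpace ℝ J) : inner ℝ a b = ∑ j, a j * b j := by
  simp [PiLp.inner_apply, mul_comm]

theorem face_inner_nonneg {π : J → SignType} {t : V × EuclideanSpace ℝ J × EuclideanSpace ℝ J}
    (ht : t ∈ S.face π) {e : EuclideanSpace ℝ J} (he : e ∈ S.slackSet) :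
    0 ≤ inner ℝ t.2.2 (e - t.2.1) := by
  rw [inner_eq_sum]
  refine Finset.sum_nonneg fun j _ => ?_
  obtain ⟨h1, h2, h3, h4, h5⟩ := ht j
  simp only [PiLp.sub_apply]
  rcases hπ : π j with _ | _ | _
  · rw [h3 hπ, zero_mul]
  · obtain ⟨h6, h7⟩ := h5 hπ
    by_cases hb : S.bounded j
    · have := (he j).2 hb
      exact mul_nonneg_of_nonpos_of_nonpos h6 (by linarith)
    · rw [le_antisymm h6 (h2 hb), zero_mul]
  · obtain ⟨h6, h7⟩ := h4 hπ
    exact mul_nonneg h6 (by linarith [(he j).1])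

/-- Within one face, a coordinate has zero multiplier or a pinned slack. This orthogonality makes
the objective constant on the KKT points of a face. -/
theorem face_inner_eq_zero {π : J → SignType}
    {t t' : V × EuclideanSpace ℝ J × EuclideanSpace ℝ J} (ht : t ∈ S.face π)
    (ht' : t' ∈ S.face π) : inner ℝ t.2.2 (t'.2.1 - t.2.1) = 0 := by
  rw [inner_eq_sum]
  refine Finset.sum_eq_zero fun j _ => ?_
  obtain ⟨h1, h2, h3, h4, h5⟩ := ht j
  obtain ⟨-, -, -, h4', h5'⟩ := ht' j
  simp only [PiLp.sub_apply]
  rcases hπ : π j with _ | _ | _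
  · rw [h3 hπ, zero_mul]
  · rw [(h5 hπ).2, (h5' hπ).2, sub_self, mul_zero]
  · rw [(h4 hπ).2, (h4' hπ).2, sub_self, mul_zero]

variable (S)

/-- The Karush-Kuhn-Tucker equations: feasibility and stationarity. -/
structure IsKKT (t : V × EuclideanSpace ℝ J × EuclideanSpace ℝ J) : Prop where
  res_eq : S.res (t.1, t.2.1) = 0
  stationary : ∀ d, inner ℝ (S.objGrad t.1) d + inner ℝ t.2.2 (S.A d) = 0

variable {S}

/-- The objective takes the same value at all KKT points with the same complementarity pattern. -/
theorem IsKKT.obj_eq {π : J → SignType} {t t' : V × EuclideanSpace ℝ J × EuclideanSpace ℝ J}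
    (hk : S.IsKKT t) (hk' : S.IsKKT t') (ht : t ∈ S.face π) (ht' : t' ∈ S.face π) :
    S.obj t'.1 = S.obj t.1 := by
  -- The linear term of the expansion at `t` vanishes by stationarity and the orthogonality on a
  -- face, leaving only `-α / 2 * ‖t'.1 - t.1‖ ^ 2`. Exchanging `t` and `t'` forces this to be zero.
  have key : ∀ {t t' : V × EuclideanSpace ℝ J × EuclideanSpace ℝ J}, S.IsKKT t → S.IsKKT t' →
      t ∈ S.face π → t' ∈ S.face π → S.obj t'.1 = S.obj t.1 - S.α / 2 * ‖t'.1 - t.1‖ ^ 2 := by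
    intro t t' hk hk' ht ht'
    have h1 := S.obj_add t.1 (t'.1 - t.1)
    rw [add_sub_cancel] at h1
    have h2 := hk.stationary (t'.1 - t.1)
    have h3 : S.A (t'.1 - t.1) = -(t'.2.1 - t.2.1) := by
      have e1 := hk.res_eq
      have e2 := hk'.res_eq
      simp only [res, coupling_apply] at e1 e2
      rw [map_sub, eq_neg_iff_add_eq_zero]
      have : S.A t'.1 - S.A t.1 + (t'.2.1 - t.2.1) =
        (S.A t'.1 + t'.2.1 - S.rhs) - (S.A t.1 + t.2.1 - S.rhs) := by abel
      rw [this, e1, e2, sub_zero]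
    rw [h3, inner_neg_right, face_inner_eq_zero ht ht'] at h2
    linarith
  have h1 := key hk hk' ht ht'
  have h2 := key hk' hk ht' ht
  rw [norm_sub_rev] at h2
  linarith

/-- The proximal augmented Lagrangian relative to a KKT point. -/
theorem IsKKT.lag_eq {t : V × EuclideanSpace ℝ J × EuclideanSpace ℝ J} (hk : S.IsKKT t) (ν : ℝ)
    (y : EuclideanSpace ℝ J) (w x : V × EuclideanSpace ℝ J) :
    S.lag ν y w x = S.obj t.1 + inner ℝ (y - t.2.2) (S.res x) + ν / 2 * ‖S.res x‖ ^ 2 +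
      S.ρ / 2 * normSq (x - w) - S.α / 2 * ‖x.1 - t.1‖ ^ 2 + inner ℝ t.2.2 (x.2 - t.2.1) := by
  have h1 := S.obj_add t.1 (x.1 - t.1)
  rw [add_sub_cancel] at h1
  have h2 := hk.stationary (x.1 - t.1)
  have h3 : S.A (x.1 - t.1) = S.res x - (x.2 - t.2.1) := by
    have e1 := hk.res_eq
    simp only [res, coupling_apply] at e1
    have : S.rhs = S.A t.1 + t.2.1 := (sub_eq_zero.1 e1).symm
    rw [res, coupling_apply, this, map_sub]
    abel
  rw [h3, inner_sub_right t.2.2] at h2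
  unfold lag
  rw [h1, inner_sub_left]
  linarith

variable {δ : ℝ}

namespace Admissible

/-- Near a KKT point with the same complementarity pattern, the potential function differs from the
objective by a quadratic error. -/
theorem exists_abs_potential_sub_le [FiniteDimensional ℝ V] (h : S.Admissible δ) :
    ∃ C : ℝ, 0 < C ∧ ∀ (π : J → SignType) (t t' : V × EuclideanSpace ℝ J × EuclideanSpace ℝ J)
      (y : EuclideanSpace ℝ J) (w : V × EuclideanSpace ℝ J) (a : ℝ), S.IsKKT t → t ∈ S.face π →
      t' ∈ S.face π → ‖y - t.2.2‖ ≤ a → ‖t'.1 - t.1‖ ≤ a → ‖t'.2.1 - t.2.1‖ ≤ a →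
      ‖w.1 - t.1‖ ≤ a → ‖w.2 - t.2.1‖ ≤ a →
      |S.potential y w (t'.1, t'.2.1) - S.obj t.1| ≤ C * a ^ 2 := by
  have hm := h.gap_pos
  have hρ := h.ρ_pos
  have hμ := h.μ_pos
  have hα := h.α_pos
  have hδ := h.δ_pos
  -- `C₁` bounds how far the dual value can fall below the objective; `C₂` bounds the Lagrangian
  -- error, with one summand each for the multiplier, penalty, proximal and concave terms. Weak
  -- duality makes these and the upper bound on the envelope sufficient.
  set C₁ := 1 / (2 * S.μ) + S.α * S.ρ / (2 * (S.ρ - S.α)) with hC₁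
  set C₂ := 2 * δ + S.μ * δ ^ 2 + 4 * S.ρ + S.α with hC₂
  have hC₁0 : 0 < C₁ := by positivity
  have hC₂0 : 0 < C₂ := by positivity
  refine ⟨C₂ + 2 * C₁ + 2 * S.ρ, by positivity, ?_⟩
  intro π t t' y w a hk ht ht' hy hv he hp hz
  have ha : 0 ≤ a := (norm_nonneg _).trans hy
  set x : V × EuclideanSpace ℝ J := (t'.1, t'.2.1) with hx
  have hxm : x ∈ S.slackDomain := fun j => (ht' j).1
  have htm : ((t.1, t.2.1) : V × EuclideanSpace ℝ J) ∈ S.feasibleDomain :=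
    ⟨fun j => (ht j).1, hk.res_eq⟩
  have hsq : ∀ {b : ℝ}, 0 ≤ b → b ≤ a → b ^ 2 ≤ a ^ 2 := fun h1 h2 => pow_le_pow_left₀ h1 h2 2
  have hsv := hsq (norm_nonneg _) hv
  have hse := hsq (norm_nonneg _) he
  have hsp := hsq (norm_nonneg _) hp
  have hsz := hsq (norm_nonneg _) hz
  have hsy := hsq (norm_nonneg _) hy
  -- the Lagrangian
  have hK : |S.lag S.μ y w x - S.obj t.1| ≤ C₂ * a ^ 2 := by
    have h1 := hk.lag_eq S.μ y w x
    rw [show x.2 - t.2.1 = t'.2.1 - t.2.1 from rfl, face_inner_eq_zero ht ht'] at h1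
    have h2 : S.res x = S.coupling (x - (t.1, t.2.1)) := by
      rw [← S.res_sub_res, hk.res_eq, sub_zero]
    have h3 : ‖S.res x‖ ^ 2 ≤ δ ^ 2 * (2 * a ^ 2) := by
      rw [h2]
      refine (h.coupling_le _).trans (mul_le_mul_of_nonneg_left ?_ (sq_nonneg δ))
      simp only [normSq, hx, Prod.fst_sub, Prod.snd_sub]
      linarith
    have h4 : ‖S.res x‖ ≤ 2 * δ * a := by
      refine (abs_le_of_sq_le_sq' ?_ (by positivity)).2
      nlinarith [mul_nonneg (sq_nonneg δ) (sq_nonneg a)]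
    have h5 : |inner ℝ (y - t.2.2) (S.res x)| ≤ a * (2 * δ * a) :=
      (abs_real_inner_le_norm _ _).trans (mul_le_mul hy h4 (norm_nonneg _) ha)
    have h6 : normSq (x - w) ≤ 8 * a ^ 2 := by
      have e1 : ‖x.1 - w.1‖ ≤ 2 * a := by
        have := norm_sub_le_norm_sub_add_norm_sub x.1 t.1 w.1
        rw [norm_sub_rev t.1] at this
        have : ‖x.1 - t.1‖ ≤ a := hv
        linarith
      have e2 : ‖x.2 - w.2‖ ≤ 2 * a := by
        have := norm_sub_le_norm_sub_add_norm_sub x.2 t.2.1 w.2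
        rw [norm_sub_rev t.2.1] at this
        have : ‖x.2 - t.2.1‖ ≤ a := he
        linarith
      have e3 := pow_le_pow_left₀ (norm_nonneg _) e1 2
      have e4 := pow_le_pow_left₀ (norm_nonneg _) e2 2
      simp only [normSq, Prod.fst_sub, Prod.snd_sub]
      linarith
    have h7 : 0 ≤ normSq (x - w) := normSq_nonneg _
    have h8 : ‖x.1 - t.1‖ ^ 2 ≤ a ^ 2 := hsv
    have h9 := sq_nonneg ‖x.1 - t.1‖
    have h10 := sq_nonneg ‖S.res x‖
    obtain ⟨h5a, h5b⟩ := abs_le.1 h5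
    rw [abs_le, hC₂]
    have m1 := mul_le_mul_of_nonneg_left h3 hμ.le
    have m2 := mul_le_mul_of_nonneg_left h6 hρ.le
    have m3 := mul_le_mul_of_nonneg_left h8 hα.le
    have m4 := mul_nonneg hμ.le h10
    have m5 := mul_nonneg hρ.le h7
    have m6 := mul_nonneg hα.le h9
    have m7 : 0 ≤ S.μ * δ ^ 2 * a ^ 2 := by positivity
    have m8 : 0 ≤ S.ρ * a ^ 2 := by positivity
    have m9 : 0 ≤ S.α * a ^ 2 := by positivity
    constructor <;> linarith
  -- the dual function
  have hd : S.obj t.1 - C₁ * a ^ 2 ≤ S.dualVal y w := by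
    set u := S.dualMin y w with hu
    have h1 := hk.lag_eq S.μ y w u
    have h2 := face_inner_nonneg ht (h.dualMin_spec y w).1
    have h3 : -(1 / (2 * S.μ) * a ^ 2) ≤
        inner ℝ (y - t.2.2) (S.res u) + S.μ / 2 * ‖S.res u‖ ^ 2 := by
      have e1 := two_inner_le (-(y - t.2.2)) (S.res u) (t := 1 / S.μ) (by positivity)
      rw [inner_neg_left, norm_neg] at e1
      have e2 : ‖S.res u‖ ^ 2 / (1 / S.μ) = S.μ * ‖S.res u‖ ^ 2 := by field_simp
      rw [e2] at e1
      have e3 : 1 / S.μ * ‖y - t.2.2‖ ^ 2 ≤ 1 / S.μ * a ^ 2 := by gcongr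
      have e4 : 1 / (2 * S.μ) * a ^ 2 = 1 / S.μ * a ^ 2 / 2 := by field_simp
      linarith
    have h4 : -(S.α * S.ρ / (2 * (S.ρ - S.α)) * a ^ 2) ≤
        S.ρ / 2 * normSq (u - w) - S.α / 2 * ‖u.1 - t.1‖ ^ 2 := by
      -- The weight satisfies `α (1 + t) = ρ`, so the proximal term at `u` exactly absorbs the
      -- concave term.
      have e1 := norm_add_sq_le (u.1 - w.1) (w.1 - t.1) (t := (S.ρ - S.α) / S.α) (by positivity)
      rw [sub_add_sub_cancel] at e1
      have e2 : ‖u.1 - w.1‖ ^ 2 ≤ normSq (u - w) := by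
        simp only [normSq, Prod.fst_sub]
        linarith [sq_nonneg ‖(u - w).2‖]
      have e3 : S.α / 2 * ‖u.1 - t.1‖ ^ 2 ≤ S.ρ / 2 * ‖u.1 - w.1‖ ^ 2 +
          S.α * S.ρ / (2 * (S.ρ - S.α)) * ‖w.1 - t.1‖ ^ 2 := by
        calc _ ≤ S.α / 2 * _ := mul_le_mul_of_nonneg_left e1 (by positivity)
          _ = _ := by
            field_simp
            ring
      have e4 : S.α * S.ρ / (2 * (S.ρ - S.α)) * ‖w.1 - t.1‖ ^ 2 ≤
          S.α * S.ρ / (2 * (S.ρ - S.α)) * a ^ 2 := by gcongr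
      have e5 := mul_le_mul_of_nonneg_left e2 hρ.le
      linarith
    rw [hC₁]
    unfold dualVal
    rw [← hu, h1]
    linarith
  -- the proximal envelope
  have hP : S.primalVal w ≤ S.obj t.1 + S.ρ * a ^ 2 := by
    refine (h.primalVal_le w htm).trans ?_
    have : S.lag 0 0 w (t.1, t.2.1) = S.obj t.1 + S.ρ / 2 * normSq ((t.1, t.2.1) - w) := by
      simp [lag, hk.res_eq]
    rw [this, normSq_sub_comm]
    simp only [normSq, Prod.fst_sub, Prod.snd_sub]
    nlinarith
  have hPd := h.dualVal_le_primalVal y w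
  obtain ⟨hK1, hK2⟩ := abs_le.1 hK
  have m1 : 0 ≤ S.ρ * a ^ 2 := by positivity
  have m2 : 0 ≤ C₁ * a ^ 2 := by positivity
  unfold potential
  rw [abs_le]
  constructor <;> linarith

end Admissible

end SplitProblem

/-! ### KKT error bound and convergence -/

theorem norm_le_of_normSq_le {V W : Type*} [NormedAddCommGroup V] [NormedAddCommGroup W]
    {d : V × W} {η : ℝ} (hη : 0 ≤ η) (hd : normSq d ≤ η ^ 2) : ‖d‖ ≤ η :=
  (abs_le_of_sq_le_sq' ((norm_sq_le_normSq d).trans hd) hη).2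

namespace SplitProblem

variable {V J : Type*} [NormedAddCommGroup V] [InnerProductSpace ℝ V] [Fintype J]
  (S : SplitProblem V J)

section KKT

variable [CompleteSpace V]

/-- The linear part of the KKT equations. -/
def kktMap : V × EuclideanSpace ℝ J × EuclideanSpace ℝ J →L[ℝ] EuclideanSpace ℝ J × V :=
  let E := EuclideanSpace ℝ J
  (S.A.comp (ContinuousLinearMap.fst ℝ V (E × E)) +
    (ContinuousLinearMap.fst ℝ E E).comp (ContinuousLinearMap.snd ℝ V (E × E))).prod
  ((-S.α) • ContinuousLinearMap.fst ℝ V (E × E) +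
    (ContinuousLinearMap.adjoint S.A).comp
      ((ContinuousLinearMap.snd ℝ E E).comp (ContinuousLinearMap.snd ℝ V (E × E))))

/-- The right-hand side of the KKT equations. -/
def kktRhs : EuclideanSpace ℝ J × V := (S.rhs, -(S.cost + S.α • S.center))

theorem kktMap_sub_kktRhs (t : V × EuclideanSpace ℝ J × EuclideanSpace ℝ J) :
    S.kktMap t - S.kktRhs =
      (S.res (t.1, t.2.1), S.objGrad t.1 + ContinuousLinearMap.adjoint S.A t.2.2) := by
  ext1
  · rfl
  · change (-S.α) • t.1 + ContinuousLinearMap.adjoint S.A t.2.2 -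
      -(S.cost + S.α • S.center) = S.cost - S.α • (t.1 - S.center) + _
    module

variable {S}

theorem isKKT_iff {t : V × EuclideanSpace ℝ J × EuclideanSpace ℝ J} :
    S.IsKKT t ↔ S.kktMap t = S.kktRhs := by
  rw [← sub_eq_zero, kktMap_sub_kktRhs, Prod.mk_eq_zero]
  constructor
  · rintro ⟨h1, h2⟩
    refine ⟨h1, ext_inner_right ℝ fun d => ?_⟩
    rw [inner_add_left, ContinuousLinearMap.adjoint_inner_left, h2, inner_zero_left]
  · rintro ⟨h1, h2⟩
    refine ⟨h1, fun d => ?_⟩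
    rw [← ContinuousLinearMap.adjoint_inner_left, ← inner_add_left, h2, inner_zero_left]

variable (S)

/-- Hoffman's bound on each face, with one constant for the finitely many patterns. A single `R`
encodes both the threshold `1 / R` on the residual and the factor, so each bound persists for larger
`R`. -/
theorem exists_kkt_error_bound [FiniteDimensional ℝ V] :
    ∃ R : ℝ, 0 < R ∧ ∀ π : J → SignType, ∀ t ∈ S.face π, ‖S.kktMap t - S.kktRhs‖ * R < 1 →
      ∃ t' ∈ S.face π, S.IsKKT t' ∧ ‖t' - t‖ ≤ R * ‖S.kktMap t - S.kktRhs‖ := by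
  have key : ∀ π : J → SignType, ∀ᶠ R : ℝ in atTop, ∀ t ∈ S.face π,
      ‖S.kktMap t - S.kktRhs‖ * R < 1 →
      ∃ t' ∈ S.face π, S.IsKKT t' ∧ ‖t' - t‖ ≤ R * ‖S.kktMap t - S.kktRhs‖ := by
    intro π
    obtain ⟨ε, hε, σ, hσ, H⟩ := (S.isPolyhedral_face π).exists_error_bound S.kktMap S.kktRhs
    filter_upwards [eventually_ge_atTop σ, eventually_ge_atTop (1 / ε)] with R hR1 hR2 t ht hres
    have h1 : ‖S.kktMap t - S.kktRhs‖ < ε := by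
      have h2 : ‖S.kktMap t - S.kktRhs‖ * (1 / ε) < 1 :=
        (mul_le_mul_of_nonneg_left hR2 (norm_nonneg (S.kktMap t - S.kktRhs))).trans_lt hres
      rwa [mul_one_div, div_lt_one hε] at h2
    obtain ⟨t', ht', hk, hle⟩ := H t ht h1
    exact ⟨t', ht', isKKT_iff.2 hk,
      hle.trans (mul_le_mul_of_nonneg_right hR1 (norm_nonneg (S.kktMap t - S.kktRhs)))⟩
  obtain ⟨R, hR, H⟩ := ((eventually_gt_atTop (0 : ℝ)).and (eventually_all.2 key)).exists
  exact ⟨R, hR, H⟩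

end KKT

variable {S} {δ : ℝ}

theorem progress_nonneg (y : EuclideanSpace ℝ J) (w x x' : V × EuclideanSpace ℝ J) :
    0 ≤ S.progress y w x x' := by
  have h1 := normSq_nonneg (x' - x)
  have h2 := normSq_nonneg (x' - w)
  unfold progress
  positivity

/-- The centre and the point share their limit and its residual is zero, so the proximal and penalty
terms disappear. -/
theorem tendsto_lagGrad {y : ℕ → EuclideanSpace ℝ J} {w x d : ℕ → V × EuclideanSpace ℝ J}
    {yl : EuclideanSpace ℝ J} {xl dl : V × EuclideanSpace ℝ J} (hres : S.res xl = 0)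
    (hy : Tendsto y atTop (𝓝 yl)) (hw : Tendsto w atTop (𝓝 xl)) (hx : Tendsto x atTop (𝓝 xl))
    (hd : Tendsto d atTop (𝓝 dl)) :
    Tendsto (fun k => S.lagGrad S.μ (y k) (w k) (x k) (d k)) atTop
      (𝓝 (inner ℝ (S.objGrad xl.1) dl.1 + inner ℝ yl (S.coupling dl))) := by
  have h1 {W : ℕ → V × EuclideanSpace ℝ J} {l} (h : Tendsto W atTop (𝓝 l)) :
      Tendsto (fun k => (W k).1) atTop (𝓝 l.1) := (continuous_fst.tendsto _).comp h
  have h2 {W : ℕ → V × EuclideanSpace ℝ J} {l} (h : Tendsto W atTop (𝓝 l)) :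
      Tendsto (fun k => (W k).2) atTop (𝓝 l.2) := (continuous_snd.tendsto _).comp h
  have h3 {W : ℕ → V × EuclideanSpace ℝ J} {l} (h : Tendsto W atTop (𝓝 l)) :
      Tendsto (fun k => S.coupling (W k)) atTop (𝓝 (S.coupling l)) :=
    (S.coupling.continuous.tendsto _).comp h
  have hg : Tendsto (fun k => S.objGrad (x k).1) atTop (𝓝 (S.objGrad xl.1)) :=
    tendsto_const_nhds.sub (((h1 hx).sub tendsto_const_nhds).const_smul _)
  have hr : Tendsto (fun k => S.res (x k)) atTop (𝓝 (S.res xl)) :=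
    (h3 hx).sub tendsto_const_nhds
  have := (((hg.add (((h1 hx).sub (h1 hw)).const_smul S.ρ)).inner (𝕜 := ℝ) (h1 hd)).add
    ((((h2 hx).sub (h2 hw)).const_smul S.ρ).inner (𝕜 := ℝ) (h2 hd))).add
      ((hy.add (hr.const_smul S.μ)).inner (𝕜 := ℝ) (h3 hd))
  simp only [sub_self, smul_zero, add_zero, hres, inner_zero_left] at this
  exact this

namespace Admissible

/-- The step length only records the residual at `dualMin`; the distance from `x'` to it is
controlled by the sweep. -/
theorem exists_norm_res_sweep_le [FiniteDimensional ℝ V] (h : S.Admissible δ) :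
    ∃ C : ℝ, 0 < C ∧ ∀ y w x x' η,
    Sweep S y w x x' → 0 ≤ η → S.progress y w x x' ≤ η ^ 2 → ‖S.res x'‖ ≤ C * η := by
  have hm := h.gap_pos
  have hμ := h.μ_pos
  have hδ := h.δ_pos
  refine ⟨1 + δ * (S.μ * δ / (S.ρ - S.α)), by positivity, fun y w x x' η hsw hη hP => ?_⟩
  have h1 := normSq_nonneg (x' - x)
  have h2 := normSq_nonneg (x' - w)
  unfold progress at hP
  have h3 : ‖S.res (S.dualMin y w)‖ ≤ η :=
    (abs_le_of_sq_le_sq' (by linarith) hη).2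
  have h4 : ‖S.res x' - S.res (S.dualMin y w)‖ ≤ δ * (S.μ * δ / (S.ρ - S.α)) * η := by
    refine (abs_le_of_sq_le_sq' ?_ (by positivity)).2
    rw [S.res_sub_res]
    have h5 : ‖x'.2 - x.2‖ ^ 2 ≤ η ^ 2 := by
      have : ‖x'.2 - x.2‖ ^ 2 ≤ normSq (x' - x) := by
        simp only [normSq, Prod.snd_sub]
        linarith [sq_nonneg ‖(x' - x).1‖]
      linarith [sq_nonneg ‖S.res (S.dualMin y w)‖]
    calc _ ≤ δ ^ 2 * normSq (x' - S.dualMin y w) := h.coupling_le _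
      _ ≤ δ ^ 2 * ((S.μ * δ / (S.ρ - S.α)) ^ 2 * η ^ 2) := by
        gcongr
        exact (h.normSq_sweep_sub_dualMin_le hsw).trans (by gcongr)
      _ = _ := by ring
  have h6 := norm_add_le (S.res x' - S.res (S.dualMin y w)) (S.res (S.dualMin y w))
  rw [sub_add_cancel] at h6
  linarith

/-- After a short step, the potential function is close to one of finitely many values. -/
theorem exists_critical_values [FiniteDimensional ℝ V] [CompleteSpace V] (h : S.Admissible δ) :
    ∃ C : ℝ, 0 < C ∧ ∃ ε : ℝ, 0 < ε ∧ ∃ G : (J → SignType) → ℝ,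
      ∀ y w w' x x', ∀ β η : ℝ, 0 ≤ β → β ≤ 1 → Sweep S y w x x' → w' = w + β • (x' - w) → 0 ≤ η →
        S.progress y w x x' ≤ η ^ 2 → η < ε → ∃ π, |S.potential y w' x' - G π| ≤ C * η ^ 2 := by
  classical
  have hμ := h.μ_pos
  have hρ := h.ρ_pos
  obtain ⟨R, hR, hkkt⟩ := S.exists_kkt_error_bound
  obtain ⟨C₁, hC₁, hres⟩ := h.exists_norm_res_sweep_le
  obtain ⟨C₂, hC₂, hpot⟩ := h.exists_abs_potential_sub_le
  set N := ‖ContinuousLinearMap.adjoint S.A‖ with hN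
  have hN0 : 0 ≤ N := norm_nonneg (ContinuousLinearMap.adjoint S.A)
  set C₃ := C₁ + S.ρ + N * (S.ρ + S.μ) with hC₃
  have hC₃0 : 0 < C₃ := by positivity
  set C₄ := S.μ * C₁ + S.ρ + 1 + R * C₃ with hC₄
  have hC₄0 : 0 < C₄ := by positivity
  -- The choice of KKT point is immaterial by `IsKKT.obj_eq`. The default `0` for faces without one
  -- is never used, since the pattern found below has a KKT point.
  let G : (J → SignType) → ℝ := fun π =>
    if hex : ∃ t ∈ S.face π, S.IsKKT t then S.obj hex.choose.1 else 0
  refine ⟨C₂ * C₄ ^ 2, by positivity, 1 / (C₃ * R), by positivity, G, ?_⟩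
  intro y w w' x x' β η hβ0 hβ1 hsw hw hη hP hηε
  have hr := hres y w x x' η hsw hη hP
  have hP' := hP
  unfold progress at hP'
  have hx : ‖x' - x‖ ≤ η := norm_le_of_normSq_le hη (by
    linarith [normSq_nonneg (x' - w), sq_nonneg ‖S.res (S.dualMin y w)‖])
  have hD : ‖x' - w‖ ≤ η := norm_le_of_normSq_le hη (by
    linarith [normSq_nonneg (x' - x), sq_nonneg ‖S.res (S.dualMin y w)‖])
  have hx2 : ‖x'.2 - x.2‖ ≤ η := (norm_snd_le (x' - x)).trans hx
  have hD1 : ‖x'.1 - w.1‖ ≤ η := (norm_fst_le (x' - w)).trans hD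
  have hD2 : ‖x'.2 - w.2‖ ≤ η := (norm_snd_le (x' - w)).trans hD
  -- With this multiplier the optimality condition of the slack block is exactly complementarity.
  -- All error is left in the feasibility and stationarity equations.
  set z : EuclideanSpace ℝ J := S.ρ • (x'.2 - w.2) + (y + S.μ • S.res x') with hz
  set t : V × EuclideanSpace ℝ J × EuclideanSpace ℝ J := (x'.1, x'.2, z) with ht
  have hface : t ∈ S.face fun j => SignType.sign (z j) := by
    refine mem_face_sign hsw.snd_mem (fun e he => ?_) x'.1
    have h1 := hsw.snd_opt e he
    simpa [lagGrad_apply, coupling_apply, hz, inner_add_left] using h1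
  have hstat : S.objGrad x'.1 + ContinuousLinearMap.adjoint S.A z =
      ContinuousLinearMap.adjoint S.A (S.ρ • (x'.2 - w.2) + S.μ • (x'.2 - x.2)) -
        S.ρ • (x'.1 - w.1) := by
    refine ext_inner_right ℝ fun d => ?_
    have h1 := hsw.fst_opt d
    have h2 : S.res (x'.1, x.2) = S.res x' - (x'.2 - x.2) := by
      simp only [res, coupling_apply]; abel
    simp only [lagGrad_apply, coupling_apply, h2, inner_zero_right, add_zero] at h1
    simp only [inner_add_left, inner_sub_left, smul_sub, inner_smul_left, conj_trivial,
      ContinuousLinearMap.adjoint_inner_left, hz] at h1 ⊢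
    linarith
  have hresid : ‖S.kktMap t - S.kktRhs‖ ≤ C₃ * η := by
    rw [kktMap_sub_kktRhs, Prod.norm_def]
    refine max_le ?_ ?_
    · refine hr.trans (mul_le_mul_of_nonneg_right ?_ hη)
      rw [hC₃]
      have : 0 ≤ N * (S.ρ + S.μ) := by positivity
      linarith
    · change ‖S.objGrad x'.1 + ContinuousLinearMap.adjoint S.A z‖ ≤ _
      rw [hstat]
      have h1 : ‖S.ρ • (x'.2 - w.2) + S.μ • (x'.2 - x.2)‖ ≤ (S.ρ + S.μ) * η := by
        refine (norm_add_le _ _).trans ?_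
        rw [norm_smul, norm_smul, Real.norm_of_nonneg hρ.le, Real.norm_of_nonneg hμ.le]
        nlinarith
      have h2 : ‖S.ρ • (x'.1 - w.1)‖ ≤ S.ρ * η := by
        rw [norm_smul, Real.norm_of_nonneg hρ.le]
        exact mul_le_mul_of_nonneg_left hD1 hρ.le
      have h3 := (ContinuousLinearMap.adjoint S.A).le_opNorm
        (S.ρ • (x'.2 - w.2) + S.μ • (x'.2 - x.2))
      have h4 := mul_le_mul_of_nonneg_left h1 hN0
      have h5 : 0 ≤ C₁ * η := by positivity
      refine (norm_sub_le _ _).trans ?_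
      rw [hC₃]
      linarith
  obtain ⟨t', ht', hk, hdist⟩ := hkkt _ t hface (by
    rw [lt_div_iff₀ (by positivity)] at hηε
    calc _ ≤ C₃ * η * R := mul_le_mul_of_nonneg_right hresid hR.le
      _ = η * (C₃ * R) := by ring
      _ < 1 := hηε)
  refine ⟨fun j => SignType.sign (z j), ?_⟩
  have hG : G (fun j => SignType.sign (z j)) = S.obj t'.1 := by
    have hex : ∃ t ∈ S.face fun j => SignType.sign (z j), S.IsKKT t := ⟨t', ht', hk⟩
    simp only [G, dif_pos hex]
    exact hk.obj_eq hex.choose_spec.2 ht' hex.choose_spec.1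
  rw [hG]
  have hdist' : ‖t - t'‖ ≤ R * C₃ * η := by
    rw [norm_sub_rev]
    refine hdist.trans ?_
    rw [mul_assoc]
    exact mul_le_mul_of_nonneg_left hresid hR.le
  have d1 : ‖x'.1 - t'.1‖ ≤ R * C₃ * η := (norm_fst_le (t - t')).trans hdist'
  have d23 : ‖(t - t').2‖ ≤ R * C₃ * η := (norm_snd_le (t - t')).trans hdist'
  have d2 : ‖x'.2 - t'.2.1‖ ≤ R * C₃ * η := (norm_fst_le (t - t').2).trans d23
  have d3 : ‖z - t'.2.2‖ ≤ R * C₃ * η := (norm_snd_le (t - t').2).trans d23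
  have hw' : w' - x' = (β - 1) • (x' - w) := by rw [hw]; module
  have hwn : ‖w' - x'‖ ≤ η := by
    rw [hw', norm_smul, Real.norm_eq_abs, abs_of_nonpos (by linarith)]
    nlinarith [norm_nonneg (x' - w)]
  have p1 : 0 ≤ S.μ * C₁ * η := by positivity
  have p2 : 0 ≤ S.ρ * η := by positivity
  have hfin := hpot _ t' t y w' (C₄ * η) hk ht' hface ?_ ?_ ?_ ?_ ?_
  · rw [mul_pow, ← mul_assoc] at hfin
    exact hfin
  · have e1 : y - t'.2.2 = (z - t'.2.2) - (S.ρ • (x'.2 - w.2) + S.μ • S.res x') := by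
      rw [hz]; abel
    have e2 : ‖S.ρ • (x'.2 - w.2) + S.μ • S.res x'‖ ≤ S.ρ * η + S.μ * (C₁ * η) := by
      refine (norm_add_le _ _).trans ?_
      rw [norm_smul, norm_smul, Real.norm_of_nonneg hρ.le, Real.norm_of_nonneg hμ.le]
      gcongr
    rw [e1, hC₄]
    refine (norm_sub_le _ _).trans ?_
    linarith
  · rw [hC₄]
    exact d1.trans (by linarith)
  · rw [hC₄]
    exact d2.trans (by linarith)
  · have := norm_sub_le_norm_sub_add_norm_sub w'.1 x'.1 t'.1
    have h1 : ‖w'.1 - x'.1‖ ≤ η := (norm_fst_le (w' - x')).trans hwn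
    rw [hC₄]
    linarith
  · have := norm_sub_le_norm_sub_add_norm_sub w'.2 x'.2 t'.2.1
    have h1 : ‖w'.2 - x'.2‖ ≤ η := (norm_snd_le (w' - x')).trans hwn
    rw [hC₄]
    linarith

/-- Convergence of the algorithm to a KKT point. -/
theorem exists_tendsto [FiniteDimensional ℝ V] [CompleteSpace V] (h : S.Admissible δ) :
    ∃ β₀ : ℝ, 0 < β₀ ∧ β₀ ≤ 1 ∧ ∀ β : ℝ, 0 < β → β < β₀ →
      ∀ (x w : ℕ → V × EuclideanSpace ℝ J) (y : ℕ → EuclideanSpace ℝ J),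
        (∀ k, Sweep S (y k) (w k) (x k) (x (k + 1))) →
        (∀ k, w (k + 1) = w k + β • (x (k + 1) - w k)) →
        (∀ k, y (k + 1) = y k + S.μ • S.res (x (k + 1))) →
        ∃ xl yl, Tendsto x atTop (𝓝 xl) ∧ Tendsto w atTop (𝓝 xl) ∧ Tendsto y atTop (𝓝 yl) ∧
          xl ∈ S.feasibleDomain ∧ (∀ d, inner ℝ (S.objGrad xl.1) d + inner ℝ yl (S.A d) = 0) ∧
          ∀ e ∈ S.slackSet, 0 ≤ inner ℝ yl (e - xl.2) := by
  obtain ⟨β₀, hβ₀, hβ₀1, hdecr⟩ := h.exists_potential_le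
  obtain ⟨C, hC, ε, hε, G, hcrit⟩ := h.exists_critical_values
  obtain ⟨C₁, hC₁, hres⟩ := h.exists_norm_res_sweep_le
  obtain ⟨b, hb⟩ := h.exists_le_primalVal
  refine ⟨β₀, hβ₀, hβ₀1, fun β hβ0 hβ x w y hsw hw hy => ?_⟩
  obtain ⟨c, hc, hdec⟩ := hdecr β hβ0 hβ
  -- The multiplier is one index behind the point and the centre, matching the `y₀` and `y` of the
  -- decrease estimate. Starting at `x 1` ensures that the slack lies in its set.
  set Ψ : ℕ → ℝ := fun k => S.potential (y k) (w (k + 1)) (x (k + 1)) with hΨ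
  set P : ℕ → ℝ := fun k =>
    S.progress (y (k + 1)) (w (k + 1)) (x (k + 1)) (x (k + 2)) with hP
  have hP0 : ∀ k, 0 ≤ P k := fun k => progress_nonneg _ _ _ _
  set η : ℕ → ℝ := fun k => √(P k) with hη
  have hη0 : ∀ k, 0 ≤ η k := fun k => Real.sqrt_nonneg _
  have hηsq : ∀ k, η k ^ 2 = P k := fun k => Real.sq_sqrt (hP0 k)
  have hstep : ∀ k, Ψ (k + 1) + c * η k ^ 2 ≤ Ψ k := by
    intro k
    rw [hηsq]
    exact hdec _ _ _ _ _ _ (hsw k).snd_mem (hsw (k + 1)) (hy k) (hw (k + 1))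
  have hanti : Antitone Ψ := antitone_nat_of_succ_le fun k => by
    nlinarith [hstep k, sq_nonneg (η k)]
  have hbdd : BddBelow (Set.range Ψ) := by
    refine ⟨b, ?_⟩
    rintro _ ⟨k, rfl⟩
    exact (hb _).trans (h.primalVal_le_potential _ _ (hsw k).snd_mem)
  obtain ⟨l, hl⟩ : ∃ l, Tendsto Ψ atTop (𝓝 l) := ⟨_, tendsto_atTop_ciInf hanti hbdd⟩
  have hl' : Tendsto (fun k => Ψ (k + 1)) atTop (𝓝 l) := (tendsto_add_atTop_iff_nat 1).2 hl
  have hηsq0 : Tendsto (fun k => η k ^ 2) atTop (𝓝 0) := by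
    have h1 : Tendsto (fun k => (Ψ k - Ψ (k + 1)) / c) atTop (𝓝 0) := by
      simpa using (hl.sub hl').div_const c
    refine squeeze_zero (fun k => sq_nonneg _) (fun k => ?_) h1
    rw [le_div_iff₀ hc]
    linarith [hstep k]
  have hη_lim : Tendsto η atTop (𝓝 0) := by
    have := (Real.continuous_sqrt.tendsto 0).comp hηsq0
    rw [Real.sqrt_zero] at this
    refine this.congr fun k => ?_
    simp [Real.sqrt_sq (hη0 k)]
  have hbound : ∀ᶠ k in atTop, Ψ (k + 1) - l ≤ C * η k ^ 2 := by
    -- The values `G π` different from `l` stay a positive distance away. Eventually the error and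
    -- `|Ψ (k + 1) - l|` together are smaller than that, so the pattern of the step must have `G π =
    -- l`.
    have h1 : ∀ π, ∀ᶠ k in atTop, G π ≠ l → C * η k ^ 2 + |Ψ (k + 1) - l| < |G π - l| := by
      intro π
      by_cases hπ : G π = l
      · exact Eventually.of_forall fun k hk => absurd hπ hk
      · have h2 : Tendsto (fun k => C * η k ^ 2 + |Ψ (k + 1) - l|) atTop (𝓝 0) := by
          simpa using (hηsq0.const_mul C).add ((hl'.sub_const l).abs)
        filter_upwards [h2.eventually_lt_const (abs_pos.2 (sub_ne_zero.2 hπ))] with k hk _ using hk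
    filter_upwards [eventually_all.2 h1, hη_lim.eventually_lt_const hε] with k hk hkε
    obtain ⟨π, hπ⟩ := hcrit (y (k + 1)) (w (k + 1)) (w (k + 2)) (x (k + 1)) (x (k + 2)) β (η k)
      hβ0.le (hβ.le.trans hβ₀1) (hsw (k + 1)) (hw (k + 1)) (hη0 k) (hηsq k).ge hkε
    have hπ' : |Ψ (k + 1) - G π| ≤ C * η k ^ 2 := hπ
    have hGl : G π = l := by
      by_contra hne
      have h3 := hk π hne
      have h4 := abs_sub_le (G π) (Ψ (k + 1)) l
      rw [abs_sub_comm (G π) (Ψ (k + 1))] at h4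
      linarith
    rw [hGl] at hπ'
    exact (le_abs_self _).trans hπ'
  have hsum : Summable η := summable_of_sufficient_decrease hc hC hη0 hstep hl hbound
  have hPx : ∀ k, ‖x (k + 2) - x (k + 1)‖ ≤ η k := fun k => norm_le_of_normSq_le (hη0 k) (by
    rw [hηsq]
    simp only [hP, progress]
    linarith [normSq_nonneg (x (k + 2) - w (k + 1)),
      sq_nonneg ‖S.res (S.dualMin (y (k + 1)) (w (k + 1)))‖])
  have hPw : ∀ k, ‖x (k + 2) - w (k + 1)‖ ≤ η k := fun k => norm_le_of_normSq_le (hη0 k) (by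
    rw [hηsq]
    simp only [hP, progress]
    linarith [normSq_nonneg (x (k + 2) - x (k + 1)),
      sq_nonneg ‖S.res (S.dualMin (y (k + 1)) (w (k + 1)))‖])
  have hPr : ∀ k, ‖S.res (x (k + 2))‖ ≤ C₁ * η k := fun k =>
    hres _ _ _ _ _ (hsw (k + 1)) (hη0 k) (hηsq k).ge
  obtain ⟨xl, hxl⟩ : ∃ xl, Tendsto (fun k => x (k + 1)) atTop (𝓝 xl) :=
    cauchySeq_tendsto_of_complete (cauchySeq_of_dist_le_of_summable η (fun k => by
      rw [dist_comm, dist_eq_norm]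
      exact hPx k) hsum)
  obtain ⟨wl, hwl⟩ : ∃ wl, Tendsto (fun k => w (k + 1)) atTop (𝓝 wl) :=
    cauchySeq_tendsto_of_complete (cauchySeq_of_dist_le_of_summable η (fun k => by
      rw [dist_comm, dist_eq_norm, hw (k + 1), add_sub_cancel_left, norm_smul,
        Real.norm_of_nonneg hβ0.le]
      have h1 : β * ‖x (k + 2) - w (k + 1)‖ ≤ 1 * η k :=
        mul_le_mul (hβ.le.trans hβ₀1) (hPw k) (norm_nonneg _) zero_le_one
      simpa using h1) hsum)
  obtain ⟨yl, hyl⟩ : ∃ yl, Tendsto (fun k => y (k + 1)) atTop (𝓝 yl) :=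
    cauchySeq_tendsto_of_complete (cauchySeq_of_dist_le_of_summable (fun k => S.μ * (C₁ * η k))
      (fun k => by
        rw [dist_comm, dist_eq_norm, hy (k + 1), add_sub_cancel_left, norm_smul,
          Real.norm_of_nonneg h.μ_pos.le]
        exact mul_le_mul_of_nonneg_left (hPr k) h.μ_pos.le) ((hsum.mul_left C₁).mul_left S.μ))
  have hxl2 : Tendsto (fun k => x (k + 2)) atTop (𝓝 xl) :=
    (tendsto_add_atTop_iff_nat (f := fun k => x (k + 1)) 1).2 hxl
  have hwx : wl = xl := by
    have h1 : Tendsto (fun k => x (k + 2) - w (k + 1)) atTop (𝓝 0) :=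
      squeeze_zero_norm hPw hη_lim
    exact (sub_eq_zero.1 (tendsto_nhds_unique (hxl2.sub hwl) h1)).symm
  subst hwx
  have hcres : Continuous S.res := S.coupling.continuous.sub continuous_const
  have hres0 : S.res wl = 0 := by
    have h1 : Tendsto (fun k => S.res (x (k + 2))) atTop (𝓝 0) :=
      squeeze_zero_norm hPr (by simpa using hη_lim.const_mul C₁)
    exact tendsto_nhds_unique ((hcres.tendsto _).comp hxl2) h1
  refine ⟨wl, yl, (tendsto_add_atTop_iff_nat 1).1 hxl, (tendsto_add_atTop_iff_nat 1).1 hwl,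
    (tendsto_add_atTop_iff_nat 1).1 hyl, ⟨?_, hres0⟩, fun d => ?_, fun e he => ?_⟩
  · exact S.isClosed_slackDomain.mem_of_tendsto hxl
      (Eventually.of_forall fun k => (hsw k).snd_mem)
  · have h1 : Tendsto (fun k => ((x (k + 2)).1, (x (k + 1)).2)) atTop (𝓝 (wl.1, wl.2)) :=
      ((continuous_fst.tendsto _).comp hxl2).prodMk_nhds ((continuous_snd.tendsto _).comp hxl)
    have h2 := tendsto_lagGrad hres0 hyl hwl h1 (tendsto_const_nhds (x := ((d, 0) : V × _)))
    have h3 := tendsto_nhds_unique h2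
      (tendsto_const_nhds.congr fun k => ((hsw (k + 1)).fst_opt d).symm)
    simpa [coupling_apply] using h3
  · have h1 : Tendsto (fun k => ((0, e - (x (k + 2)).2) : V × EuclideanSpace ℝ J)) atTop
        (𝓝 (0, e - wl.2)) :=
      tendsto_const_nhds.prodMk_nhds (tendsto_const_nhds.sub ((continuous_snd.tendsto _).comp hxl2))
    have h2 := ge_of_tendsto' (tendsto_lagGrad hres0 hyl hwl hxl2 h1)
      fun k => (hsw (k + 1)).snd_opt e he
    simpa [coupling_apply] using h2

end Admissible

end SplitProblem

/-! ### Concatenated vectors -/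

section Join

variable {M N : Type*}

/-- The concatenation of two vectors. -/
def join (a : EuclideanSpace ℝ M) (b : EuclideanSpace ℝ N) : EuclideanSpace ℝ (M ⊕ N) :=
  WithLp.toLp 2 (Sum.elim a b)

/-- The first part of a concatenated vector. -/
def left (e : EuclideanSpace ℝ (M ⊕ N)) : EuclideanSpace ℝ M :=
  WithLp.toLp 2 fun i => e (Sum.inl i)

/-- The second part of a concatenated vector. -/
def right (e : EuclideanSpace ℝ (M ⊕ N)) : EuclideanSpace ℝ N :=
  WithLp.toLp 2 fun i => e (Sum.inr i)

@[simp] theorem join_inl (a : EuclideanSpace ℝ M) (b : EuclideanSpace ℝ N) (i : M) :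
    join a b (Sum.inl i) = a i := rfl

@[simp] theorem join_inr (a : EuclideanSpace ℝ M) (b : EuclideanSpace ℝ N) (i : N) :
    join a b (Sum.inr i) = b i := rfl

@[simp] theorem right_join (a : EuclideanSpace ℝ M) (b : EuclideanSpace ℝ N) :
    right (join a b) = b := rfl

theorem join_left_right (e : EuclideanSpace ℝ (M ⊕ N)) : join (left e) (right e) = e := by
  ext i
  cases i <;> rfl

theorem continuous_left : Continuous (left : EuclideanSpace ℝ (M ⊕ N) → EuclideanSpace ℝ M) := by
  unfold left; fun_prop

theorem continuous_right :
    Continuous (right : EuclideanSpace ℝ (M ⊕ N) → EuclideanSpace ℝ N) := by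
  unfold right; fun_prop

theorem join_add (a a' : EuclideanSpace ℝ M) (b b' : EuclideanSpace ℝ N) :
    join a b + join a' b' = join (a + a') (b + b') := by
  ext i
  cases i <;> rfl

theorem join_sub (a a' : EuclideanSpace ℝ M) (b b' : EuclideanSpace ℝ N) :
    join a b - join a' b' = join (a - a') (b - b') := by
  ext i
  cases i <;> rfl

theorem smul_join (c : ℝ) (a : EuclideanSpace ℝ M) (b : EuclideanSpace ℝ N) :
    c • join a b = join (c • a) (c • b) := by
  ext i
  cases i <;> rfl

variable [Fintype M] [Fintype N]

theorem inner_join (a a' : EuclideanSpace ℝ M) (b b' : EuclideanSpace ℝ N) :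
    inner ℝ (join a b) (join a' b') = inner ℝ a a' + inner ℝ b b' := by
  simp [PiLp.inner_apply]

theorem norm_join_sq (a : EuclideanSpace ℝ M) (b : EuclideanSpace ℝ N) :
    ‖join a b‖ ^ 2 = ‖a‖ ^ 2 + ‖b‖ ^ 2 := by
  simp only [← real_inner_self_eq_norm_sq, inner_join]

end Join

/-! ### Spectral bounds for the constraint matrix -/

section Spectral

variable {M N : Type*} [Fintype M] [Fintype N] [DecidableEq N]

/-- A real infimum over the empty type is `0`. -/
theorem nonempty_of_minEigenvalue_pos {A : Matrix M N ℝ} (h : 0 < minEigenvalue A) :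
    Nonempty N := by
  by_contra hN
  rw [not_nonempty_iff] at hN
  simp [minEigenvalue, Real.iInf_of_isEmpty] at h

variable [DecidableEq M]

theorem inner_toEuclideanLin_conjTranspose_mul_self (A : Matrix M N ℝ) (u v : EuclideanSpace ℝ N) :
    inner ℝ u (Matrix.toEuclideanLin (A.conjTranspose * A) v) =
      inner ℝ (Matrix.toEuclideanLin A u) (Matrix.toEuclideanLin A v) := by
  have h1 : Matrix.toEuclideanLin (A.conjTranspose * A) v =
      Matrix.toEuclideanLin A.conjTranspose (Matrix.toEuclideanLin A v) := by
    ext i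
    simp [Matrix.toLpLin_apply, Matrix.mulVec_mulVec]
  rw [h1, Matrix.toEuclideanLin_conjTranspose_eq_adjoint, LinearMap.adjoint_inner_right]

/-- Expand both sides in an orthonormal eigenbasis of `Aᵀ A`. -/
theorem minEigenvalue_mul_le (A : Matrix M N ℝ) (v : EuclideanSpace ℝ N) :
    minEigenvalue A * ‖v‖ ^ 2 ≤ ‖Matrix.toEuclideanLin A v‖ ^ 2 := by
  have hA := Matrix.isHermitian_conjTranspose_mul_self A
  set b := hA.eigenvectorBasis with hb
  have hmul : ∀ i, Matrix.toEuclideanLin (A.conjTranspose * A) (b i) = hA.eigenvalues i • b i := by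
    intro i
    ext j
    have := congrFun (hA.mulVec_eigenvectorBasis i) j
    simpa [Matrix.toLpLin_apply, hb] using this
  have hinner : ∀ i, inner ℝ (b i) (Matrix.toEuclideanLin (A.conjTranspose * A) v) =
      hA.eigenvalues i * inner ℝ (b i) v := by
    intro i
    rw [inner_toEuclideanLin_conjTranspose_mul_self, real_inner_comm,
      ← inner_toEuclideanLin_conjTranspose_mul_self, hmul, inner_smul_right, real_inner_comm]
  have h1 : ‖Matrix.toEuclideanLin A v‖ ^ 2 = ∑ i, hA.eigenvalues i * inner ℝ (b i) v ^ 2 := by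
    rw [← real_inner_self_eq_norm_sq, ← inner_toEuclideanLin_conjTranspose_mul_self,
      ← b.sum_inner_mul_inner]
    refine Finset.sum_congr rfl fun i _ => ?_
    rw [hinner, real_inner_comm v (b i)]
    ring
  have h2 : ‖v‖ ^ 2 = ∑ i, inner ℝ (b i) v ^ 2 := by
    rw [← real_inner_self_eq_norm_sq, ← b.sum_inner_mul_inner]
    refine Finset.sum_congr rfl fun i _ => ?_
    rw [real_inner_comm v (b i)]
    ring
  rw [h1, h2, Finset.mul_sum]
  refine Finset.sum_le_sum fun i _ => mul_le_mul_of_nonneg_right ?_ (sq_nonneg _)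
  exact ciInf_le (Set.finite_range _).bddBelow i

theorem toEuclideanLin_couplingMatrix (A : Matrix M N ℝ) (v e₂ : EuclideanSpace ℝ N)
    (e₁ : EuclideanSpace ℝ M) :
    Matrix.toEuclideanLin (couplingMatrix A) (join v (join e₁ e₂)) =
      join (Matrix.toEuclideanLin A v + e₁) (v - e₂) := by
  ext i
  cases i with
  | inl i =>
    simp [Matrix.toLpLin_apply, couplingMatrix, join, Matrix.fromBlocks_mulVec,
      Matrix.fromCols_mulVec, Function.comp_def]
  | inr i =>
    simp [Matrix.toLpLin_apply, couplingMatrix, join, Matrix.fromBlocks_mulVec,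
      Matrix.fromCols_mulVec, Function.comp_def, Matrix.neg_mulVec, sub_eq_add_neg]

theorem couplingNorm_nonneg (A : Matrix M N ℝ) : 0 ≤ couplingNorm A := by
  unfold couplingNorm specNorm
  positivity

theorem norm_coupling_sq_le (A : Matrix M N ℝ) (v e₂ : EuclideanSpace ℝ N)
    (e₁ : EuclideanSpace ℝ M) :
    ‖Matrix.toEuclideanLin A v + e₁‖ ^ 2 + ‖v - e₂‖ ^ 2 ≤
      couplingNorm A ^ 2 * (‖v‖ ^ 2 + (‖e₁‖ ^ 2 + ‖e₂‖ ^ 2)) := by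
  have h1 := (Matrix.toEuclideanLin (couplingMatrix A)).toContinuousLinearMap.le_opNorm
    (join v (join e₁ e₂))
  have h2 := pow_le_pow_left₀ (norm_nonneg _) h1 2
  rw [LinearMap.coe_toContinuousLinearMap', toEuclideanLin_couplingMatrix, mul_pow, norm_join_sq,
    norm_join_sq, norm_join_sq] at h2
  exact h2

/-- Test the block `-I` on a unit vector. -/
theorem one_le_couplingNorm [Nonempty N] (A : Matrix M N ℝ) : 1 ≤ couplingNorm A := by
  obtain ⟨j⟩ := ‹Nonempty N›
  have h := norm_coupling_sq_le A 0 (EuclideanSpace.single j 1) 0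
  simp at h
  rwa [abs_of_nonneg (couplingNorm_nonneg A)] at h

end Spectral

/-! ### The upper bound on the penalty parameter -/

/-- The real inequality behind the upper bound on the penalty parameter. -/
theorem penalty_small {α ρ μ δ L : ℝ} (hα : 0 < α) (hρ : α < ρ) (hL : 0 ≤ L) (hδ : 1 ≤ δ)
    (hμ0 : 0 < μ) (hμ : μ ≤ ρ * (ρ - α) ^ 2 / (4 * δ ^ 2 * (ρ + L + 2) ^ 2 - (ρ - α) ^ 2)) :
    μ * δ ^ 2 * (1 + μ * δ / (ρ - α)) ^ 2 ≤ 4 / 9 * (ρ + μ) := by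
  have hm : 0 < ρ - α := sub_pos.2 hρ
  have hρ0 : 0 < ρ := hα.trans hρ
  have hδ2 : 1 ≤ δ ^ 2 := one_le_pow₀ hδ
  have hmρ : (ρ - α) ^ 2 ≤ ρ ^ 2 := pow_le_pow_left₀ hm.le (by linarith) 2
  have hK : ρ ^ 2 ≤ (ρ + L + 2) ^ 2 := pow_le_pow_left₀ hρ0.le (by linarith) 2
  have hK' : δ ^ 2 * ρ ^ 2 ≤ δ ^ 2 * (ρ + L + 2) ^ 2 := by gcongr
  have hK'' : ρ ^ 2 ≤ δ ^ 2 * ρ ^ 2 := le_mul_of_one_le_left (by positivity) hδ2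
  have hρ2 : 0 < ρ ^ 2 := by positivity
  have hden : 0 < 4 * δ ^ 2 * (ρ + L + 2) ^ 2 - (ρ - α) ^ 2 := by linarith
  rw [le_div_iff₀ hden] at hμ
  have h1 : 4 * (μ * (δ ^ 2 * ρ ^ 2)) ≤ (ρ + μ) * (ρ - α) ^ 2 := by
    have := mul_le_mul_of_nonneg_left hK' hμ0.le
    linarith
  have h2 : 4 * (μ * δ ^ 2) ≤ ρ + μ := by
    refine le_of_mul_le_mul_right ?_ hρ2
    have := mul_le_mul_of_nonneg_left hmρ (by positivity : 0 ≤ ρ + μ)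
    linarith
  have h3 : μ ≤ μ * δ ^ 2 := le_mul_of_one_le_right hμ0.le hδ2
  have h4 : μ * δ ≤ μ * δ ^ 2 := by
    refine mul_le_mul_of_nonneg_left ?_ hμ0.le
    nlinarith
  -- From `h2` and `h3`, `4 μ δ² ≤ ρ + μ ≤ ρ + μ δ²`, hence `μ δ ≤ μ δ² ≤ ρ / 3`. Squaring the
  -- resulting `4 / 3` and using `h1` produces the constant `4 / 9`.
  have h5 : 1 + μ * δ / (ρ - α) ≤ 4 / 3 * ρ / (ρ - α) := by
    rw [le_div_iff₀ hm, add_mul, div_mul_cancel₀ _ hm.ne']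
    linarith
  have h6 : 0 ≤ 1 + μ * δ / (ρ - α) := by positivity
  calc μ * δ ^ 2 * (1 + μ * δ / (ρ - α)) ^ 2 ≤ μ * δ ^ 2 * (4 / 3 * ρ / (ρ - α)) ^ 2 := by gcongr
    _ = 4 / 9 * (4 * (μ * (δ ^ 2 * ρ ^ 2)) / (ρ - α) ^ 2) := by
      field_simp
      ring
    _ ≤ 4 / 9 * (ρ + μ) := by
      gcongr
      rw [div_le_iff₀ (by positivity)]
      exact h1

/-! ### The decoding model as a split problem -/

namespace Model

theorem exists_le_objective {M N : Type*} [Fintype N] [DecidableEq N] (Q : Model M N) {α : ℝ}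
    (hα : 0 < α) : ∃ c, ∀ v ∈ Q.feasible, c ≤ Q.objective α v := by
  set h : EuclideanSpace ℝ N := WithLp.toLp 2 fun _ => (0.5 : ℝ) with hh
  set R := √(Fintype.card N : ℝ)
  refine ⟨-(‖Q.cost‖ * R) - α / 2 * (R + ‖h‖) ^ 2, fun v hv => ?_⟩
  have hvR : ‖v‖ ≤ R := by
    rw [EuclideanSpace.norm_eq]
    refine Real.sqrt_le_sqrt ?_
    calc ∑ i, ‖v i‖ ^ 2 ≤ ∑ _i : N, (1 : ℝ) := Finset.sum_le_sum fun i _ => by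
          have := hv.2 i
          rw [Real.norm_of_nonneg this.1]
          exact pow_le_one₀ this.1 this.2
      _ = _ := by simp
  have h1 : -(‖Q.cost‖ * ‖v‖) ≤ inner ℝ Q.cost v := neg_le_of_abs_le (abs_real_inner_le_norm _ _)
  have h2 : ‖v - h‖ ^ 2 ≤ (R + ‖h‖) ^ 2 :=
    pow_le_pow_left₀ (norm_nonneg _) ((norm_sub_le v h).trans (by linarith)) 2
  have h3 := mul_le_mul_of_nonneg_left hvR (norm_nonneg Q.cost)
  have h4 := mul_le_mul_of_nonneg_left h2 hα.le
  unfold objective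
  rw [← hh]
  linarith

variable {M N : Type*} [Fintype M] [Fintype N] [DecidableEq N]

/-- The model in the form `A v + e = rhs`, where the slack vector is `(e₁, -e₂)`. -/
def toSplit (Q : Model M N) (α ρ μ : ℝ) : SplitProblem (EuclideanSpace ℝ N) (M ⊕ N) where
  A := LinearMap.toContinuousLinearMap
    { toFun := fun v => join (Q.mul v) v
      map_add' := fun u v => by rw [join_add, mul, mul, mul, map_add]
      map_smul' := fun c v => by rw [RingHom.id_apply, smul_join, mul, mul, map_smul] }
  rhs := join Q.rhs 0
  -- An equality row gets the interval `[0, 0]`, an inequality row `[0, ∞)`. A box coordinate gets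
  -- `[-1, 0]`, since its slack is `-e₂`.
  lower := Sum.elim 0 (-1)
  upper := 0
  bounded := Sum.elim Q.isEq fun _ => True
  cost := Q.cost
  center := WithLp.toLp 2 fun _ => (0.5 : ℝ)
  α := α
  ρ := ρ
  μ := μ

variable (Q : Model M N) (α ρ μ : ℝ)

theorem toSplit_A (v : EuclideanSpace ℝ N) : (Q.toSplit α ρ μ).A v = join (Q.mul v) v := rfl

theorem toSplit_obj (v : EuclideanSpace ℝ N) : (Q.toSplit α ρ μ).obj v = Q.objective α v := rfl

theorem toSplit_res (v : EuclideanSpace ℝ N) (a : EuclideanSpace ℝ M) (b : EuclideanSpace ℝ N) :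
    (Q.toSplit α ρ μ).res (v, join a b) = join (Q.mul v + a - Q.rhs) (v + b) := by
  rw [SplitProblem.res, SplitProblem.coupling_apply, toSplit_A, join_add]
  change _ - join Q.rhs 0 = _
  rw [join_sub, sub_zero]

theorem join_neg_mem_slackSet (a : EuclideanSpace ℝ M) (b : EuclideanSpace ℝ N) :
    join a (-b) ∈ (Q.toSplit α ρ μ).slackSet ↔ a ∈ Q.slacks ∧ b ∈ box N := by
  constructor
  · intro h
    constructor
    · intro i
      have := h (Sum.inl i)
      exact ⟨this.1, fun hi => le_antisymm (this.2 hi) this.1⟩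
    · intro j
      have h1 : (-1 : ℝ) ≤ -b j := (h (Sum.inr j)).1
      have h2 : -b j ≤ (0 : ℝ) := (h (Sum.inr j)).2 trivial
      constructor <;> linarith
  · rintro ⟨h1, h2⟩ (i | j)
    · exact ⟨(h1 i).1, fun hi => ((h1 i).2 hi).le⟩
    · have := h2 j
      refine ⟨?_, fun _ => ?_⟩
      · change (-1 : ℝ) ≤ -b j
        linarith
      · change -b j ≤ (0 : ℝ)
        linarith

theorem toSplit_lag (v p e₂ z₂ y₂ : EuclideanSpace ℝ N) (e₁ z₁ y₁ : EuclideanSpace ℝ M) :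
    (Q.toSplit α ρ μ).lag μ (join y₁ y₂) (p, join z₁ (-z₂)) (v, join e₁ (-e₂)) =
      Q.augLag α μ v e₁ e₂ y₁ y₂ + ρ / 2 * ‖v - p‖ ^ 2 + ρ / 2 * ‖e₁ - z₁‖ ^ 2 +
        ρ / 2 * ‖e₂ - z₂‖ ^ 2 := by
  have h1 : -e₂ - -z₂ = -(e₂ - z₂) := by abel
  simp only [SplitProblem.lag, toSplit_res, inner_join, norm_join_sq, normSq, Prod.fst_sub,
    Prod.snd_sub, join_sub, h1, norm_neg, augLag, toSplit_obj, ← sub_eq_add_neg]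
  change _ + _ + _ + ρ / 2 * _ = _
  ring

/-- The iteration is a sweep over the two blocks of the split problem. -/
theorem sweep_of_step {β : ℝ} {s s' : Iterate M N} (h : Step Q α ρ μ β s s') :
    SplitProblem.Sweep (Q.toSplit α ρ μ) (join s.y₁ s.y₂) (s.p, join s.z₁ (-s.z₂))
      (s.v, join s.e₁ (-s.e₂)) (s'.v, join s'.e₁ (-s'.e₂)) := by
  have hquad := (Q.toSplit α ρ μ).isQuadratic_lag μ (join s.y₁ s.y₂) (s.p, join s.z₁ (-s.z₂))
  have hmem : join s'.e₁ (-s'.e₂) ∈ (Q.toSplit α ρ μ).slackSet :=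
    (Q.join_neg_mem_slackSet α ρ μ _ _).2 ⟨h.e₁_update.1, h.e₂_update.1⟩
  refine ⟨fun d => ?_, hmem, fun e he => ?_⟩
  · let D : Set (EuclideanSpace ℝ N × EuclideanSpace ℝ (M ⊕ N)) :=
      {x | x.2 = join s.e₁ (-s.e₂)}
    have hD : Convex ℝ D := by
      intro a ha b hb t r ht hr htr
      have ha : a.2 = _ := ha
      have hb : b.2 = _ := hb
      change t • a.2 + r • b.2 = _
      rw [ha, hb, ← add_smul, htr, one_smul]
    have hmin : IsMinOn ((Q.toSplit α ρ μ).lag μ (join s.y₁ s.y₂) (s.p, join s.z₁ (-s.z₂))) D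
        (s'.v, join s.e₁ (-s.e₂)) := by
      rintro ⟨v, e⟩ (hve : e = _)
      subst hve
      have := h.v_update.2 (Set.mem_univ v)
      simp only [Set.mem_ofPred_eq, toSplit_lag] at this ⊢
      linarith
    -- The first block is unconstrained, so the inequality for `d` and for `-d` makes the derivative
    -- vanish.
    have key : ∀ d : EuclideanSpace ℝ N, 0 ≤ (Q.toSplit α ρ μ).lagGrad μ (join s.y₁ s.y₂)
        (s.p, join s.z₁ (-s.z₂)) (s'.v, join s.e₁ (-s.e₂)) (d, 0) := by
      intro d
      have := hquad.grad_nonneg hD (x := (s'.v, join s.e₁ (-s.e₂))) rfl hmin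
        (x' := (s'.v + d, join s.e₁ (-s.e₂))) rfl
      simpa using this
    have h1 := key d
    have h2 := key (-d)
    have h3 : ((-d, 0) : EuclideanSpace ℝ N × EuclideanSpace ℝ (M ⊕ N)) = -(d, 0) := by simp
    rw [h3, map_neg] at h2
    exact le_antisymm (neg_nonneg.1 h2) h1
  · let D : Set (EuclideanSpace ℝ N × EuclideanSpace ℝ (M ⊕ N)) :=
      {x | x.1 = s'.v ∧ x.2 ∈ (Q.toSplit α ρ μ).slackSet}
    have hD : Convex ℝ D := by
      intro a ha b hb t r ht hr htr
      refine ⟨?_, (Q.toSplit α ρ μ).convex_slackSet ha.2 hb.2 ht hr htr⟩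
      change t • a.1 + r • b.1 = _
      rw [ha.1, hb.1, ← add_smul, htr, one_smul]
    have hmin : IsMinOn ((Q.toSplit α ρ μ).lag μ (join s.y₁ s.y₂) (s.p, join s.z₁ (-s.z₂))) D
        (s'.v, join s'.e₁ (-s'.e₂)) := by
      rintro ⟨v, e⟩ ⟨hv, hve⟩
      have hv : v = s'.v := hv
      subst hv
      have he : join (left e) (-(-right e)) = e := by rw [neg_neg, join_left_right]
      rw [← he] at hve ⊢
      obtain ⟨ha, hb⟩ := (Q.join_neg_mem_slackSet α ρ μ _ _).1 hve
      -- The Lagrangian has no term coupling `e₁` and `e₂`. So the two updates, each made with the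
      -- other slack at its old value, add up to one minimization over the joint slack.
      have h1 := h.e₁_update.2 ha
      have h2 := h.e₂_update.2 hb
      simp only [Set.mem_ofPred_eq, toSplit_lag] at h1 h2 ⊢
      unfold augLag at h1 h2 ⊢
      linarith
    have := hquad.grad_nonneg hD (x := (s'.v, join s'.e₁ (-s'.e₂))) ⟨rfl, hmem⟩ hmin
      (x' := (s'.v, e)) ⟨rfl, he⟩
    rw [Prod.mk_sub_mk, sub_self] at this
    exact this

theorem mem_feasible_of_mem_feasibleDomain {x : EuclideanSpace ℝ N × EuclideanSpace ℝ (M ⊕ N)}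
    (hx : x ∈ (Q.toSplit α ρ μ).feasibleDomain) :
    x.1 ∈ Q.feasible ∧ Q.mul x.1 + left x.2 = Q.rhs ∧ x.1 = -right x.2 := by
  obtain ⟨h1, h2⟩ := hx
  have he : join (left x.2) (-(-right x.2)) = x.2 := by rw [neg_neg, join_left_right]
  rw [← he, Q.join_neg_mem_slackSet α ρ μ] at h1
  have h3 : (Q.toSplit α ρ μ).res (x.1, join (left x.2) (right x.2)) = 0 := by
    rw [join_left_right]
    exact h2
  rw [toSplit_res] at h3
  have h4 : Q.mul x.1 + left x.2 = Q.rhs := sub_eq_zero.1 (congrArg left h3)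
  have h5 : x.1 = -right x.2 := eq_neg_of_add_eq_zero_left (congrArg right h3)
  refine ⟨⟨fun i => ?_, ?_⟩, h4, h5⟩
  · have h6 : Q.mul x.1 i + left x.2 i = Q.rhs i := by rw [← h4]; rfl
    have h7 := h1.1 i
    exact ⟨by linarith, fun hi => by have := h7.2 hi; linarith⟩
  · rw [h5]
    exact h1.2

theorem mem_feasibleDomain_of_mem_feasible {v : EuclideanSpace ℝ N} (hv : v ∈ Q.feasible) :
    (v, join (Q.rhs - Q.mul v) (-v)) ∈ (Q.toSplit α ρ μ).feasibleDomain := by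
  refine ⟨(Q.join_neg_mem_slackSet α ρ μ _ _).2 ⟨fun i => ?_, hv.2⟩, ?_⟩
  · have := hv.1 i
    change 0 ≤ Q.rhs i - Q.mul v i ∧ (Q.isEq i → Q.rhs i - Q.mul v i = 0)
    exact ⟨by linarith, fun hi => by have := this.2 hi; linarith⟩
  · rw [toSplit_res]
    ext i
    cases i <;> simp

variable {Q α ρ μ}

/-- The split operator stacks `A` on the identity, so `μ ‖A v‖² ≥ α ‖v‖²`, which is the lower bound
on `μ`, gains another `μ ‖v‖²` and yields coercivity with `μ + α`. The upper bound on `μ` enters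
through `penalty_small`, and the box makes the objective bounded below. -/
theorem admissible_toSplit [DecidableEq M] {L : ℝ} (hα : 0 < α) (hρ : α < ρ) (hL : 0 ≤ L)
    (hpos : 0 < minEigenvalue Q.A) (hμ_lower : α / minEigenvalue Q.A ≤ μ)
    (hμ_upper : μ ≤ ρ * (ρ - α) ^ 2 /
      (4 * couplingNorm Q.A ^ 2 * (ρ + L + 2) ^ 2 - (ρ - α) ^ 2))
    (hne : Q.feasible.Nonempty) :
    (Q.toSplit α ρ μ).Admissible (couplingNorm Q.A) := by
  have := nonempty_of_minEigenvalue_pos hpos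
  have hδ := one_le_couplingNorm Q.A
  have hμ : 0 < μ := (div_pos hα hpos).trans_le hμ_lower
  refine ⟨hα, hρ, hμ, by linarith, fun d => ?_, fun v => ?_,
    penalty_small hα hρ hL hδ hμ hμ_upper, ?_, ?_⟩
  · obtain ⟨v, e⟩ := d
    have h1 := norm_coupling_sq_le Q.A v (-right e) (left e)
    rw [← join_left_right e]
    rw [SplitProblem.coupling_apply]
    change ‖join (Q.mul v) v + join (left e) (right e)‖ ^ 2 ≤ _
    rw [sub_neg_eq_add, norm_neg] at h1
    rw [join_add, norm_join_sq]
    change _ ≤ _ * (‖v‖ ^ 2 + ‖join (left e) (right e)‖ ^ 2)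
    rw [norm_join_sq]
    exact h1
  · rw [toSplit_A, norm_join_sq]
    change (μ + α) * ‖v‖ ^ 2 ≤ μ * _
    have h1 := minEigenvalue_mul_le Q.A v
    rw [div_le_iff₀ hpos] at hμ_lower
    have h2 := mul_le_mul_of_nonneg_right hμ_lower (sq_nonneg ‖v‖)
    have h3 := mul_le_mul_of_nonneg_left h1 hμ.le
    change _ ≤ μ * (‖Matrix.toEuclideanLin Q.A v‖ ^ 2 + ‖v‖ ^ 2)
    linarith
  · obtain ⟨v, hv⟩ := hne
    exact ⟨_, Q.mem_feasibleDomain_of_mem_feasible α ρ μ hv⟩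
  · obtain ⟨c, hc⟩ := Q.exists_le_objective hα
    exact ⟨c, fun x hx => hc _ (Q.mem_feasible_of_mem_feasibleDomain α ρ μ hx).1⟩

/-- The second-order expansion is exact, so the remainder is `-(α / 2) ‖u - v‖²`. -/
theorem hasGradientAt_objective (v : EuclideanSpace ℝ N) :
    HasGradientAt (Q.objective α) ((Q.toSplit α ρ μ).objGrad v) v := by
  rw [hasGradientAt_iff_isLittleO]
  have h1 := (Asymptotics.isLittleO_pow_sub_sub v one_lt_two).const_mul_left (-(α / 2))
  refine h1.congr_left fun u => ?_
  have h2 := (Q.toSplit α ρ μ).obj_add v (u - v)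
  rw [add_sub_cancel, toSplit_obj, toSplit_obj] at h2
  rw [h2]
  change -(α / 2) * ‖u - v‖ ^ 2 = Q.objective α v + _ - α / 2 * ‖u - v‖ ^ 2 - _ - _
  ring

/-- Convergence of the iterates for an arbitrary feasible model. -/
theorem exists_convergesTo {δ : ℝ} (h : (Q.toSplit α ρ μ).Admissible δ) :
    ∃ β₀ : ℝ, 0 < β₀ ∧ β₀ ≤ 1 ∧ ∀ β : ℝ, 0 < β → β < β₀ → ∀ s : ℕ → Iterate M N,
      Generates Q α ρ μ β s → ∃ l : Iterate M N, ConvergesTo s l ∧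
        Q.mul l.v + l.e₁ = Q.rhs ∧ l.v = l.e₂ ∧ l.v = l.p ∧ l.e₁ = l.z₁ ∧ l.e₂ = l.z₂ ∧
        IsStationary (Q.objective α) Q.feasible l.v := by
  obtain ⟨β₀, hβ₀, hβ₀1, H⟩ := h.exists_tendsto
  refine ⟨β₀, hβ₀, hβ₀1, fun β hβ0 hβ s hs => ?_⟩
  obtain ⟨xl, yl, hx, hw, hy, hfeas, hstat, hvi⟩ := H β hβ0 hβ
    (fun k => ((s k).v, join (s k).e₁ (-(s k).e₂)))
    (fun k => ((s k).p, join (s k).z₁ (-(s k).z₂)))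
    (fun k => join (s k).y₁ (s k).y₂)
    (fun k => Q.sweep_of_step α ρ μ (hs.2 k))
    (fun k => by
      have hk := hs.2 k
      simp only [Prod.mk_sub_mk, Prod.smul_mk, Prod.mk_add_mk, join_sub, smul_join, join_add,
        hk.p_update, hk.z₁_update, hk.z₂_update]
      congr 2
      module)
    (fun k => by
      have hk := hs.2 k
      rw [toSplit_res, hk.y₁_update, hk.y₂_update, ← sub_eq_add_neg]
      change _ = _ + μ • _
      rw [smul_join, join_add])
  obtain ⟨hX, hA, he₂⟩ := Q.mem_feasible_of_mem_feasibleDomain α ρ μ hfeas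
  have hleft {W : ℕ → EuclideanSpace ℝ N × EuclideanSpace ℝ (M ⊕ N)} {c}
      (hW : Tendsto W atTop (𝓝 c)) : Tendsto (fun k => left (W k).2) atTop (𝓝 (left c.2)) :=
    ((continuous_left.comp continuous_snd).tendsto _).comp hW
  have hright {W : ℕ → EuclideanSpace ℝ N × EuclideanSpace ℝ (M ⊕ N)} {c}
      (hW : Tendsto W atTop (𝓝 c)) : Tendsto (fun k => right (W k).2) atTop (𝓝 (right c.2)) :=
    ((continuous_right.comp continuous_snd).tendsto _).comp hW
  refine ⟨⟨xl.1, left xl.2, -right xl.2, xl.1, left xl.2, -right xl.2, left yl, right yl⟩,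
    ⟨?_, ?_, ?_, ?_, ?_, ?_, ?_, ?_⟩, hA, he₂, rfl, rfl, rfl, hX, fun v hv => ?_⟩
  · exact (continuous_fst.tendsto _).comp hx
  · exact hleft hx
  · simpa using (hright hx).neg
  · exact (continuous_fst.tendsto _).comp hw
  · exact hleft hw
  · simpa using (hright hw).neg
  · exact (continuous_left.tendsto _).comp hy
  · exact (continuous_right.tendsto _).comp hy
  · rw [(hasGradientAt_objective (ρ := ρ) (μ := μ) xl.1).gradient, real_inner_comm]
    have hmem := Q.mem_feasibleDomain_of_mem_feasible α ρ μ hv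
    have h1 := hvi _ hmem.1
    have h2 := hstat (v - xl.1)
    -- Two points satisfying the constraints have slacks differing by minus the image of their
    -- difference. This turns the variational inequality for slacks, combined with stationarity,
    -- into one for `v`.
    have h3 : join (Q.rhs - Q.mul v) (-v) - xl.2 = -(Q.toSplit α ρ μ).A (v - xl.1) := by
      have e1 := (Q.toSplit α ρ μ).res_sub_res (v, join (Q.rhs - Q.mul v) (-v)) xl
      rw [hmem.2, hfeas.2, sub_zero, SplitProblem.coupling_apply] at e1
      exact eq_neg_of_add_eq_zero_right e1.symm
    change 0 ≤ inner ℝ yl (join (Q.rhs - Q.mul v) (-v) - xl.2) at h1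
    rw [h3, inner_neg_right] at h1
    linarith

end Model

/-! ### Feasibility of the decoding model -/

section Code

variable {F : Type*} [Field F] [Fintype F] [DecidableEq F] [Algebra (ZMod 2) F] {m n q : ℕ}
  (bs : Module.Basis (Fin q) (ZMod 2) F) (emb : Embedding)

/-- The parity inequalities do not involve the coordinates of the zero element. -/
theorem checkMatrix_eq_zero (h : Fin 3 → F) (r : BitSet q × Fin 4) (k : Fin 3) (σ : Idx F emb)
    (hσ : (σ : F) = 0) : checkMatrix bs emb h r (k, σ) = 0 := by
  simp only [checkMatrix, Matrix.of_apply, Matrix.mul_apply]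
  refine Finset.sum_eq_zero fun a _ => ?_
  -- Multiplication by `h` fixes zero, so the column of the zero element meets only its own row, and
  -- there all bits vanish.
  by_cases ha : a.1 = k ∧ (a.2 : F) = 0
  · have h1 : ∀ i, (parityMatrix * bitBlock bs emb r.1) i a = 0 := by
      intro i
      rw [Matrix.mul_apply]
      refine Finset.sum_eq_zero fun j _ => ?_
      simp [bitBlock, bitRow, ha.2]
    have h2 := h1 r.2
    rw [Matrix.mul_apply] at h2
    rw [h2, zero_mul]
  · have h1 : rotationBlock emb h a (k, σ) = 0 := by
      simp only [rotationBlock, rotation, Matrix.of_apply, hσ, zero_mul]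
      by_cases hk : a.1 = k
      · have : (a.2 : F) ≠ 0 := fun h0 => ha ⟨hk, h0⟩
        simp [this]
      · simp [hk]
    rw [h1, mul_zero]

variable (H : Matrix (Fin m) (Fin n) F)

theorem codeMatrix_inl_eq_zero (r : Eqn H × (BitSet q × Fin 4)) (c : Var emb H)
    (hc : (c.2 : F) = 0) : codeMatrix bs emb H (Sum.inl r) c = 0 := by
  obtain ⟨τ, r⟩ := r
  simp only [codeMatrix, Matrix.of_apply, Matrix.mul_apply]
  refine Finset.sum_eq_zero fun a _ => ?_
  by_cases ha : a.2 = c.2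
  · have h1 : (a.2 : F) = 0 := by rw [ha, hc]
    obtain ⟨k, σ⟩ := a
    rw [checkMatrix_eq_zero bs emb _ r k σ h1, zero_mul]
  · simp [Matrix.kroneckerMap_apply, ha]

/-- The embedded all-zero word is feasible. -/
theorem feasible_decodingModel_nonempty (γ : Fin n → Idx F emb → ℝ) :
    (decodingModel bs emb H γ).feasible.Nonempty := by
  refine ⟨WithLp.toLp 2 fun c => if (c.2 : F) = 0 then 1 else 0, fun r => ?_, fun c => ?_⟩
  · have hmul : (decodingModel bs emb H γ).mul
        (WithLp.toLp 2 fun c => if (c.2 : F) = 0 then 1 else 0) r =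
        ∑ c, codeMatrix bs emb H r c * if (c.2 : F) = 0 then 1 else 0 := by
      simp only [Model.mul, decodingModel, Matrix.toLpLin_apply, Matrix.mulVec, dotProduct]
    rw [hmul]
    cases r with
    | inl r =>
      have h0 : ∑ c, codeMatrix bs emb H (Sum.inl r) c * (if (c.2 : F) = 0 then (1 : ℝ) else 0)
          = 0 := by
        refine Finset.sum_eq_zero fun c _ => ?_
        by_cases hc : (c.2 : F) = 0
        · rw [codeMatrix_inl_eq_zero bs emb H r c hc, zero_mul]
        · rw [if_neg hc, mul_zero]
      rw [h0]
      refine ⟨?_, fun h => h.elim⟩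
      change 0 ≤ parityRhs r.2.2
      generalize r.2.2 = i
      fin_cases i <;> simp [parityRhs]
    | inr s =>
      have h0 : ∑ c, codeMatrix bs emb H (Sum.inr s) c * (if (c.2 : F) = 0 then (1 : ℝ) else 0)
          = ∑ σ : Idx F emb, if (σ : F) = 0 then (1 : ℝ) else 0 := by
        rw [Fintype.sum_prod_type]
        simp only [codeMatrix, Matrix.of_apply]
        rw [Finset.sum_eq_single s]
        · simp
        · intro s' _ hs'
          simp [hs'.symm]
        · simp
      rw [h0]
      change _ ≤ (1 : ℝ) ∧ (emb = Embedding.constantWeight → _ = (1 : ℝ))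
      -- The zero symbol is a unit vector in the constant-weight embedding, giving row sum `1`, and
      -- the zero vector in the Flanagan embedding, giving `0 ≤ 1`.
      by_cases hemb : emb = Embedding.constantWeight
      · have h1 : ∑ σ : Idx F emb, (if (σ : F) = 0 then (1 : ℝ) else 0) = 1 := by
          rw [Finset.sum_eq_single (⟨0, Or.inl hemb⟩ : Idx F emb)]
          · simp
          · intro σ _ hσ
            rw [if_neg fun h => hσ (Subtype.ext h)]
          · simp
        exact ⟨h1.le, fun _ => h1⟩
      · have h1 : ∑ σ : Idx F emb, (if (σ : F) = 0 then (1 : ℝ) else 0) = 0 := by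
          refine Finset.sum_eq_zero fun σ _ => ?_
          rw [if_neg (σ.2.resolve_left hemb)]
        rw [h1]
        exact ⟨zero_le_one, fun h => absurd h hemb⟩
  · change (0 : ℝ) ≤ (if (c.2 : F) = 0 then 1 else 0) ∧ (if (c.2 : F) = 0 then (1 : ℝ) else 0) ≤ 1
    split_ifs <;> simp

end Code

end ProxADMM

end

/-! ### Convergence of the decoder -/

theorem theorem1 {F : Type*} [Field F] [Fintype F] [DecidableEq F] [Algebra (ZMod 2) F]
    {m n q : ℕ} (bs : Module.Basis (Fin q) (ZMod 2) F) (H : Matrix (Fin m) (Fin n) F)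
    (hH : ∀ j, 3 ≤ ProxADMM.checkDegree H j)
    (emb : ProxADMM.Embedding) (γ : Fin n → ProxADMM.Idx F emb → ℝ)
    (α ρ μ : ℝ) (L : ℝ≥0) (hα : 0 < α) (hρ : α < ρ)
    (hL : ProxADMM.IsGradLipschitz (ProxADMM.decodingModel bs emb H γ) α μ L)
    (hpos : 0 < ProxADMM.minEigenvalue (ProxADMM.codeMatrix bs emb H))
    (hμ_lower : α / ProxADMM.minEigenvalue (ProxADMM.codeMatrix bs emb H) ≤ μ)
    (hμ_upper : μ ≤ ρ * (ρ - α) ^ 2 /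
      (4 * ProxADMM.couplingNorm (ProxADMM.codeMatrix bs emb H) ^ 2 *
        (ρ + L + 2) ^ 2 - (ρ - α) ^ 2)) :
    ∃ β₀ : ℝ, 0 < β₀ ∧ β₀ ≤ 1 ∧ ∀ β : ℝ, 0 < β → β < β₀ →
      ∀ s : ℕ → ProxADMM.Iterate (ProxADMM.Row q H) (ProxADMM.Var emb H),
        ProxADMM.Generates (ProxADMM.decodingModel bs emb H γ) α ρ μ β s →
        ∃ l : ProxADMM.Iterate (ProxADMM.Row q H) (ProxADMM.Var emb H),
          ProxADMM.ConvergesTo s l ∧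
          (ProxADMM.decodingModel bs emb H γ).mul l.v + l.e₁ =
            (ProxADMM.decodingModel bs emb H γ).rhs ∧
          l.v = l.e₂ ∧ l.v = l.p ∧ l.e₁ = l.z₁ ∧ l.e₂ = l.z₂ ∧
          ProxADMM.IsStationary ((ProxADMM.decodingModel bs emb H γ).objective α)
            (ProxADMM.decodingModel bs emb H γ).feasible l.v :=
  ProxADMM.Model.exists_convergesTo <|
    ProxADMM.Model.admissible_toSplit (Q := ProxADMM.decodingModel bs emb H γ) hα hρ
      L.coe_nonneg hpos hμ_lower hμ_upper
      (ProxADMM.feasible_decodingModel_nonempty bs emb H γ)
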